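/- Fix a constant $0<\beta<1$. Let $\kappa$ be the security parameter and let the number of parties $n=n(\kappa)$ be polynomially bounded with $n\to\infty$. The communication is synchronous, and everything below is uniform: all parties and adversaries are probabilistic polynomial-time (PPT) machines in $\kappa$, which are given $\kappa$, $n$ and the number of rounds in unary. **Hybrid model.** The functionality $\mathcal F_{\mathsf{crs}}$ draws a common reference string $\mathsf{crs}$ from a fixed distribution (depending on $\kappa$) and gives it to all parties and to the adversary. The functionality $\mathcal F_{\mathsf{ae\text{-}comm}}^{*}$ itself chooses a random set $D\subseteq[n]$ of isolated parties, from a distribution that may depend on $\kappa$ and on the set $I$ of corrupted parties. The only requirement is that there is a polynomial $q$ such that, for all large $\kappa$, all $I$ with $|I|\le\beta n$ and all $i\notin I$, one has $\Pr[D=\{i\}]\ge 1/q(\kappa)$. In each round $\mathcal F_{\mathsf{ae\text{-}comm}}^{*}$ takes an input from every party, discards the inputs of the parties in $D$, computes an output for every party from the remaining inputs by a PPT interactive (stateful, randomized) machine that is given neither $D$ nor $I$ (for example: forwarding messages between pairs of parties, or distributing the message on which a committee agrees), and delivers these outputs to the parties outside $D$; the parties in $D$ receive nothing. **Protocols.**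 Let $\pi$ be a PPT $n$-party protocol in the $(\mathcal F_{\mathsf{crs}},\mathcal F_{\mathsf{ae\text{-}comm}}^{*})$-hybrid model in which each party has an input bit and outputs a bit, consisting of two parts: polynomially many rounds (in $\kappa$) in which communication is via $\mathcal F_{\mathsf{ae\text{-}comm}}^{*}$ only, followed by a single round over private point-to-point channels, in which each party may send one message to each other party. The parties have no setup besides $\mathsf{crs}$. Message filtering is dynamic: a receiver may discard messages depending on the contents of all the messages it has received. **Adversaries.** An adversary is static and malicious: it chooses $I$ at the start, knowing only $\mathsf{crs}$ (and $\kappa$, $n$, the number of rounds), and then controls the parties in $I$; in the point-to-point round it is rushing. The protocol $\pi$ is a $\beta n$-resilient Byzantine agreement protocol if for every PPT static adversary and every choice of the input bits (for each $\kappa$), the following event has negligible probability in $\kappa$: $|I|\le\beta n$, and one of these properties fails: every honest party outputs a bit (termination); all honest parties output the same bit (agreement); if all honest parties have the same input $b$, they all output $b$ (validity). **Theorem.** Let $\pi$ be a $\beta n$-resilient Byzantine agreement protocol of this form. Then some party must send $\Theta(n)$ messages in the last round. That is, there are a function $m(\kappa)=\Theta(n(\kappa))$, a PPT static adversary and a constant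 $k$ such that for all sufficiently large $\kappa$ there are input bits and a party $P_i$ for which, with probability at least $\kappa^{-k}$, the adversary corrupts at most $\beta n$ parties, $P_i$ is honest, and $P_i$ sends messages to at least $m(\kappa)$ other parties in the point-to-point round. -/

import Mathlib

open Filter Topology Asymptotics

noncomputable section

namespace BALowerBound

/-! ### Data and probabilistic programs with a step count -/

/-- The memory objects of the machine model: binary trees (a cell is either empty or holds two
pointers). Bits, unary numbers, tuples and lists are all stored as such trees. -/
inductive Data : Type
  | nil : Data
  | cons (a b : Data) : Data

namespace Data

/-- First component (the empty cell for the empty cell). -/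
def hd : Data → Data
  | nil => nil
  | cons a _ => a

/-- Second component (the empty cell for the empty cell). -/
def tl : Data → Data
  | nil => nil
  | cons _ b => b

/-- The list stored along the right spine. -/
def toList : Data → List Data
  | nil => []
  | cons a b => a :: toList b

/-- A list, stored along the right spine. -/
def ofList : List Data → Data
  | [] => nil
  | a :: l => cons a (ofList l)

/-- The `i`-th entry of a stored list, and the empty cell if there is none. -/
def get (d : Data) (i : ℕ) : Data := d.toList.getD i nil

/-- A vector with `n` entries, stored as a list. -/
def ofVec {n : ℕ} (v : Fin n → Data) : Data := ofList (List.ofFn v)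

/-- The number `n` written in unary. -/
def unary (n : ℕ) : Data := ofList (List.replicate n nil)

/-- A bit. -/
def ofBool : Bool → Data
  | false => nil
  | true => cons nil nil

/-- Reading a bit; everything that is not a bit is read as "no bit". -/
def toBool? : Data → Option Bool
  | nil => some false
  | cons nil nil => some true
  | _ => none

end Data

/-- Probabilistic programs over `Data`: variables (numbered from the innermost binding outwards),
construction and destruction of cells, a test for the empty cell, local definitions, calls of
closed programs, coin flips, and loops over a stored list. Every program halts; a program with a
polynomial step count is a probabilistic polynomial-time program, and a probabilistic
polynomial-time machine can be written as such a program by looping over a unary clock. -/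
inductive Code : Type
  | var (k : ℕ) : Code
  | nil : Code
  | cons (a b : Code) : Code
  | hd (a : Code) : Code
  | tl (a : Code) : Code
  /-- if `c` is the empty cell then `a` else `b` -/
  | ifNil (c a b : Code) : Code
  /-- compute `a`, bind it to variable `0`, and go on with `b` -/
  | letIn (a b : Code) : Code
  /-- run the program `p` in a fresh environment that holds only the value of `a` -/
  | call (p a : Code) : Code
  /-- a uniformly random bit -/
  | flip : Code
  /-- for every `x` on the list `l`, from left to right, replace the accumulator (initially `z`)
  by the value of `b`, in which variable `0` is `x` and variable `1` is the accumulator -/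
  | fold (l z b : Code) : Code

/-- Runs the body of a loop for every entry of a list, and adds up the steps. -/
def loop (body : Data → Data → PMF (Data × ℕ)) : List Data → Data → PMF (Data × ℕ)
  | [], acc => pure (acc, 0)
  | x :: l, acc => do
      let u ← body x acc
      let v ← loop body l u.1
      pure (v.1, u.2 + v.2 + 1)

/-- `p.run env` is the joint distribution of the value that the program `p` computes in the
environment `env` and of the number of steps that it takes; every elementary operation is one
step. -/
def Code.run : Code → List Data → PMF (Data × ℕ)
  | var k, env => pure (env.getD k Data.nil, 1)
  | nil, _ => pure (Data.nil, 1)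
  | cons a b, env => do
      let u ← a.run env
      let v ← b.run env
      pure (Data.cons u.1 v.1, u.2 + v.2 + 1)
  | hd a, env => do
      let u ← a.run env
      pure (u.1.hd, u.2 + 1)
  | tl a, env => do
      let u ← a.run env
      pure (u.1.tl, u.2 + 1)
  | ifNil c a b, env => do
      let u ← c.run env
      let v ← (match u.1 with
        | Data.nil => a.run env
        | Data.cons _ _ => b.run env)
      pure (v.1, u.2 + v.2 + 1)
  | letIn a b, env => do
      let u ← a.run env
      let v ← b.run (u.1 :: env)
      pure (v.1, u.2 + v.2 + 1)
  | call p a, env => do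
      let u ← a.run env
      let v ← p.run [u.1]
      pure (v.1, u.2 + v.2 + 1)
  | flip, _ => do
      let b ← PMF.uniformOfFintype Bool
      pure (Data.ofBool b, 1)
  | fold l z b, env => do
      let u ← l.run env
      let v ← z.run env
      let w ← loop (fun x acc => b.run (x :: acc :: env)) u.1.toList v.1
      pure (w.1, u.2 + v.2 + w.2 + 1)

/-! ### Interactive machines -/

/-- One activation of the interactive machine with program `M`: from its memory `s` and what it
has just received, the machine computes a new memory (first component of the result) and what it
hands out (second component). The number of steps is forgotten here. -/
def activate (M : Code) (s received : Data) : PMF (Data × Data) := do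
  let u ← M.run [s, received]
  pure (u.1.hd, u.1.tl)

/-- `Reaches M s₀ r s`: started with memory `s₀`, the machine `M` can have memory `s` after `r`
activations, for some random choices and some incoming data. -/
inductive Reaches (M : Code) (s₀ : Data) : ℕ → Data → Prop
  | start : Reaches M s₀ 0 s₀
  | step {r : ℕ} {s : Data} (received : Data) (u : Data × ℕ) :
      Reaches M s₀ r s → u ∈ (M.run [s, received]).support → Reaches M s₀ (r + 1) u.1.hd

/-- The interactive machine `M`, started with a memory in `start κ` and activated at most `T κ`
times, takes at most polynomially many steps (in `κ`) per activation, for all its random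
choices and whatever it receives. -/
def PolyTime (M : Code) (T : ℕ → ℕ) (start : ℕ → Set Data) : Prop :=
  ∃ p : Polynomial ℕ, ∀ κ, ∀ s₀ ∈ start κ, ∀ r < T κ, ∀ s, Reaches M s₀ r s →
    ∀ received, ∀ u ∈ (M.run [s, received]).support, u.2 ≤ p.eval κ

/-- Independent samples from finitely many distributions. -/
def sampleAll {α : Type} : {n : ℕ} → (Fin n → PMF α) → PMF (Fin n → α)
  | 0, _ => pure Fin.elim0
  | _ + 1, f => do
      let a ← f 0
      let v ← sampleAll fun i => f i.succ
      pure (Fin.cons a v)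

/-! ### The hybrid model and protocols -/

/-- The two ideal functionalities, for every value `κ` of the security parameter, and the number
of parties.

* The common reference string is drawn from `crs κ` and given to everybody.
* The almost-everywhere communication functionality draws a set `D` of isolated parties from
  `isolated κ I`, where `I` is the set of corrupted parties. In each round it takes one input
  from every party, replaces the inputs of the isolated parties by nothing, lets the interactive
  machine `relay` compute one output for every party, and delivers these outputs to the parties
  outside `D`. The parties in `D` get nothing. The machine `relay` knows neither `D` nor `I`. -/
structure HybridModel where
  parties : ℕ → ℕ
  crs : ℕ → PMF Data
  isolated : (κ : ℕ) → Finset (Fin (parties κ)) → PMF (Finset (Fin (parties κ)))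
  relay : Code

/-- A protocol: all parties run the program `code` (which gets the index of the party). The
number of rounds of the first part is public. -/
structure Protocol where
  rounds : ℕ → ℕ
  code : Code

/-- The memory with which party `i` starts. Its input bit is what it receives first. -/
def partyStart (H : HybridModel) (π : Protocol) (κ : ℕ) (crs : Data) (i : ℕ) : Data :=
  Data.ofList [Data.unary κ, Data.unary (H.parties κ), Data.unary (π.rounds κ), crs, Data.unary i]

/-- The memory with which the adversary starts. -/
def adversaryStart (H : HybridModel) (π : Protocol) (κ : ℕ) (crs : Data) : Data :=
  Data.ofList [Data.unary κ, Data.unary (H.parties κ), Data.unary (π.rounds κ), crs]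

/-- The memory with which the machine that relays the messages starts. -/
def relayStart (H : HybridModel) (κ : ℕ) : Data :=
  Data.ofList [Data.unary κ, Data.unary (H.parties κ)]

/-- All parties run in probabilistic polynomial time. A party is activated once in each round of
the first part, once for the point-to-point round and once to compute its output. -/
def Protocol.PPT (π : Protocol) (H : HybridModel) : Prop :=
  PolyTime π.code (fun κ => π.rounds κ + 2)
    (fun κ => {s | ∃ crs ∈ (H.crs κ).support, ∃ i < H.parties κ, s = partyStart H π κ crs i})

/-- The adversary `A` runs in probabilistic polynomial time. It is activated once to choose the
corrupted parties, once in each round of the first part, and once for the point-to-point round. -/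
def PPTAdversary (H : HybridModel) (π : Protocol) (A : Code) : Prop :=
  PolyTime A (fun κ => π.rounds κ + 2)
    (fun κ => {s | ∃ crs ∈ (H.crs κ).support, s = adversaryStart H π κ crs})

/-- The relaying machine runs in probabilistic polynomial time. -/
def RelayPPT (H : HybridModel) (π : Protocol) : Prop :=
  PolyTime H.relay π.rounds (fun κ => {relayStart H κ})

/-- For every admissible set `I` of corrupted parties and every honest party `i`, the isolated
set is exactly `{i}` with inverse-polynomial probability. -/
def HybridModel.IsolatesSingleParties (H : HybridModel) (β : ℝ) : Prop :=
  ∃ q : Polynomial ℕ, ∀ᶠ κ in atTop, ∀ I : Finset (Fin (H.parties κ)),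
    (I.card : ℝ) ≤ β * H.parties κ → ∀ i ∉ I, 1 ≤ ((q.eval κ : ℕ) : ENNReal) * H.isolated κ I {i}

/-! ### Executions with a static malicious adversary -/

/-- The situation between two rounds of the first part: the memories of the parties, what each
party has received last, and the memories of the adversary and of the relaying machine. -/
structure Config (n : ℕ) where
  memory : Fin n → Data
  received : Fin n → Data
  adversary : Data
  relay : Data

open Classical in
/-- One round of the first part. The honest parties follow the protocol; the adversary sees what
the corrupted parties have received and provides their inputs to the functionality. -/
def aeRound (H : HybridModel) (π : Protocol) (A : Code) {n : ℕ} (I D : Finset (Fin n))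
    (c : Config n) : PMF (Config n) := do
  let party ← sampleAll fun i => activate π.code (c.memory i) (c.received i)
  let adv ← activate A c.adversary (Data.ofVec fun i => if i ∈ I then c.received i else Data.nil)
  let sent : Fin n → Data := fun i =>
    if i ∈ D then Data.nil else if i ∈ I then adv.2.get i else (party i).2
  let rel ← activate H.relay c.relay (Data.ofVec sent)
  pure
    { memory := fun i => (party i).1
      received := fun i => if i ∈ D then Data.nil else rel.2.get i
      adversary := adv.1
      relay := rel.1 }

/-- A number of consecutive rounds of the first part. -/
def aeRounds (H : HybridModel) (π : Protocol) (A : Code) {n : ℕ} (I D : Finset (Fin n)) :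
    ℕ → Config n → PMF (Config n)
  | 0, c => pure c
  | r + 1, c => do
      let c' ← aeRound H π A I D c
      aeRounds H π A I D r c'

/-- What is recorded of an execution. Only the entries of honest parties have a meaning in
`sent` (where `sent i j` is the point-to-point message from `i` to `j`, and `Data.nil` stands for
no message) and in `output` (where `none` stands for no output bit). -/
structure Outcome (n : ℕ) where
  corrupted : Finset (Fin n)
  sent : Fin n → Fin n → Data
  output : Fin n → Option Bool

open Classical in
/-- The point-to-point round and the computation of the outputs. The adversary is rushing: it
sees the messages from honest to corrupted parties before it chooses the messages of the
corrupted parties. In the end every party gets the whole vector of messages sent to it, and is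
free to discard any of them, depending on their contents. -/
def lastRound (π : Protocol) (A : Code) {n : ℕ} (I : Finset (Fin n)) (c : Config n) :
    PMF (Outcome n) := do
  let party ← sampleAll fun i => activate π.code (c.memory i) (c.received i)
  let sent : Fin n → Fin n → Data := fun i j => (party i).2.get j
  let adv ← activate A c.adversary
    (Data.cons (Data.ofVec fun i => if i ∈ I then c.received i else Data.nil)
      (Data.ofVec fun i => Data.ofVec fun j => if i ∉ I ∧ j ∈ I then sent i j else Data.nil))
  let final ← sampleAll fun j => activate π.code (party j).1
    (Data.ofVec fun i => if i ∈ I then (adv.2.get i).get j else sent i j)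
  pure
    { corrupted := I
      sent := sent
      output := fun j => (final j).2.toBool? }

open Classical in
/-- The execution of the protocol `π` with adversary `A` and input bits `x`. The adversary is
static: it chooses the corrupted parties at the start, knowing only the common reference
string (the `i`-th entry of its answer tells whether `i` is corrupted). -/
def execution (H : HybridModel) (π : Protocol) (A : Code) (κ : ℕ)
    (x : Fin (H.parties κ) → Bool) : PMF (Outcome (H.parties κ)) := do
  let crs ← H.crs κ
  let adv ← activate A (adversaryStart H π κ crs) Data.nil
  let I : Finset (Fin (H.parties κ)) := Finset.univ.filter fun i => adv.2.get i ≠ Data.nil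
  let D ← H.isolated κ I
  let c ← aeRounds H π A I D (π.rounds κ)
    { memory := fun i => partyStart H π κ crs i
      received := fun i => Data.ofBool (x i)
      adversary := adv.1
      relay := relayStart H κ }
  lastRound π A I c

/-! ### Byzantine agreement and communication -/

/-- Termination, agreement and validity, for the input bits `x`. -/
structure Outcome.Correct {n : ℕ} (o : Outcome n) (x : Fin n → Bool) : Prop where
  termination : ∀ i ∉ o.corrupted, o.output i ≠ none
  agreement : ∀ i ∉ o.corrupted, ∀ j ∉ o.corrupted, o.output i = o.output j
  validity : ∀ b, (∀ i ∉ o.corrupted, x i = b) → ∀ i ∉ o.corrupted, o.output i = some b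

/-- The protocol `π` is a `βn`-resilient Byzantine agreement protocol: for every probabilistic
polynomial-time adversary and all inputs, the probability that at most `βn` parties are corrupted
and that one of the three properties fails is negligible. -/
def IsResilientBA (H : HybridModel) (π : Protocol) (β : ℝ) : Prop :=
  ∀ A : Code, PPTAdversary H π A → ∀ x : (κ : ℕ) → Fin (H.parties κ) → Bool,
    Asymptotics.SuperpolynomialDecay atTop (fun κ : ℕ => (κ : ℝ)) fun κ =>
      ((execution H π A κ (x κ)).toOuterMeasure
        {o | (o.corrupted.card : ℝ) ≤ β * H.parties κ ∧ ¬ o.Correct (x κ)}).toReal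

open Classical in
/-- The number of messages that party `i` sends to other parties in the point-to-point round. -/
def Outcome.messagesSent {n : ℕ} (o : Outcome n) (i : Fin n) : ℕ :=
  (Finset.univ.filter fun j => j ≠ i ∧ o.sent i j ≠ Data.nil).card

end BALowerBound

end

open BALowerBound

/-! Fix `L` about `4 / β` and a block of about `n / L` parties. Suppose that a party `i` of the
block is isolated while the rest of the block is corrupted and silent. In the first part the
functionality then sees nothing from the block, so the parties outside it behave as if it did not
exist, and `i` knows only the reference string, its input and its coins. Corrupting further parties
outside the block changes nothing as long as they follow the protocol in the first part. Without
private setup, the adversary can moreover sample an independent run of the parties outside the block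
with the opposite input, and `i` cannot tell simulated messages from actual ones.

Let `P₀` and `P₁` be two such runs for the same reference string, with all inputs `false` and all
inputs `true`. The attack corrupts, besides the block without `i`, every party that sends a message
to `i` in the simulated run. In the last round such a party sends its message of `P₀` if there is
one, and otherwise its message of `P₁`. A party outside the block that stays honest sends `i`
nothing in the simulation, so its actual message already obeys this rule. Hence `i` receives the
same messages from outside the block whether `P₀` is simulated and `P₁` is actual or the other way
round (`finalOutput_isolated`). Now compare three experiments. (1) All inputs are `false` and `P₁`
is simulated: by validity `i` outputs `false`. (2) Party `i` has input `false`, the others have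
input `true`, and `P₀` is simulated. (3) All inputs are `true` and `P₀` is simulated: by validity
every honest `k` outputs `true`. Party `i` cannot distinguish (1) from (2). If `i` sends few
messages, some honest `k` gets none from `i` with either input, and `k` cannot distinguish (2) from
(3). So in (2) `i` outputs `false` and `k` outputs `true`, against agreement; this is
`one_le_failures`.

The attack needs `i` to get few messages from outside the block, since their senders are corrupted.
If all parties outside the block send fewer than `m` messages, double counting
(`card_le_of_forall_recipients`) shows that only a small fraction of the block receives many.
Averaging therefore yields a suitable `i` (`exists_few_senders`). That each party sends few messages
is the negation of the conclusion, for the adversary that merely silences the block without `i`.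

The adversary is uniform and cannot know `i`, so it guesses `i` at random. Guess and isolation
together cost a factor `2 * n * q` (`ideal_le_execution`), which negligible failure probabilities
absorb. What remains is to exhibit the attack as a program, compute its distribution, and bound its
running time (`pptAdversary_attack`). -/

noncomputable section

namespace BALowerBound

open scoped Classical

/-! ### Independent samples -/

theorem sampleAll_zero {α : Type} (f : Fin 0 → PMF α) : sampleAll f = PMF.pure Fin.elim0 := rfl

theorem sampleAll_succ {α : Type} {n : ℕ} (f : Fin (n + 1) → PMF α) :
    sampleAll f = (f 0).bind fun a => (sampleAll fun i => f i.succ).bind fun v =>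
      PMF.pure (Fin.cons a v) := rfl

/-- Independent draws commute, so two product distributions can be interleaved coordinate by
coordinate. The rules for mapping and resampling coordinates are special cases. -/
theorem sampleAll_zip {α β γ : Type} : {n : ℕ} → (f : Fin n → PMF α) → (g : Fin n → PMF β) →
    (h : Fin n → α → β → γ) →
    ((sampleAll f).bind fun v => (sampleAll g).bind fun w => PMF.pure fun j => h j (v j) (w j)) =
      sampleAll fun j => (f j).bind fun a => (g j).bind fun b => PMF.pure (h j a b)
  | 0, f, g, h => by
    simp only [sampleAll_zero, PMF.pure_bind]
    congr 1
    exact Subsingleton.elim _ _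
  | n + 1, f, g, h => by
    have ih := sampleAll_zip (fun i => f i.succ) (fun i => g i.succ) (fun i => h i.succ)
    simp only [sampleAll_succ, PMF.bind_bind, PMF.pure_bind]
    simp only [← ih, PMF.bind_bind, PMF.pure_bind]
    congr 1; funext a
    rw [PMF.bind_comm (g 0)]
    congr 1; funext v
    congr 1; funext b
    congr 1; funext w
    congr 1; funext j
    refine Fin.cases ?_ (fun i => ?_) j <;> simp

theorem sampleAll_pure {α : Type} : {n : ℕ} → (a : Fin n → α) →
    sampleAll (fun j => PMF.pure (a j)) = PMF.pure a
  | 0, a => by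
    rw [sampleAll_zero]
    congr 1
    exact Subsingleton.elim _ _
  | n + 1, a => by
    rw [sampleAll_succ, PMF.pure_bind, sampleAll_pure (fun i => a i.succ), PMF.pure_bind]
    congr 1
    exact Fin.cons_self_tail a

theorem sampleAll_map {α γ : Type} {n : ℕ} (f : Fin n → PMF α) (h : Fin n → α → γ) :
    (sampleAll f).map (fun v j => h j (v j)) = sampleAll fun j => (f j).map (h j) := by
  have := sampleAll_zip f (fun _ => PMF.pure ()) (fun j a _ => h j a)
  simp only [sampleAll_pure, PMF.pure_bind] at this
  exact this

theorem sampleAll_eval {α : Type} : {n : ℕ} → (f : Fin n → PMF α) → (i : Fin n) →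
    (sampleAll f).map (fun v => v i) = f i
  | 0, f, i => i.elim0
  | n + 1, f, i => by
    rw [sampleAll_succ]
    simp only [PMF.map_bind, PMF.pure_map]
    refine Fin.cases ?_ (fun i => ?_) i
    · simp
    · have := sampleAll_eval (fun i => f i.succ) i
      simp only [Fin.cons_succ, PMF.bind_const]
      rw [← this, PMF.map]
      rfl

/-- A single coordinate can be sampled separately from the others. -/
theorem sampleAll_resample {α : Type} {n : ℕ} (f : Fin n → PMF α) (i : Fin n) :
    sampleAll f = (f i).bind fun a => (sampleAll f).map fun v => Function.update v i a := by
  classical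
  -- Take two independent copies of the whole vector and keep coordinate `i` of the first and all
  -- the others of the second.
  have h := sampleAll_zip f f (fun j a b => if j = i then a else b)
  have h2 : (fun j => (f j).bind fun a => (f j).bind fun b =>
      PMF.pure (if j = i then a else b)) = f := by
    funext j
    by_cases hj : j = i
    · simp [hj]
    · simp [hj]
  rw [h2] at h
  conv_lhs => rw [← h]
  conv_rhs => rw [← sampleAll_eval f i]
  simp only [PMF.map, PMF.bind_bind, PMF.pure_bind, Function.comp_def]
  congr 1; funext v
  congr 1; funext w
  congr 1; funext j
  by_cases hj : j = i
  · subst hj; simp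
  · simp [hj]

theorem mem_support_sampleAll {α : Type} {n : ℕ} (f : Fin n → PMF α) (v : Fin n → α)
    (hv : v ∈ (sampleAll f).support) (j : Fin n) : v j ∈ (f j).support := by
  rw [← sampleAll_eval f j, PMF.mem_support_map_iff]
  exact ⟨v, hv, rfl⟩

/-- The loop in `tabC` produces the last entry first, so its induction peels off the last
coordinate. -/
theorem sampleAll_snoc {α : Type} : {n : ℕ} → (f : Fin (n + 1) → PMF α) →
    sampleAll f = (f (Fin.last n)).bind fun a => (sampleAll fun i => f i.castSucc).bind fun v =>
      PMF.pure (Fin.snoc (α := fun _ => α) v a)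
  | 0, f => by
    rw [sampleAll_succ]
    simp only [sampleAll_zero, PMF.pure_bind]
    congr 1; funext a
    congr 1; funext j
    rw [Fin.fin_one_eq_zero j]
    simp [Fin.snoc]
  | n + 1, f => by
    rw [sampleAll_succ, sampleAll_snoc (fun i => f i.succ)]
    simp only [PMF.bind_bind, PMF.pure_bind]
    rw [PMF.bind_comm]
    congr 1; funext a
    rw [sampleAll_succ (fun i : Fin (n + 1) => f i.castSucc)]
    simp only [PMF.bind_bind, PMF.pure_bind]
    congr 1; funext b
    congr 1; funext v
    congr 1
    exact Fin.cons_snoc_eq_snoc_cons b v a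

/-! ### Probabilities of events -/

/-- The probability of an event. -/
def Pr {α : Type} (μ : PMF α) (E : Set α) : ENNReal := μ.toOuterMeasure E

theorem Pr_le_one {α : Type} (μ : PMF α) (E : Set α) : Pr μ E ≤ 1 := by
  exact (μ.toOuterMeasure.mono (Set.subset_univ E)).trans_eq
    ((PMF.toOuterMeasure_apply_eq_one_iff μ Set.univ).2 (Set.subset_univ _))

theorem Pr_ne_top {α : Type} (μ : PMF α) (E : Set α) : Pr μ E ≠ ⊤ :=
  ((Pr_le_one μ E).trans_lt ENNReal.one_lt_top).ne

theorem Pr_mono {α : Type} (μ : PMF α) {E F : Set α} (h : E ⊆ F) : Pr μ E ≤ Pr μ F :=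
  μ.toOuterMeasure.mono h

theorem Pr_univ {α : Type} (μ : PMF α) : Pr μ Set.univ = 1 :=
  (PMF.toOuterMeasure_apply_eq_one_iff μ Set.univ).2 (Set.subset_univ _)

theorem Pr_union_le {α : Type} (μ : PMF α) (E F : Set α) : Pr μ (E ∪ F) ≤ Pr μ E + Pr μ F :=
  MeasureTheory.measure_union_le E F

theorem Pr_exists_le {α ι : Type} [Fintype ι] (μ : PMF α) (E : ι → Set α) :
    Pr μ {a | ∃ j, a ∈ E j} ≤ ∑ j, Pr μ (E j) := by
  have : {a | ∃ j, a ∈ E j} = ⋃ j, E j := by ext; simp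
  rw [this]
  exact MeasureTheory.measure_iUnion_fintype_le _ _

theorem Pr_bind {α β : Type} (μ : PMF α) (f : α → PMF β) (E : Set β) :
    Pr (μ.bind f) E = ∑' a, μ a * Pr (f a) E :=
  PMF.toOuterMeasure_bind_apply μ f E

theorem Pr_map {α β : Type} (μ : PMF α) (f : α → β) (E : Set β) :
    Pr (μ.map f) E = Pr μ (f ⁻¹' E) :=
  PMF.toOuterMeasure_map_apply f μ E

theorem Pr_pure {α : Type} (a : α) (E : Set α) [Decidable (a ∈ E)] :
    Pr (PMF.pure a) E = if a ∈ E then 1 else 0 := by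
  rw [Pr, PMF.toOuterMeasure_pure_apply]
  congr

theorem mul_Pr_le_Pr_bind {α β : Type} (μ : PMF α) (f : α → PMF β) (E : Set β) (a : α) :
    μ a * Pr (f a) E ≤ Pr (μ.bind f) E := by
  rw [Pr_bind]
  exact ENNReal.le_tsum a

theorem mul_Pr_bind_le {α β γ : Type} (μ : PMF α) (f : α → PMF β) (g : α → PMF γ) (E : Set β)
    (F : Set γ) (c : ENNReal) (h : ∀ a ∈ μ.support, c * Pr (f a) E ≤ Pr (g a) F) :
    c * Pr (μ.bind f) E ≤ Pr (μ.bind g) F := by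
  rw [Pr_bind, Pr_bind, ← ENNReal.tsum_mul_left]
  refine ENNReal.tsum_le_tsum fun a => ?_
  by_cases ha : a ∈ μ.support
  · rw [mul_left_comm]
    gcongr
    exact h a ha
  · rw [PMF.mem_support_iff, not_not] at ha
    simp [ha]

theorem Pr_bind_le_Pr_bind {α β γ : Type} (μ : PMF α) (f : α → PMF β) (g : α → PMF γ)
    (E : Set β) (F : Set γ) (h : ∀ a ∈ μ.support, Pr (f a) E ≤ Pr (g a) F) :
    Pr (μ.bind f) E ≤ Pr (μ.bind g) F := by
  simpa using mul_Pr_bind_le μ f g E F 1 (by simpa using h)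

/-- Markov's inequality for the number of members of a finite family of events that occur. -/
theorem Pr_sum_count_le {α ι : Type} (s : Finset ι) (μ : PMF α) (E : ι → Set α) (B : Set α)
    (K : ℕ) (h : ∀ a ∉ B, ∀ t ⊆ s, (∀ i ∈ t, a ∈ E i) → t.card ≤ K) :
    ∑ i ∈ s, Pr μ (E i) ≤ K + s.card * Pr μ B := by
  classical
  have key : ∀ E : Set α, Pr μ E = ∑' a, μ a * (if a ∈ E then 1 else 0) := by
    intro E
    rw [Pr, PMF.toOuterMeasure_apply]
    refine tsum_congr fun a => ?_
    by_cases ha : a ∈ E <;> simp [ha]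
  simp only [key]
  rw [← Summable.tsum_finsetSum (fun _ _ => ENNReal.summable), ← ENNReal.tsum_mul_left]
  have hK : (K : ENNReal) = ∑' a, μ a * K := by
    rw [ENNReal.tsum_mul_right, μ.tsum_coe, one_mul]
  rw [hK, ← ENNReal.tsum_add]
  refine ENNReal.tsum_le_tsum fun a => ?_
  rw [← Finset.mul_sum, mul_left_comm, ← mul_add]
  gcongr
  rw [Finset.sum_boole]
  -- On `B` all events may occur, which is charged to the second term; outside `B` at most `K` of
  -- them do.
  by_cases ha : a ∈ B
  · simp only [ha, if_true, mul_one]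
    refine le_add_left ?_
    exact_mod_cast Finset.card_filter_le _ _
  · simp only [ha, if_false, mul_zero, add_zero]
    exact_mod_cast h a ha _ (Finset.filter_subset _ _) (fun i hi => (Finset.mem_filter.1 hi).2)

theorem PMF_bind_eq {α β : Type} (μ : PMF α) (f : α → PMF β) : (μ >>= f) = μ.bind f := rfl

theorem PMF_pure_eq {α : Type} (a : α) : (pure a : PMF α) = PMF.pure a := rfl

/-! ### Data -/

namespace Data

@[simp] theorem hd_nil : hd nil = nil := rfl
@[simp] theorem tl_nil : tl nil = nil := rfl
@[simp] theorem hd_cons (a b : Data) : hd (cons a b) = a := rfl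
@[simp] theorem tl_cons (a b : Data) : tl (cons a b) = b := rfl

@[simp] theorem toList_ofList (l : List Data) : (ofList l).toList = l := by
  induction l with
  | nil => rfl
  | cons a l ih => simp [ofList, toList, ih]

@[simp] theorem toList_unary (n : ℕ) : (unary n).toList = List.replicate n nil := by simp [unary]

theorem unary_succ (n : ℕ) : unary (n + 1) = cons nil (unary n) := rfl

@[simp] theorem unary_zero : unary 0 = nil := rfl

@[simp] theorem unary_eq_nil {n : ℕ} : unary n = nil ↔ n = 0 := by
  cases n <;> simp [unary_succ]

@[simp] theorem tl_unary (n : ℕ) : (unary n).tl = unary (n - 1) := by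
  cases n <;> simp [unary_succ]

theorem tl_iterate_unary (n k : ℕ) : tl^[k] (unary n) = unary (n - k) := by
  induction k with
  | zero => rfl
  | succ k ih => rw [Function.iterate_succ_apply', ih, tl_unary, Nat.sub_sub]

theorem get_eq_hd_iterate_tl (d : Data) (j : ℕ) : d.get j = (tl^[j] d).hd := by
  induction j generalizing d with
  | zero => cases d <;> rfl
  | succ j ih =>
    rw [Function.iterate_succ_apply, ← ih]
    cases d with
    | nil => simp [get, toList]
    | cons a b => simp [get, toList]

@[simp] theorem get_ofVec {n : ℕ} (v : Fin n → Data) (j : Fin n) : (ofVec v).get j = v j := by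
  simp [get, ofVec]

@[simp] theorem ofBool_eq_nil {b : Bool} : ofBool b = nil ↔ b = false := by
  cases b <;> simp [ofBool]

end Data

/-! ### The distribution of the value of a program -/

/-- The distribution of the value that a program computes. -/
def Code.val (p : Code) (env : List Data) : PMF Data := (p.run env).map Prod.fst

/-- The distribution of the accumulator at the end of a loop. -/
def loopVal (body : Data → Data → PMF Data) : List Data → Data → PMF Data
  | [], acc => PMF.pure acc
  | x :: l, acc => (body x acc).bind fun u => loopVal body l u

theorem map_fst_loop (body : Data → Data → PMF (Data × ℕ)) (l : List Data) (acc : Data) :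
    (loop body l acc).map Prod.fst =
      loopVal (fun x acc => (body x acc).map Prod.fst) l acc := by
  induction l generalizing acc with
  | nil => exact PMF.pure_map _ _
  | cons x l ih =>
    simp only [loop, loopVal, PMF_bind_eq, PMF_pure_eq, PMF.map_bind,
      PMF.pure_map, PMF.bind_map, Function.comp_def, ← ih]
    rfl

namespace Code

@[simp] theorem val_var (k : ℕ) (env : List Data) :
    (var k).val env = PMF.pure (env.getD k Data.nil) := PMF.pure_map _ _

@[simp] theorem val_nil (env : List Data) : nil.val env = PMF.pure Data.nil := PMF.pure_map _ _

@[simp] theorem val_cons (a b : Code) (env : List Data) :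
    (cons a b).val env =
      (a.val env).bind fun x => (b.val env).bind fun y => PMF.pure (Data.cons x y) := by
  simp only [val, run, PMF_bind_eq, PMF_pure_eq, PMF.map_bind,
    PMF.pure_map, PMF.bind_map, Function.comp_def]

@[simp] theorem val_hd (a : Code) (env : List Data) :
    (hd a).val env = (a.val env).map Data.hd := by
  simp only [val, run, PMF_bind_eq, PMF_pure_eq, PMF.map_bind, PMF.pure_map, PMF.map_comp]
  rfl

@[simp] theorem val_tl (a : Code) (env : List Data) :
    (tl a).val env = (a.val env).map Data.tl := by
  simp only [val, run, PMF_bind_eq, PMF_pure_eq, PMF.map_bind, PMF.pure_map, PMF.map_comp]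
  rfl

theorem val_ifNil (c a b : Code) (env : List Data) :
    (ifNil c a b).val env =
      (c.val env).bind fun x => if x = Data.nil then a.val env else b.val env := by
  simp only [val, run, PMF_bind_eq, PMF_pure_eq, PMF.map_bind,
    PMF.pure_map, PMF.bind_map, Function.comp_def]
  congr 1; funext u
  cases hu : u.1 <;> simp <;> rfl

@[simp] theorem val_letIn (a b : Code) (env : List Data) :
    (letIn a b).val env = (a.val env).bind fun x => b.val (x :: env) := by
  simp only [val, run, PMF_bind_eq, PMF_pure_eq, PMF.map_bind,
    PMF.pure_map, PMF.bind_map, Function.comp_def]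
  rfl

@[simp] theorem val_call (p a : Code) (env : List Data) :
    (call p a).val env = (a.val env).bind fun x => p.val [x] := by
  simp only [val, run, PMF_bind_eq, PMF_pure_eq, PMF.map_bind,
    PMF.pure_map, PMF.bind_map, Function.comp_def]
  rfl

theorem val_flip (env : List Data) :
    flip.val env = (PMF.uniformOfFintype Bool).map Data.ofBool := by
  simp only [val, run, PMF_bind_eq, PMF_pure_eq, PMF.map_bind,
    PMF.pure_map]
  rfl

theorem val_fold (l z b : Code) (env : List Data) :
    (fold l z b).val env = (l.val env).bind fun u => (z.val env).bind fun v =>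
      loopVal (fun x acc => b.val (x :: acc :: env)) u.toList v := by
  simp only [val, run, PMF_bind_eq, PMF_pure_eq, PMF.map_bind,
    PMF.pure_map, PMF.bind_map, Function.comp_def]
  congr 1; funext u
  congr 1; funext v
  exact map_fst_loop _ _ _

end Code

theorem activate_eq (M : Code) (s r : Data) :
    activate M s r = (M.val [s, r]).map fun d => (d.hd, d.tl) := by
  simp only [activate, Code.val, PMF_bind_eq, PMF_pure_eq, PMF.map_comp]
  rfl

/-! ### Correctness and step counts together -/

/-- Whatever the coins are, `p` takes at most `N` steps in `env` and its value satisfies `Q`. -/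
def Triple (p : Code) (env : List Data) (N : ℕ) (Q : Data → Prop) : Prop :=
  ∀ u ∈ (p.run env).support, Q u.1 ∧ u.2 ≤ N

namespace Triple

theorem mono {p : Code} {env : List Data} {N M : ℕ} {Q Q' : Data → Prop}
    (h : Triple p env N Q) (hN : N ≤ M) (hQ : ∀ x, Q x → Q' x) : Triple p env M Q' :=
  fun u hu => ⟨hQ _ (h u hu).1, (h u hu).2.trans hN⟩

theorem of_val {p : Code} {env : List Data} {N : ℕ} {Q : Data → Prop} (h : Triple p env N Q) :
    Triple p env N fun x => x ∈ (p.val env).support :=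
  fun u hu => ⟨(PMF.mem_support_map_iff _ _ _).2 ⟨u, hu, rfl⟩, (h u hu).2⟩

/-- Separates cost from correctness: a step bound with a trivial postcondition acquires the exact
value once the value distribution is known to be a point mass. -/
theorem of_pure {p : Code} {env : List Data} {N : ℕ} {Q : Data → Prop} {d : Data}
    (h : Triple p env N Q) (hd : p.val env = PMF.pure d) : Triple p env N (· = d) :=
  h.of_val.mono le_rfl fun x hx => by simpa [hd] using hx

theorem var (k : ℕ) (env : List Data) :
    Triple (Code.var k) env 1 (· = env.getD k Data.nil) := by
  intro u hu
  rw [Code.run, PMF_pure_eq, PMF.mem_support_pure_iff] at hu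
  subst hu; simp

theorem nil (env : List Data) : Triple Code.nil env 1 (· = Data.nil) := by
  intro u hu
  rw [Code.run, PMF_pure_eq, PMF.mem_support_pure_iff] at hu
  subst hu; simp

theorem flip (env : List Data) : Triple Code.flip env 1 (fun x => ∃ b, x = Data.ofBool b) := by
  intro u hu
  simp only [Code.run, PMF_bind_eq, PMF_pure_eq, PMF.mem_support_bind_iff,
    PMF.mem_support_pure_iff] at hu
  obtain ⟨b, -, rfl⟩ := hu
  exact ⟨⟨b, rfl⟩, le_rfl⟩

theorem cons {a b : Code} {env : List Data} {N M : ℕ} {Q R S : Data → Prop}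
    (ha : Triple a env N Q) (hb : Triple b env M R)
    (h : ∀ x y, Q x → R y → S (Data.cons x y)) : Triple (Code.cons a b) env (N + M + 1) S := by
  intro w hw
  simp only [Code.run, PMF_bind_eq, PMF_pure_eq, PMF.mem_support_bind_iff,
    PMF.mem_support_pure_iff] at hw
  obtain ⟨u, hu, v, hv, rfl⟩ := hw
  have h1 := ha u hu
  have h2 := hb v hv
  exact ⟨h _ _ h1.1 h2.1, by simp only; omega⟩

theorem hd {a : Code} {env : List Data} {N : ℕ} {Q S : Data → Prop}
    (ha : Triple a env N Q) (h : ∀ x, Q x → S x.hd) : Triple (Code.hd a) env (N + 1) S := by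
  intro w hw
  simp only [Code.run, PMF_bind_eq, PMF_pure_eq, PMF.mem_support_bind_iff,
    PMF.mem_support_pure_iff] at hw
  obtain ⟨u, hu, rfl⟩ := hw
  have h1 := ha u hu
  exact ⟨h _ h1.1, by simp only; omega⟩

theorem tl {a : Code} {env : List Data} {N : ℕ} {Q S : Data → Prop}
    (ha : Triple a env N Q) (h : ∀ x, Q x → S x.tl) : Triple (Code.tl a) env (N + 1) S := by
  intro w hw
  simp only [Code.run, PMF_bind_eq, PMF_pure_eq, PMF.mem_support_bind_iff,
    PMF.mem_support_pure_iff] at hw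
  obtain ⟨u, hu, rfl⟩ := hw
  have h1 := ha u hu
  exact ⟨h _ h1.1, by simp only; omega⟩

theorem ifNil {c a b : Code} {env : List Data} {N M : ℕ} {Q S : Data → Prop}
    (hc : Triple c env N Q) (ha : Q Data.nil → Triple a env M S)
    (hb : ∀ x, Q x → x ≠ Data.nil → Triple b env M S) :
    Triple (Code.ifNil c a b) env (N + M + 1) S := by
  intro w hw
  simp only [Code.run, PMF_bind_eq, PMF_pure_eq, PMF.mem_support_bind_iff,
    PMF.mem_support_pure_iff] at hw
  obtain ⟨u, hu, v, hv, rfl⟩ := hw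
  have h1 := hc u hu
  have h2 : S v.1 ∧ v.2 ≤ M := by
    rcases hx : u.1 with _ | ⟨x, y⟩
    · rw [hx] at hv
      exact ha (hx ▸ h1.1) v hv
    · rw [hx] at hv
      exact hb _ h1.1 (by simp [hx]) v hv
  exact ⟨h2.1, by simp only; omega⟩

theorem letIn {a b : Code} {env : List Data} {N M : ℕ} {Q S : Data → Prop}
    (ha : Triple a env N Q) (hb : ∀ x, Q x → Triple b (x :: env) M S) :
    Triple (Code.letIn a b) env (N + M + 1) S := by
  intro w hw
  simp only [Code.run, PMF_bind_eq, PMF_pure_eq, PMF.mem_support_bind_iff,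
    PMF.mem_support_pure_iff] at hw
  obtain ⟨u, hu, v, hv, rfl⟩ := hw
  have h1 := ha u hu
  have h2 := hb _ h1.1 v hv
  exact ⟨h2.1, by simp only; omega⟩

theorem call {p a : Code} {env : List Data} {N M : ℕ} {Q S : Data → Prop}
    (ha : Triple a env N Q) (hb : ∀ x, Q x → Triple p [x] M S) :
    Triple (Code.call p a) env (N + M + 1) S := by
  intro w hw
  simp only [Code.run, PMF_bind_eq, PMF_pure_eq, PMF.mem_support_bind_iff,
    PMF.mem_support_pure_iff] at hw
  obtain ⟨u, hu, v, hv, rfl⟩ := hw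
  have h1 := ha u hu
  have h2 := hb _ h1.1 v hv
  exact ⟨h2.1, by simp only; omega⟩

/-- The invariant depends on the number of completed passes, because the memories of a simulated
machine are known to be reachable only after a specified number of activations. -/
theorem loop {body : Data → Data → PMF (Data × ℕ)} (B : ℕ) (Inv : ℕ → Data → Prop) (K : ℕ)
    (h : ∀ t < K, ∀ x acc, Inv t acc → ∀ u ∈ (body x acc).support, Inv (t + 1) u.1 ∧ u.2 ≤ B)
    (l : List Data) (t : ℕ) (hl : t + l.length = K) (acc : Data) (hacc : Inv t acc) :
    ∀ u ∈ (loop body l acc).support, Inv K u.1 ∧ u.2 ≤ l.length * (B + 1) := by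
  induction l generalizing t acc with
  | nil =>
    intro u hu
    rw [BALowerBound.loop, PMF_pure_eq, PMF.mem_support_pure_iff] at hu
    subst hu
    have : t = K := by simpa using hl
    subst this
    simpa using hacc
  | cons x l ih =>
    intro w hw
    simp only [BALowerBound.loop, PMF_bind_eq, PMF_pure_eq,
      PMF.mem_support_bind_iff, PMF.mem_support_pure_iff] at hw
    obtain ⟨u, hu, v, hv, rfl⟩ := hw
    simp only [List.length_cons] at hl ⊢
    have h1 := h t (by omega) x acc hacc u hu
    have h2 := ih (t + 1) (by omega) u.1 h1.1 v hv
    refine ⟨h2.1, ?_⟩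
    show u.2 + v.2 + 1 ≤ (l.length + 1) * (B + 1)
    rw [Nat.add_one_mul]
    omega

theorem fold {l z b : Code} {env : List Data} {N M : ℕ} (K B : ℕ) (Inv : ℕ → Data → Prop)
    {Qz S : Data → Prop}
    (hl : Triple l env N fun d => d.toList.length = K) (hz : Triple z env M Qz)
    (h0 : ∀ x, Qz x → Inv 0 x)
    (hb : ∀ t < K, ∀ x acc, Inv t acc → Triple b (x :: acc :: env) B (Inv (t + 1)))
    (hS : ∀ x, Inv K x → S x) :
    Triple (Code.fold l z b) env (N + M + K * (B + 1) + 1) S := by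
  intro w hw
  simp only [Code.run, PMF_bind_eq, PMF_pure_eq, PMF.mem_support_bind_iff,
    PMF.mem_support_pure_iff] at hw
  obtain ⟨u, hu, v, hv, r, hr, rfl⟩ := hw
  have h1 := hl u hu
  have h2 := hz v hv
  have h3 := loop B Inv K hb _ 0 (by rw [h1.1, zero_add]) _ (h0 _ h2.1) r hr
  rw [h1.1] at h3
  exact ⟨hS _ h3.1, by simp only; omega⟩

end Triple

/-! ### Running a program in a larger environment -/

/-- Replaces all variables from `d` on by the empty cell. -/
def Code.restrict : ℕ → Code → Code
  | d, var k => if k < d then var k else nil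
  | _, nil => nil
  | d, cons a b => cons (a.restrict d) (b.restrict d)
  | d, hd a => hd (a.restrict d)
  | d, tl a => tl (a.restrict d)
  | d, ifNil c a b => ifNil (c.restrict d) (a.restrict d) (b.restrict d)
  | d, letIn a b => letIn (a.restrict d) (b.restrict (d + 1))
  | d, call p a => call p (a.restrict d)
  | _, flip => flip
  | d, fold l z b => fold (l.restrict d) (z.restrict d) (b.restrict (d + 2))

/-- A given machine may refer to variables beyond its two arguments, which read as the empty cell.
Embedded under further local definitions these references would see other data, hence the
replacement. -/
theorem Code.run_restrict (p : Code) (env junk : List Data) :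
    (p.restrict env.length).run (env ++ junk) = p.run env := by
  induction p generalizing env with
  | var k =>
    unfold restrict
    split_ifs with h
    · rw [run, run, List.getD_append _ _ _ _ h]
    · rw [run, run, List.getD_eq_default _ _ (not_lt.1 h)]
  | nil => rfl
  | flip => rfl
  | cons a b iha ihb => simp only [restrict, run, iha, ihb]
  | hd a iha => simp only [restrict, run, iha]
  | tl a iha => simp only [restrict, run, iha]
  | ifNil c a b ihc iha ihb => simp only [restrict, run, ihc, iha, ihb]
  | letIn a b iha ihb =>
    have := fun x => ihb (x :: env)
    simp only [List.length_cons, List.cons_append] at this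
    simp only [restrict, run, iha, this]
  | call p a _ iha => simp only [restrict, run, iha]
  | fold l z b ihl ihz ihb =>
    have := fun x y => ihb (x :: y :: env)
    simp only [List.length_cons, List.cons_append] at this
    simp only [restrict, run, ihl, ihz, this]

/-- The program of an interactive machine, made insensitive to further variables. -/
def Code.machine (M : Code) : Code := M.restrict 2

theorem Code.run_machine (M : Code) (s r : Data) (junk : List Data) :
    M.machine.run (s :: r :: junk) = M.run [s, r] :=
  M.run_restrict [s, r] junk

theorem Code.val_machine (M : Code) (s r : Data) (junk : List Data) :
    M.machine.val (s :: r :: junk) = M.val [s, r] := by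
  rw [val, run_machine]; rfl

theorem Triple.machine {M : Code} {s r : Data} {N : ℕ} {Q : Data → Prop} (junk : List Data)
    (h : Triple M [s, r] N Q) : Triple M.machine (s :: r :: junk) N Q := by
  rw [Triple, Code.run_machine]; exact h

/-! ### Elementary programs -/

namespace Code

/-- From `(a, b)`, removes as many entries from the list `b` as `a` has. -/
def dropC : Code := fold (hd (var 0)) (tl (var 0)) (tl (var 1))

/-- From `(j, d)`, with `j` in unary, the `j`-th entry of `d`. -/
def nthC : Code := hd dropC

/-- From `(n, c)`, with `n` in unary, the list of the values of `p` on `(j, c)` for `j < n`. -/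
def tabC (p : Code) : Code :=
  tl (fold (hd (var 0)) (cons (hd (var 0)) nil)
    (letIn (tl (hd (var 1)))
      (cons (var 0) (cons (call p (cons (var 0) (tl (var 3)))) (tl (var 2))))))

/-- Removes `L` entries. -/
def tlsC (a : Code) : ℕ → Code
  | 0 => a
  | L + 1 => tl (tlsC a L)

/-- From `(j, n)`, with both numbers in unary, the number `n - L * j` in unary. -/
def liveC (L : ℕ) : Code := fold (hd (var 0)) (tl (var 0)) (tlsC (var 1) L)

/-- Sum of two numbers in unary. -/
def addC : Code := fold (hd (var 0)) (tl (var 0)) (cons nil (var 1))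

/-- From `(a, b)`, both in unary, the empty cell if and only if `a = b`. -/
def eqC : Code :=
  ifNil (call dropC (var 0))
    (ifNil (call dropC (cons (tl (var 0)) (hd (var 0)))) nil (cons nil nil))
    (cons nil nil)

/-! ### Values of the elementary programs -/

theorem loopVal_tl (f : Data → Data) (l : List Data) (acc : Data) :
    loopVal (fun _ acc => PMF.pure (f acc)) l acc = PMF.pure (f^[l.length] acc) := by
  induction l generalizing acc with
  | nil => rfl
  | cons x l ih => simp [loopVal, ih]

theorem val_dropC (a b : Data) :
    dropC.val [Data.cons a b] = PMF.pure (Data.tl^[a.toList.length] b) := by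
  simp [dropC, val_fold, PMF.pure_map, loopVal_tl]

@[simp] theorem val_dropC_unary (j : ℕ) (b : Data) :
    dropC.val [Data.cons (Data.unary j) b] = PMF.pure (Data.tl^[j] b) := by
  simp [val_dropC]

@[simp] theorem val_nthC (j : ℕ) (d : Data) :
    nthC.val [Data.cons (Data.unary j) d] = PMF.pure (d.get j) := by
  simp [nthC, PMF.pure_map, Data.get_eq_hd_iterate_tl]

/-- The accumulator holds a counter and the output so far. The counter is lowered before each call,
so the indices run from `n - 1` down to `0` and prepending yields the entries in order. -/
theorem loopVal_tab (q : Data → PMF Data) (n : ℕ) (out : Data) :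
    loopVal (fun _ acc => (q acc.hd.tl).bind fun y =>
        PMF.pure (Data.cons acc.hd.tl (Data.cons y acc.tl)))
      (List.replicate n Data.nil) (Data.cons (Data.unary n) out) =
    (sampleAll fun j : Fin n => q (Data.unary j)).map fun v =>
      Data.cons Data.nil ((List.ofFn v).foldr Data.cons out) := by
  induction n generalizing out with
  | zero => simp [loopVal, sampleAll_zero, PMF.pure_map]
  | succ n ih =>
    rw [sampleAll_snoc]
    simp only [List.replicate_succ, loopVal, Data.hd_cons, Data.tl_unary, Nat.add_sub_cancel,
      Data.tl_cons, PMF.bind_bind, PMF.pure_bind, PMF.map_bind, PMF.pure_map, Fin.val_last,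
      Fin.val_castSucc]
    congr 1; funext y
    rw [ih, PMF.map]
    congr 1; funext v
    simp only [Function.comp_apply]
    congr 2
    rw [List.ofFn_succ_last]
    simp

theorem val_tabC (p : Code) (n : ℕ) (c : Data) :
    (tabC p).val [Data.cons (Data.unary n) c] =
      (sampleAll fun j : Fin n => p.val [Data.cons (Data.unary j) c]).map Data.ofVec := by
  have key := loopVal_tab (fun d => p.val [Data.cons d c]) n Data.nil
  simp only [tabC, val_tl, val_fold, val_hd, val_var, PMF.pure_map, PMF.pure_bind, val_cons,
    val_nil, val_letIn, val_call, List.getD_cons_zero, List.getD_cons_succ, Data.hd_cons,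
    Data.tl_cons, Data.toList_unary, PMF.bind_bind]
  rw [key, PMF.map_comp]
  congr 1; funext v
  simp only [Function.comp_apply, Data.tl_cons, Data.ofVec]
  induction List.ofFn v with
  | nil => rfl
  | cons a l ih => simp [Data.ofList, ih]

theorem val_tabC_pure (p : Code) (n : ℕ) (c : Data) (f : ℕ → Data)
    (h : ∀ j, p.val [Data.cons (Data.unary j) c] = PMF.pure (f j)) :
    (tabC p).val [Data.cons (Data.unary n) c] = PMF.pure (Data.ofVec fun j : Fin n => f j) := by
  rw [val_tabC]
  simp only [h, sampleAll_pure, PMF.pure_map]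

theorem val_tlsC (a : Code) (L : ℕ) (env : List Data) :
    (tlsC a L).val env = (a.val env).map (Data.tl^[L]) := by
  induction L with
  | zero => simp [tlsC, PMF.map_id]
  | succ L ih =>
    rw [tlsC, val_tl, ih, PMF.map_comp, ← Function.iterate_succ']

theorem iterate_iterate_tl_unary (n L j : ℕ) :
    (Data.tl^[L])^[j] (Data.unary n) = Data.unary (n - L * j) := by
  rw [← Function.iterate_mul, Data.tl_iterate_unary]

@[simp] theorem val_liveC (L j n : ℕ) :
    (liveC L).val [Data.cons (Data.unary j) (Data.unary n)] =
      PMF.pure (Data.unary (n - L * j)) := by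
  simp [liveC, val_fold, PMF.pure_map, loopVal_tl, val_tlsC, iterate_iterate_tl_unary]

@[simp] theorem val_addC (a b : ℕ) :
    addC.val [Data.cons (Data.unary a) (Data.unary b)] = PMF.pure (Data.unary (a + b)) := by
  have : ∀ a, (Data.cons Data.nil)^[a] (Data.unary b) = Data.unary (a + b) := by
    intro a
    induction a with
    | zero => simp
    | succ a ih => rw [Function.iterate_succ_apply', ih, Nat.succ_add, Data.unary_succ]
  simp [addC, val_fold, PMF.pure_map, loopVal_tl, this]

theorem val_eqC (a b : ℕ) :
    eqC.val [Data.cons (Data.unary a) (Data.unary b)] =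
      PMF.pure (if a = b then Data.nil else Data.cons Data.nil Data.nil) := by
  simp only [eqC, val_ifNil, val_call, val_var, List.getD_cons_zero, PMF.pure_bind,
    val_dropC_unary, val_cons, val_tl, val_hd, PMF.pure_map, Data.hd_cons, Data.tl_cons, val_nil,
    Data.tl_iterate_unary, Data.unary_eq_nil]
  by_cases h : a = b
  · simp [h]
  · rw [if_neg h]
    split_ifs <;> first | rfl | omega

/-- From `n` in unary, a random number in unary: the uniform distribution on the numbers below
the least power of two that is at least `n`. -/
def pickC : Code :=
  tl (fold (var 0) (cons (cons nil nil) nil)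
    (ifNil (call dropC (cons (hd (var 1)) (var 2))) (var 1)
      (cons (call addC (cons (hd (var 1)) (hd (var 1))))
        (ifNil flip (tl (var 1)) (call addC (cons (hd (var 1)) (tl (var 1))))))))

/-- The loop body of `pickC`. -/
def pickStep (n : ℕ) (acc : Data) : PMF Data :=
  (ifNil (call dropC (cons (hd (var 1)) (var 2))) (var 1)
      (cons (call addC (cons (hd (var 1)) (hd (var 1))))
        (ifNil flip (tl (var 1)) (call addC (cons (hd (var 1)) (tl (var 1))))))).val
    [Data.nil, acc, Data.unary n]

/-- In the state `(k, u)`, `u` consists of the random bits drawn so far and `k` is the size of its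
range. Each pass draws the next higher bit until the range reaches `n`. -/
theorem pickStep_eq (n k u : ℕ) :
    pickStep n (Data.cons (Data.unary k) (Data.unary u)) =
      if n ≤ k then PMF.pure (Data.cons (Data.unary k) (Data.unary u))
      else (PMF.uniformOfFintype Bool).map fun b =>
        Data.cons (Data.unary (k + k)) (Data.unary (if b then k + u else u)) := by
  simp only [pickStep, val_ifNil, val_call, val_var, List.getD_cons_zero, List.getD_cons_succ,
    PMF.pure_bind, val_dropC_unary, val_cons, val_tl, val_hd, PMF.pure_map, Data.hd_cons,
    Data.tl_cons, val_addC, Data.tl_iterate_unary, Data.unary_eq_nil, val_flip, PMF.bind_map,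
    Function.comp_def, Data.ofBool_eq_nil, Nat.sub_eq_zero_iff_le]
  split_ifs with h
  · rfl
  · rw [PMF.bind_bind, PMF.map]
    congr 1; funext b
    cases b <;> simp

theorem val_pickC (n : ℕ) :
    pickC.val [Data.unary n] = (loopVal (fun _ acc => pickStep n acc) (List.replicate n Data.nil)
      (Data.cons (Data.unary 1) (Data.unary 0))).map Data.tl := by
  simp only [pickC, val_tl, val_fold, val_var, PMF.pure_bind, val_cons, val_nil,
    List.getD_cons_zero, Data.toList_unary]
  rfl

theorem loop_pick_of_le {n k : ℕ} (h : n ≤ k) (l : List Data) (u : ℕ) :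
    loopVal (fun _ acc => pickStep n acc) l (Data.cons (Data.unary k) (Data.unary u)) =
      PMF.pure (Data.cons (Data.unary k) (Data.unary u)) := by
  induction l with
  | nil => rfl
  | cons x l ih => rw [loopVal, pickStep_eq, if_pos h, PMF.pure_bind, ih]

/-- The hypothesis `y % k = u` says that `y` can still be reached. One of the two values of the next
bit keeps it reachable: the factor `1 / 2` is made up by the doubling of `k`, and `k < 2 * n` keeps
the bound below one at the end. -/
theorem loop_pick_ge (n : ℕ) (l : List Data) (k u y : ℕ) (hk : k < 2 * n)
    (hl : n ≤ 2 ^ l.length * k) (hy : y < n) (hu : y % k = u) :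
    (k : ENNReal) / (2 * n) ≤
      (loopVal (fun _ acc => pickStep n acc) l
        (Data.cons (Data.unary k) (Data.unary u))).map Data.tl (Data.unary y) := by
  induction l generalizing k u with
  | nil =>
    have hnk : n ≤ k := by simpa using hl
    rw [loop_pick_of_le hnk, PMF.pure_map, Data.tl_cons, ← hu,
      Nat.mod_eq_of_lt (hy.trans_le hnk), PMF.pure_apply_self]
    refine ENNReal.div_le_of_le_mul ?_
    rw [one_mul]
    exact_mod_cast hk.le
  | cons x l ih =>
    by_cases hnk : n ≤ k
    · rw [loop_pick_of_le hnk, PMF.pure_map, Data.tl_cons, ← hu,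
        Nat.mod_eq_of_lt (hy.trans_le hnk), PMF.pure_apply_self]
      refine ENNReal.div_le_of_le_mul ?_
      rw [one_mul]
      exact_mod_cast hk.le
    · have hk0 : 0 < k := by
        rcases Nat.eq_zero_or_pos k with rfl | h
        · simp at hl; omega
        · exact h
      rw [loopVal, pickStep_eq, if_neg hnk, PMF.bind_map, PMF.map_bind, PMF.bind_apply,
        tsum_fintype]
      simp only [Function.comp_apply, PMF.uniformOfFintype_apply, Fintype.card_bool]
      -- The residue of `y` modulo `2 * k` is either `u` or `k + u`; this is the bit that must come
      -- up.
      obtain ⟨b, hb⟩ : ∃ b : Bool, y % (k + k) = if b then k + u else u := by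
        have h1 : y % (k + k) % k = u := by
          rw [Nat.mod_mod_of_dvd _ ⟨2, by ring⟩, hu]
        have h2 := Nat.mod_lt y (show 0 < k + k by omega)
        by_cases h3 : y % (k + k) < k
        · exact ⟨false, by rw [Nat.mod_eq_of_lt h3] at h1; simpa using h1⟩
        · refine ⟨true, ?_⟩
          rw [Nat.mod_eq_sub_mod (not_lt.1 h3), Nat.mod_eq_of_lt (by omega)] at h1
          simp; omega
      refine le_trans ?_ (Finset.single_le_sum (fun _ _ => zero_le) (Finset.mem_univ b))
      have hle := ih (k + k) _ (by omega)
        (by rw [List.length_cons, pow_succ] at hl; nlinarith) hb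
      refine le_trans ?_ (mul_le_mul_right hle _)
      rw [div_eq_mul_inv, div_eq_mul_inv, ← mul_assoc]
      gcongr
      push_cast
      rw [← two_mul, ← mul_assoc, ENNReal.inv_mul_cancel two_ne_zero ENNReal.ofNat_ne_top, one_mul]

/-- Every number below `n` is picked with probability at least `1 / (2 * n)`. -/
theorem pickC_ge (n y : ℕ) (hy : y < n) :
    1 / (2 * n : ENNReal) ≤ pickC.val [Data.unary n] (Data.unary y) := by
  rw [val_pickC]
  have := loop_pick_ge n (List.replicate n Data.nil) 1 0 y (by omega)
    (by simpa using Nat.lt_two_pow_self.le) hy (Nat.mod_one y)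
  simpa using this

end Code

/-! ### Runs in which a block of parties is silent -/

/-- The first `⌈n / L⌉` of `n` parties. -/
def block (L n : ℕ) : Finset (Fin n) := Finset.univ.filter fun j => L * j < n

theorem mem_block {L n : ℕ} {j : Fin n} : j ∈ block L n ↔ L * j < n := by simp [block]

/-- One activation of all parties outside the block. -/
def liveStep (M : Code) (L : ℕ) {n : ℕ} (mem recv : Fin n → Data) : PMF (Fin n → Data) :=
  sampleAll fun j => if j ∈ block L n then PMF.pure Data.nil else M.val [mem j, recv j]

/-- A number of rounds of the parties outside the block, with communication through the machine
`rel`, followed by one more activation: the joint distribution of the results of the last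
activations. -/
def liveRun (M rel : Code) (L : ℕ) {n : ℕ} :
    ℕ → (Fin n → Data) → (Fin n → Data) → Data → PMF (Fin n → Data)
  | 0, mem, recv, _ => liveStep M L mem recv
  | r + 1, mem, recv, ρ => (liveStep M L mem recv).bind fun P =>
      (rel.val [ρ, Data.ofVec fun j => (P j).tl]).bind fun v =>
        liveRun M rel L r (fun j => (P j).hd) (fun j => v.tl.get j) v.hd

/-- A number of rounds of a party that receives nothing after its input, followed by one more
activation: the distribution of the result of the last activation. -/
def loneRun (M : Code) : ℕ → Data → Data → PMF Data
  | 0, mem, recv => M.val [mem, recv]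
  | r + 1, mem, recv => (M.val [mem, recv]).bind fun v => loneRun M r v.hd Data.nil

theorem liveStep_congr (M : Code) (L : ℕ) {n : ℕ} {mem mem' recv recv' : Fin n → Data}
    (hm : ∀ j ∉ block L n, mem j = mem' j) (hr : ∀ j ∉ block L n, recv j = recv' j) :
    liveStep M L mem recv = liveStep M L mem' recv' := by
  unfold liveStep
  congr 1; funext j
  split_ifs with h
  · rfl
  · rw [hm j h, hr j h]

theorem liveRun_congr (M rel : Code) (L : ℕ) {n : ℕ} (r : ℕ) {mem mem' recv recv' : Fin n → Data}
    (hm : ∀ j ∉ block L n, mem j = mem' j) (hr : ∀ j ∉ block L n, recv j = recv' j) (ρ : Data) :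
    liveRun M rel L r mem recv ρ = liveRun M rel L r mem' recv' ρ := by
  cases r <;> simp only [liveRun, liveStep_congr M L hm hr]

theorem eq_nil_of_mem_liveStep {M : Code} {L n : ℕ} {mem recv P : Fin n → Data}
    (hP : P ∈ (liveStep M L mem recv).support) {j : Fin n} (hj : j ∈ block L n) :
    P j = Data.nil := by
  simpa [hj] using mem_support_sampleAll _ P hP j

theorem eq_nil_of_mem_liveRun {M rel : Code} {L n : ℕ} (r : ℕ) {mem recv P : Fin n → Data}
    {ρ : Data} (hP : P ∈ (liveRun M rel L r mem recv ρ).support) {j : Fin n}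
    (hj : j ∈ block L n) : P j = Data.nil := by
  induction r generalizing mem recv ρ with
  | zero => exact eq_nil_of_mem_liveStep hP hj
  | succ r ih =>
    simp only [liveRun, PMF.mem_support_bind_iff] at hP
    obtain ⟨_, _, _, _, h⟩ := hP
    exact ih h

/-! ### The programs of the adversary -/

namespace Code

/-- From `(j, n, results, received)`, the result of the activation of party `j`, or nothing if it
belongs to the block. -/
def stepC (M : Code) (L : ℕ) : Code :=
  ifNil (call (liveC L) (cons (hd (var 0)) (hd (tl (var 0)))))
    (letIn (call nthC (cons (hd (var 0)) (tl (tl (tl (var 0))))))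
      (letIn (hd (call nthC (cons (hd (var 1)) (hd (tl (tl (var 1)))))))
        M.machine))
    nil

/-- From `(n, results, received)`, the results of all parties outside the block. -/
def stepAllC (M : Code) (L : ℕ) : Code := call (tabC (stepC M L)) (cons (hd (var 0)) (var 0))

/-- From `(n, results)`, the messages in the results. -/
def sentC : Code := tabC (tl nthC)

/-- From `(n, results, received, relay)`, the situation after one more round. -/
def roundC (M rel : Code) (L : ℕ) : Code :=
  letIn (call (stepAllC M L) (cons (hd (var 0)) (cons (hd (tl (var 0))) (hd (tl (tl (var 0)))))))
    (letIn (call sentC (cons (hd (var 1)) (var 0)))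
      (letIn (tl (tl (tl (var 2))))
        (letIn rel.machine
          (cons (var 3) (cons (tl (var 0)) (hd (var 0)))))))

/-- From `(n, rounds, results, received, relay)`, the results of the last activations of a run. -/
def runC (M rel : Code) (L : ℕ) : Code :=
  letIn (fold (hd (tl (var 0))) (tl (tl (var 0)))
      (call (roundC M rel L) (cons (hd (var 2)) (var 1))))
    (call (stepAllC M L) (cons (hd (var 1)) (cons (hd (var 0)) (hd (tl (var 0))))))

/-- From `(j, s)`, where `s` is the start memory of the adversary, a cell with the start memory of
party `j`. -/
def startC : Code :=
  cons (cons (hd (tl (var 0))) (cons (hd (tl (tl (var 0)))) (cons (hd (tl (tl (tl (var 0)))))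
    (cons (hd (tl (tl (tl (tl (var 0)))))) (cons (hd (var 0)) nil))))) nil

/-- From the start memory of the adversary, the cells with the start memories of all parties. -/
def startAllC : Code := call (tabC startC) (cons (hd (tl (var 0))) (var 0))

/-- A fixed bit. -/
def bitC (b : Bool) : Code := if b then cons nil nil else nil

/-- From the start memory of the adversary, the situation in which a run starts. -/
def initC (b : Bool) : Code :=
  cons (call startAllC (var 0))
    (cons (call (tabC (bitC b)) (cons (hd (tl (var 0))) nil))
      (cons (hd (var 0)) (cons (hd (tl (var 0))) nil)))

/-- From `(j, i, results)`, the message from `j` to `i`. -/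
def messageC : Code :=
  call nthC (cons (hd (tl (var 0))) (tl (call nthC (cons (hd (var 0)) (tl (tl (var 0)))))))

/-- From `(j, n, i, messages)`, whether `j` is to be corrupted. -/
def corruptC (L : ℕ) (sim : Bool) : Code :=
  ifNil (call (liveC L) (cons (hd (var 0)) (hd (tl (var 0)))))
    (if sim then call nthC (cons (hd (var 0)) (tl (tl (tl (var 0))))) else nil)
    (call eqC (cons (hd (var 0)) (hd (tl (tl (var 0))))))

/-- From `(j, n, i, messages, results)`, the messages that `j` sends to everybody in the last
round. -/
def rowC (b : Bool) : Code :=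
  letIn (call nthC (cons (hd (var 0)) (hd (tl (tl (tl (var 0)))))))
    (letIn (call messageC (cons (hd (var 1)) (cons (hd (tl (tl (var 1))))
        (tl (tl (tl (tl (var 1))))))))
      (call (tabC (tl (var 0))) (cons (hd (tl (var 2)))
        (if b then ifNil (var 0) (var 1) (var 0) else ifNil (var 1) (var 0) (var 1)))))

/-- The first activation of the adversary. -/
def corruptionC (M rel : Code) (L : ℕ) (b sim : Bool) : Code :=
  letIn (call pickC (hd (tl (var 0))))
    (letIn (call (runC M rel L) (cons (hd (tl (var 1))) (cons (hd (tl (tl (var 1))))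
        (call (initC b) (var 1)))))
      (letIn (call (tabC messageC) (cons (hd (tl (var 2))) (cons (var 1) (var 0))))
        (letIn (cons (hd (tl (var 3))) (cons (var 2) (var 0)))
          (cons (cons (cons (hd (tl (tl (var 4)))) (cons (var 0) (call startAllC (var 4)))) nil)
            (call (tabC (corruptC L sim)) (cons (hd (var 0)) (var 0)))))))

/-- From the memory and what has been received, an activation of the adversary in a round of the
first part. -/
def roundActionC (M : Code) (L : ℕ) : Code :=
  letIn (call (stepAllC M L) (cons (hd (hd (tl (hd (hd (var 0))))))
      (cons (tl (tl (hd (hd (var 0))))) (tl (var 0)))))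
    (cons (cons (cons (tl (hd (hd (hd (var 1))))) (cons (hd (tl (hd (hd (var 1))))) (var 0))) nil)
      (call sentC (cons (hd (hd (tl (hd (hd (var 1)))))) (var 0))))

/-- From the memory and what has been received, the activation of the adversary in the
point-to-point round. -/
def lastActionC (M : Code) (L : ℕ) (b : Bool) : Code :=
  letIn (call (stepAllC M L) (cons (hd (hd (tl (hd (hd (var 0))))))
      (cons (tl (tl (hd (hd (var 0))))) (hd (tl (var 0))))))
    (cons nil (call (tabC (rowC b)) (cons (hd (hd (tl (hd (hd (var 1))))))
      (cons (hd (hd (tl (hd (hd (var 1))))))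
        (cons (hd (tl (hd (tl (hd (hd (var 1)))))))
          (cons (tl (tl (hd (tl (hd (hd (var 1))))))) (var 0)))))))

end Code

open Code in
/-- The adversary. It picks a party `i`, simulates a run in which the block is silent and all
inputs are `b`, and corrupts the block without `i` and (if `sim` is set) all the parties that send
a message to `i` in the simulation. The former are silent, the latter follow the protocol until
the last round. In the last round, they send what they should send to `i` according to the
simulation or to the protocol; the execution with input `false` takes precedence. -/
def attack (M rel : Code) (L : ℕ) (b sim : Bool) : Code :=
  -- The start memory is a list with four entries and has a nonempty tail; every later memory is a
  -- cell with an empty tail. The inner test reads the number of remaining rounds.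
  ifNil (tl (var 0))
    (ifNil (hd (hd (var 0)))
      (call (lastActionC M L b) (cons (var 0) (var 1)))
      (call (roundActionC M L) (cons (var 0) (var 1))))
    (call (corruptionC M rel L b sim) (var 0))

/-- The memory of the adversary after its first activation: the number of remaining rounds, the
picked party, the simulated messages to it, and the last results of all parties. -/
def attackMemory (n : ℕ) (r : ℕ) (i : ℕ) (msgs results : Data) : Data :=
  Data.cons (Data.cons (Data.unary r)
    (Data.cons (Data.cons (Data.unary n) (Data.cons (Data.unary i) msgs)) results)) Data.nil

/-! ### What the programs compute -/

namespace Code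

theorem val_stepC (M : Code) (L n j : ℕ) (results recv : Data) :
    (stepC M L).val [Data.cons (Data.unary j) (Data.cons (Data.unary n)
      (Data.cons results recv))] =
      if L * j < n then PMF.pure Data.nil else M.val [(results.get j).hd, recv.get j] := by
  simp only [stepC, val_ifNil, val_call, val_cons, val_hd, val_tl, val_var, List.getD_cons_zero,
    List.getD_cons_succ, PMF.pure_map, PMF.pure_bind, Data.hd_cons, Data.tl_cons, val_liveC,
    Data.unary_eq_nil, val_letIn, val_nthC, val_machine, val_nil, Nat.sub_eq_zero_iff_le]
  by_cases h : L * j < n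
  · rw [if_pos h, if_neg (not_le.2 h)]
  · rw [if_neg h, if_pos (not_lt.1 h)]

theorem val_stepAllC (M : Code) (L n : ℕ) (results recv : Data) :
    (stepAllC M L).val [Data.cons (Data.unary n) (Data.cons results recv)] =
      (liveStep M L (fun j : Fin n => (results.get j).hd) (fun j => recv.get j)).map
        Data.ofVec := by
  simp only [stepAllC, val_call, val_cons, val_hd, val_var, List.getD_cons_zero, PMF.pure_map,
    PMF.pure_bind, Data.hd_cons, val_tabC, val_stepC, liveStep, mem_block]

theorem val_sentC (n : ℕ) (results : Data) :
    sentC.val [Data.cons (Data.unary n) results] =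
      PMF.pure (Data.ofVec fun j : Fin n => (results.get j).tl) :=
  val_tabC_pure _ _ _ (fun j => (results.get j).tl) fun j => by simp [PMF.pure_map]

theorem val_roundC (M rel : Code) (L n : ℕ) (results recv ρ : Data) :
    (roundC M rel L).val [Data.cons (Data.unary n) (Data.cons results (Data.cons recv ρ))] =
      (liveStep M L (fun j : Fin n => (results.get j).hd) (fun j => recv.get j)).bind fun P =>
        (rel.val [ρ, Data.ofVec fun j => (P j).tl]).map fun v =>
          Data.cons (Data.ofVec P) (Data.cons v.tl v.hd) := by
  simp only [roundC, val_call, val_cons, val_hd, val_tl, val_var, List.getD_cons_zero,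
    List.getD_cons_succ, PMF.pure_map, PMF.pure_bind, Data.hd_cons, Data.tl_cons, val_letIn,
    val_stepAllC, val_sentC, val_machine, PMF.bind_map, Function.comp_def, Data.get_ofVec]
  rfl

theorem val_runC (M rel : Code) (L n r : ℕ) (results recv ρ : Data) :
    (runC M rel L).val [Data.cons (Data.unary n) (Data.cons (Data.unary r)
      (Data.cons results (Data.cons recv ρ)))] =
      (liveRun M rel L r (fun j : Fin n => (results.get j).hd) (fun j => recv.get j) ρ).map
        Data.ofVec := by
  simp only [runC, val_call, val_cons, val_hd, val_tl, val_var, List.getD_cons_zero,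
    List.getD_cons_succ, PMF.pure_map, PMF.pure_bind, Data.hd_cons, Data.tl_cons, val_letIn,
    val_fold, Data.toList_unary]
  induction r generalizing results recv ρ with
  | zero => simp [loopVal, val_stepAllC, liveRun]
  | succ r ih =>
    simp only [List.replicate_succ, loopVal, val_roundC, PMF.bind_bind, PMF.bind_map,
      Function.comp_def, ih, liveRun, PMF.map_bind, Data.get_ofVec]

theorem val_startAllC (κ n r : ℕ) (crs : Data) :
    startAllC.val [Data.ofList [Data.unary κ, Data.unary n, Data.unary r, crs]] =
      PMF.pure (Data.ofVec fun j : Fin n => Data.cons (Data.ofList [Data.unary κ, Data.unary n,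
        Data.unary r, crs, Data.unary j]) Data.nil) := by
  simp only [startAllC, val_call, val_cons, val_hd, val_tl, val_var, List.getD_cons_zero,
    PMF.pure_map, PMF.pure_bind, Data.ofList, Data.hd_cons, Data.tl_cons]
  refine val_tabC_pure _ _ _ (fun j => Data.cons (Data.ofList [Data.unary κ, Data.unary n,
        Data.unary r, crs, Data.unary j]) Data.nil) fun j => ?_
  simp [startC, PMF.pure_map, Data.ofList]

theorem val_bitC (b : Bool) (env : List Data) :
    (bitC b).val env = PMF.pure (Data.ofBool b) := by
  cases b <;> simp [bitC, Data.ofBool]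

theorem val_initC (b : Bool) (κ n r : ℕ) (crs : Data) :
    (initC b).val [Data.ofList [Data.unary κ, Data.unary n, Data.unary r, crs]] =
      PMF.pure (Data.cons (Data.ofVec fun j : Fin n => Data.cons (Data.ofList [Data.unary κ,
        Data.unary n, Data.unary r, crs, Data.unary j]) Data.nil)
        (Data.cons (Data.ofVec fun _ : Fin n => Data.ofBool b)
          (Data.ofList [Data.unary κ, Data.unary n]))) := by
  have h := val_tabC_pure (bitC b) n Data.nil (fun _ => Data.ofBool b) (fun j => val_bitC b _)
  have h2 := val_startAllC κ n r crs
  simp only [Data.ofList] at h2 ⊢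
  simp only [initC, val_call, val_cons, val_hd, val_tl, val_var, List.getD_cons_zero,
    PMF.pure_map, PMF.pure_bind, Data.hd_cons, Data.tl_cons, h2, h, val_nil]

theorem val_messageC (i j : ℕ) (results : Data) :
    messageC.val [Data.cons (Data.unary j) (Data.cons (Data.unary i) results)] =
      PMF.pure ((results.get j).tl.get i) := by
  simp [messageC, PMF.pure_map]

theorem val_corruptC (L : ℕ) (sim : Bool) (n i j : ℕ) (msgs : Data) :
    (corruptC L sim).val [Data.cons (Data.unary j) (Data.cons (Data.unary n)
      (Data.cons (Data.unary i) msgs))] =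
      PMF.pure (if L * j < n then (if j = i then Data.nil else Data.cons Data.nil Data.nil)
        else if sim then msgs.get j else Data.nil) := by
  simp only [corruptC, val_ifNil, val_call, val_cons, val_hd, val_tl, val_var,
    List.getD_cons_zero, PMF.pure_map, PMF.pure_bind, Data.hd_cons, Data.tl_cons, val_liveC,
    Data.unary_eq_nil, val_eqC, Nat.sub_eq_zero_iff_le]
  by_cases h : L * j < n
  · rw [if_pos h, if_neg (not_le.2 h)]
  · rw [if_neg h, if_pos (not_lt.1 h)]
    cases sim <;> simp [PMF.pure_map]

end Code

/-- The message in the execution with input `false` if there is one, and otherwise the one in the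
execution with input `true`. -/
def precedence (m₀ m₁ : Data) : Data := if m₀ = Data.nil then m₁ else m₀

/-- The message that a corrupted party sends, from the simulated one and the one of the
protocol, where `b` is the input bit in the simulation. -/
def combine (b : Bool) (simulated actual : Data) : Data :=
  if b then precedence actual simulated else precedence simulated actual

namespace Code

theorem val_rowC (b : Bool) (n i j : ℕ) (msgs results : Data) :
    (rowC b).val [Data.cons (Data.unary j) (Data.cons (Data.unary n) (Data.cons (Data.unary i)
      (Data.cons msgs results)))] =
      PMF.pure (Data.ofVec fun _ : Fin n =>
        combine b (msgs.get j) ((results.get j).tl.get i)) := by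
  have h : ∀ c, (tabC (tl (var 0))).val [Data.cons (Data.unary n) c] =
      PMF.pure (Data.ofVec fun _ : Fin n => c) := fun c =>
    val_tabC_pure _ _ _ (fun _ => c) fun j => by simp [PMF.pure_map]
  cases b
  · simp only [rowC, val_letIn, val_call, val_cons, val_hd, val_tl, val_var,
      List.getD_cons_zero, List.getD_cons_succ, PMF.pure_map, PMF.pure_bind, Data.hd_cons,
      Data.tl_cons, val_nthC, val_messageC, val_ifNil, combine, precedence, Bool.false_eq_true,
      if_false]
    split_ifs <;> simp [h]
  · simp only [rowC, val_letIn, val_call, val_cons, val_hd, val_tl, val_var,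
      List.getD_cons_zero, List.getD_cons_succ, PMF.pure_map, PMF.pure_bind, Data.hd_cons,
      Data.tl_cons, val_nthC, val_messageC, val_ifNil, combine, precedence, if_true]
    split_ifs <;> simp [h]

end Code

/-- Whether the adversary corrupts party `j`, given the results in its simulation. -/
def corruptFlag (L : ℕ) (sim : Bool) {n : ℕ} (i : ℕ) (P : Fin n → Data) (j : Fin n) : Data :=
  if j ∈ block L n then (if (j : ℕ) = i then Data.nil else Data.cons Data.nil Data.nil)
  else if sim then (P j).tl.get i else Data.nil

/-- An inequality suffices because only the guess `i` is kept. The arbitrary continuation `f` makes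
the bound applicable to the rest of the execution. -/
theorem val_attack_start (M rel : Code) (L : ℕ) (b sim : Bool) (κ n r : ℕ) (crs : Data)
    (d : Data) (i : ℕ) (hi : i < n) {α : Type} (f : Data → PMF α) (E : Set α) :
    1 / (2 * n : ENNReal) * Pr ((liveRun M rel L r (fun j : Fin n => Data.ofList [Data.unary κ,
          Data.unary n, Data.unary r, crs, Data.unary j]) (fun _ => Data.ofBool b)
          (Data.ofList [Data.unary κ, Data.unary n])).bind fun P =>
        f (Data.cons (attackMemory n r i (Data.ofVec fun j => (P j).tl.get i)
            (Data.ofVec fun j : Fin n => Data.cons (Data.ofList [Data.unary κ, Data.unary n,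
              Data.unary r, crs, Data.unary j]) Data.nil))
          (Data.ofVec (corruptFlag L sim i P)))) E ≤
      Pr (((attack M rel L b sim).val [Data.ofList [Data.unary κ, Data.unary n, Data.unary r, crs],
        d]).bind f) E := by
  have h1 := Code.val_initC b κ n r crs
  have h2 := Code.val_startAllC κ n r crs
  have h3 : ∀ (i : ℕ) P, (Code.tabC Code.messageC).val
      [Data.cons (Data.unary n) (Data.cons (Data.unary i) P)] =
      PMF.pure (Data.ofVec fun j : Fin n => (P.get j).tl.get i) := fun i P =>
    Code.val_tabC_pure _ _ _ _ fun j => Code.val_messageC i j P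
  have h4 : ∀ (i : ℕ) msgs, (Code.tabC (Code.corruptC L sim)).val
      [Data.cons (Data.unary n) (Data.cons (Data.unary n) (Data.cons (Data.unary i) msgs))] =
      PMF.pure (Data.ofVec fun j : Fin n => if L * (j : ℕ) < n then
        (if (j : ℕ) = i then Data.nil else Data.cons Data.nil Data.nil)
        else if sim then msgs.get j else Data.nil) := fun i msgs =>
    Code.val_tabC_pure _ _ _ (fun j => if L * (j : ℕ) < n then
        (if (j : ℕ) = i then Data.nil else Data.cons Data.nil Data.nil)
        else if sim then msgs.get j else Data.nil) fun j => Code.val_corruptC L sim n i j msgs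
  simp only [Data.ofList] at h1 h2 ⊢
  simp only [attack, Code.val_ifNil, Code.val_tl, Code.val_hd, Code.val_var, Code.val_call,
    List.getD_cons_zero, PMF.pure_map, PMF.pure_bind, Data.hd_cons,
    Data.tl_cons, Code.corruptionC, Code.val_letIn, reduceCtorEq, if_false, PMF.bind_bind]
  refine le_trans ?_ (mul_Pr_le_Pr_bind _ _ _ (Data.unary i))
  gcongr
  · exact Code.pickC_ge n i hi
  · simp only [Code.val_cons, Code.val_hd, Code.val_tl, Code.val_var, List.getD_cons_zero,
      List.getD_cons_succ, PMF.pure_map, PMF.pure_bind, Data.hd_cons, Data.tl_cons,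
      Code.val_call, h1, h2, h3, h4, Code.val_runC, PMF.bind_map, Function.comp_def,
      Data.get_ofVec, Code.val_nil, PMF.bind_bind]
    apply le_of_eq
    congr 2
    funext P
    have hflag : corruptFlag L sim i P = fun j : Fin n => if L * (j : ℕ) < n then
        (if (j : ℕ) = i then Data.nil else Data.cons Data.nil Data.nil)
        else if sim then (P j).tl.get i else Data.nil := by
      funext j
      simp only [corruptFlag, mem_block]
    simp only [attackMemory, hflag]

theorem val_attack_round (M rel : Code) (L : ℕ) (b sim : Bool) (n r i : ℕ)
    (msgs results recv : Data) :
    (attack M rel L b sim).val [attackMemory n (r + 1) i msgs results, recv] =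
      (liveStep M L (fun j : Fin n => (results.get j).hd) (fun j => recv.get j)).map fun P =>
        Data.cons (attackMemory n r i msgs (Data.ofVec P)) (Data.ofVec fun j => (P j).tl) := by
  simp only [attack, attackMemory, Code.val_ifNil, Code.val_tl, Code.val_hd, Code.val_var,
    Code.val_call, List.getD_cons_zero, List.getD_cons_succ, PMF.pure_map, PMF.pure_bind,
    Data.hd_cons, Data.tl_cons, if_true, Data.unary_eq_nil, Nat.succ_ne_zero, if_false,
    Code.val_cons, Code.roundActionC, Code.val_letIn, Code.val_stepAllC, PMF.bind_map,
    Function.comp_def, Code.val_nil, Code.val_sentC, Data.get_ofVec, Data.tl_unary,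
    Nat.add_sub_cancel]
  rfl

theorem val_attack_last (M rel : Code) (L : ℕ) (b sim : Bool) (n i : ℕ)
    (msgs results recv recv' : Data) :
    (attack M rel L b sim).val [attackMemory n 0 i msgs results, Data.cons recv recv'] =
      (liveStep M L (fun j : Fin n => (results.get j).hd) (fun j => recv.get j)).map fun P =>
        Data.cons Data.nil (Data.ofVec fun j : Fin n => Data.ofVec fun _ : Fin n =>
          combine b (msgs.get j) ((P j).tl.get i)) := by
  have h : ∀ P : Fin n → Data, (Code.tabC (Code.rowC b)).val [Data.cons (Data.unary n)
      (Data.cons (Data.unary n) (Data.cons (Data.unary i) (Data.cons msgs (Data.ofVec P))))] =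
      PMF.pure (Data.ofVec fun j : Fin n => Data.ofVec fun _ : Fin n =>
        combine b (msgs.get j) ((P j).tl.get i)) := by
    intro P
    rw [Code.val_tabC_pure _ _ _ _ fun j => Code.val_rowC b n i j msgs _]
    simp only [Data.get_ofVec]
  simp only [attack, attackMemory, Code.val_ifNil, Code.val_tl, Code.val_hd, Code.val_var,
    Code.val_call, List.getD_cons_zero, List.getD_cons_succ, PMF.pure_map, PMF.pure_bind,
    Data.hd_cons, Data.tl_cons, if_true, Data.unary_zero,
    Code.val_cons, Code.lastActionC, Code.val_letIn, Code.val_stepAllC, PMF.bind_map,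
    Function.comp_def, Code.val_nil, h]
  rfl

/-! ### The attack in an execution -/

/-- The parties that the adversary corrupts, given the picked party and the results in its
simulation. -/
def corruptSet (L : ℕ) (sim : Bool) {n : ℕ} (i : ℕ) (P : Fin n → Data) : Finset (Fin n) :=
  Finset.univ.filter fun j => corruptFlag L sim i P j ≠ Data.nil

/-- Forgets the entries of the corrupted parties. -/
def Outcome.trim {n : ℕ} (o : Outcome n) : Outcome n where
  corrupted := o.corrupted
  sent := fun j k => if j ∈ o.corrupted then Data.nil else o.sent j k
  output := fun j => if j ∈ o.corrupted then none else o.output j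

/-- The results of all parties before the point-to-point messages are delivered, from those of
the parties outside the block and the one of the isolated party `i`. -/
def allResults {n : ℕ} (i : Fin n) (P : Fin n → Data) (l : Data) (j : Fin n) : Data :=
  if j = i then l else P j

/-- The messages that party `k` gets in the point-to-point round. -/
def delivered {n : ℕ} (b : Bool) (I : Finset (Fin n)) (i : Fin n) (msgs P : Fin n → Data)
    (l : Data) (k : Fin n) : Data :=
  Data.ofVec fun j => if j ∈ I then combine b (msgs j) ((P j).tl.get i)
    else (allResults i P l j).tl.get k

/-- The output of party `k`. -/
def finalOutput (M : Code) {n : ℕ} (b : Bool) (I : Finset (Fin n)) (i : Fin n)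
    (msgs P : Fin n → Data) (l : Data) (k : Fin n) : PMF (Option Bool) :=
  if k ∈ I then PMF.pure none
  else (M.val [(allResults i P l k).hd, delivered b I i msgs P l k]).map fun d => d.tl.toBool?

/-- The outcome of an execution, as a function of the results of the last activation before the
point-to-point messages are delivered. -/
def finish (M : Code) {n : ℕ} (b : Bool) (I : Finset (Fin n)) (i : Fin n)
    (msgs P : Fin n → Data) (l : Data) : PMF (Outcome n) :=
  (sampleAll (finalOutput M b I i msgs P l)).map fun out =>
    { corrupted := I
      sent := fun j k => if j ∈ I then Data.nil else (allResults i P l j).tl.get k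
      output := out }

/-- In the execution every party is activated twice, by the protocol and in the adversary's head,
but only one of the two results matters for each party. By independence the irrelevant samples
integrate out, and that of the isolated party splits off. -/
theorem merge_sampleAll {n : ℕ} {γ : Type} (I : Finset (Fin n)) (i : Fin n)
    (f g : Fin n → PMF Data) (G : (Fin n → Data) → Data → PMF γ) :
    ((sampleAll f).bind fun v => (sampleAll g).bind fun q =>
      G (fun j => if j ∈ I then q j else if j = i then Data.nil else v j) (v i)) =
    (sampleAll fun j => if j ∈ I then g j else if j = i then PMF.pure Data.nil else f j).bind
      fun P => (f i).bind fun l => G P l := by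
  have h := sampleAll_zip f g fun j a b => if j ∈ I then b else if j = i then Data.nil else a
  have h2 : (fun j => (f j).bind fun a => (g j).bind fun b =>
      PMF.pure (if j ∈ I then b else if j = i then Data.nil else a)) =
      fun j => if j ∈ I then g j else if j = i then PMF.pure Data.nil else f j := by
    funext j
    by_cases h1 : j ∈ I
    · simp [h1]
    · by_cases h2 : j = i
      · subst h2; simp [h1]
      · simp [h1, h2]
  rw [h2] at h
  rw [← h]
  conv_rhs => rw [PMF.bind_comm]
  conv_lhs => rw [sampleAll_resample f i]
  simp only [PMF.bind_bind, PMF.pure_bind, PMF.bind_map, Function.comp_def]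
  congr 1; funext l
  congr 1; funext v
  congr 1; funext q
  rw [Function.update_self]
  congr 1; funext j
  split_ifs with h1 h2
  · rfl
  · rfl
  · rw [Function.update_of_ne h2]

/-- Outside the block, corrupted parties are run by the adversary with the same program and inputs
as honest ones. Inside it, all parties but `i` are corrupted and silent, and the entry of `i` has
been blanked. -/
theorem liveStep_merge (M : Code) {L n : ℕ} {I : Finset (Fin n)} {i : Fin n}
    (hi : i ∉ I) (hib : i ∈ block L n) (hb : ∀ j ∈ block L n, j ≠ i → j ∈ I)
    (mem mem' recv : Fin n → Data) :
    (sampleAll fun j => if j ∈ I then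
        (if j ∈ block L n then PMF.pure Data.nil
          else M.val [mem' j, if j ∈ I then recv j else Data.nil])
      else if j = i then PMF.pure Data.nil else M.val [mem j, recv j]) =
    liveStep M L (fun j => if j ∈ I then mem' j else mem j) recv := by
  unfold liveStep
  congr 1; funext j
  by_cases h1 : j ∈ I
  · simp [h1]
  · by_cases h2 : j = i
    · subst h2; simp [hi, hib]
    · simp only [h1, h2, if_false]
      rw [if_neg fun h => h1 (hb j h h2)]

theorem sampleAll_activate {n : ℕ} (M : Code) (s r : Fin n → Data) :
    (sampleAll fun j => activate M (s j) (r j)) =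
      (sampleAll fun j => M.val [s j, r j]).map fun v j => ((v j).hd, (v j).tl) := by
  rw [sampleAll_map (fun j => M.val [s j, r j]) fun _ d => (d.hd, d.tl)]
  simp only [activate_eq]

/-- The execution also activates the protocol for corrupted parties, with meaningless results.
Trimming erases them, so that the last round depends only on the run outside the block and on the
isolated party. -/
theorem map_trim_lastRound (π : Protocol) (rel : Code) {L n : ℕ} (b sim : Bool)
    {I : Finset (Fin n)} {i : Fin n} (hi : i ∉ I) (hib : i ∈ block L n)
    (hb : ∀ j ∈ block L n, j ≠ i → j ∈ I) (msgs : Fin n → Data) (results : Data)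
    (c : Config n) (hc : c.adversary = attackMemory n 0 i (Data.ofVec msgs) results) :
    (lastRound π (attack π.code rel L b sim) I c).map Outcome.trim =
      (liveStep π.code L (fun j => if j ∈ I then (results.get j).hd else c.memory j)
        c.received).bind fun P =>
      (π.code.val [c.memory i, c.received i]).bind fun l =>
        finish π.code b I i msgs P l := by
  simp only [lastRound, PMF_bind_eq, PMF_pure_eq, sampleAll_activate, hc]
  simp only [activate_eq, val_attack_last, PMF.bind_map, PMF.map_bind, PMF.pure_map,
    Function.comp_def, Data.get_ofVec, Data.tl_cons]
  rw [← liveStep_merge π.code hi hib hb]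
  refine Eq.trans ?_ (merge_sampleAll I i (fun j => π.code.val [c.memory j, c.received j]) _
    fun P l => finish π.code b I i msgs P l)
  congr 1; funext v
  unfold liveStep
  congr 1; funext q
  unfold finish
  have hfin : finalOutput π.code b I i msgs
      (fun j => if j ∈ I then q j else if j = i then Data.nil else v j) (v i) = fun k =>
      (π.code.val [(v k).hd, Data.ofVec fun j =>
        if j ∈ I then combine b (msgs j) ((q j).tl.get i) else (v j).tl.get k]).map
        fun d => if k ∈ I then none else d.tl.toBool? := by
    funext k
    unfold finalOutput
    by_cases hk : k ∈ I
    · simp only [hk, if_true]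
      exact (PMF.map_const _ _).symm
    · have h1 : allResults i (fun j => if j ∈ I then q j else if j = i then Data.nil else v j)
          (v i) k = v k := by
        unfold allResults
        by_cases h : k = i <;> simp [h, hk]
      simp only [hk, if_false, h1]
      congr 3
      unfold delivered
      congr 3; funext j
      by_cases hj : j ∈ I
      · simp [hj]
      · by_cases h : j = i <;> simp [allResults, h, hj, hi]
  rw [hfin, ← sampleAll_map _ fun (k : Fin n) (d : Data) =>
    (if k ∈ I then none else d.tl.toBool? : Option Bool), PMF.map_comp,
    PMF.map]
  congr 1; funext w
  simp only [Function.comp_apply, Outcome.trim]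
  congr 2
  funext j k
  by_cases hj : j ∈ I
  · simp [hj]
  · by_cases h : j = i <;> simp [allResults, h, hj, hi]

/-- This is the decoupling: with `D = {i}` and the rest of the block silent, neither the relay nor
any party outside the block learns anything about `i`, and `i` learns nothing about them. The two
runs are therefore independent, given the reference string and the simulated messages. -/
theorem map_trim_aeRounds (H : HybridModel) (π : Protocol) {L n : ℕ} (b sim : Bool)
    {I : Finset (Fin n)} {i : Fin n} (hi : i ∉ I) (hib : i ∈ block L n)
    (hb : ∀ j ∈ block L n, j ≠ i → j ∈ I) (msgs : Fin n → Data) (r : ℕ) (results : Data)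
    (c : Config n) (hc : c.adversary = attackMemory n r i (Data.ofVec msgs) results) :
    ((aeRounds H π (attack π.code H.relay L b sim) I {i} r c).bind
      (lastRound π (attack π.code H.relay L b sim) I)).map Outcome.trim =
      (liveRun π.code H.relay L r (fun j => if j ∈ I then (results.get j).hd else c.memory j)
        c.received c.relay).bind fun P =>
      (loneRun π.code r (c.memory i) (c.received i)).bind fun l =>
        finish π.code b I i msgs P l := by
  induction r generalizing results c with
  | zero =>
    simp only [aeRounds, PMF_pure_eq, PMF.pure_bind, liveRun, loneRun]
    exact map_trim_lastRound π H.relay b sim hi hib hb msgs results c hc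
  | succ r ih =>
    simp only [aeRounds, PMF_bind_eq, aeRound, PMF_pure_eq, sampleAll_activate, hc]
    simp only [activate_eq, val_attack_round, PMF.bind_map, PMF.pure_bind, Function.comp_def,
      Data.get_ofVec, Data.hd_cons, Data.tl_cons, PMF.bind_bind, PMF.map_bind (p := sampleAll _),
      PMF.map_bind (p := liveStep _ _ _ _), PMF.map_bind (p := H.relay.val _)]
    simp only [liveRun, loneRun, PMF.bind_bind]
    rw [← liveStep_merge π.code hi hib hb]
    -- The activation of `i` is unrelated to the relay and the other parties, so it may be drawn
    -- before them, as in the order of the actual round.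
    have swap : ∀ P₁ : Fin n → Data,
        ((H.relay.val [c.relay, Data.ofVec fun j => (P₁ j).tl]).bind fun w =>
          (liveRun π.code H.relay L r (fun j => (P₁ j).hd) (fun j => w.tl.get j) w.hd).bind
            fun P => (π.code.val [c.memory i, c.received i]).bind fun l₁ =>
              (loneRun π.code r l₁.hd Data.nil).bind fun l => finish π.code b I i msgs P l) =
        (π.code.val [c.memory i, c.received i]).bind fun l₁ =>
          (H.relay.val [c.relay, Data.ofVec fun j => (P₁ j).tl]).bind fun w =>
          (liveRun π.code H.relay L r (fun j => (P₁ j).hd) (fun j => w.tl.get j) w.hd).bind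
            fun P => (loneRun π.code r l₁.hd Data.nil).bind fun l =>
              finish π.code b I i msgs P l := by
      intro P₁
      rw [PMF.bind_comm (π.code.val _)]
      congr 1; funext w
      rw [PMF.bind_comm (π.code.val _)]
    simp only [swap]
    refine Eq.trans ?_ (merge_sampleAll I i (fun j => π.code.val [c.memory j, c.received j]) _ _)
    congr 1; funext v
    unfold liveStep
    congr 1; funext q
    have hsent : (fun j => if j ∈ ({i} : Finset (Fin n)) then Data.nil
        else if j ∈ I then (q j).tl else (v j).tl) =
        fun j => (if j ∈ I then q j else if j = i then Data.nil else v j).tl := by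
      funext j
      by_cases h : j = i
      · simp [h, hi]
      · by_cases hj : j ∈ I <;> simp [h, hj]
    rw [hsent]
    congr 1; funext w
    rw [ih (Data.ofVec q) _ rfl]
    simp only [Finset.mem_singleton, if_true]
    congr 1
    -- The configuration holds a genuine memory for `i`, where the merged vector is blank; `liveRun`
    -- never reads it, since `i` lies in the block.
    refine liveRun_congr _ _ _ _ (fun j hj => ?_) (fun j hj => ?_) _
    · have : j ≠ i := fun h => hj (h ▸ hib)
      by_cases h : j ∈ I <;> simp [h, this]
    · have : j ≠ i := fun h => hj (h ▸ hib)
      simp [this]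

/-- The outcome of the attack when party `i` is picked and isolated. -/
def ideal (H : HybridModel) (π : Protocol) (L : ℕ) (b sim : Bool) (κ : ℕ)
    (i : Fin (H.parties κ)) (x : Fin (H.parties κ) → Bool) : PMF (Outcome (H.parties κ)) :=
  (H.crs κ).bind fun crs =>
    (liveRun π.code H.relay L (π.rounds κ) (fun j : Fin (H.parties κ) => partyStart H π κ crs j)
      (fun _ => Data.ofBool b) (relayStart H κ)).bind fun P' =>
    (liveRun π.code H.relay L (π.rounds κ) (fun j : Fin (H.parties κ) => partyStart H π κ crs j)
      (fun j => Data.ofBool (x j)) (relayStart H κ)).bind fun P =>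
    (loneRun π.code (π.rounds κ) (partyStart H π κ crs i) (Data.ofBool (x i))).bind fun l =>
      finish π.code b (corruptSet L sim i P') i (fun j => (P' j).tl.get i) P l

theorem mem_corruptSet_of_mem_block {L n : ℕ} {sim : Bool} {i : Fin n} {P : Fin n → Data}
    {j : Fin n} (hj : j ∈ block L n) : j ∈ corruptSet L sim i P ↔ j ≠ i := by
  rw [corruptSet, Finset.mem_filter, corruptFlag, if_pos hj]
  simp [Fin.ext_iff]

theorem mem_corruptSet_of_notMem_block {L n : ℕ} {sim : Bool} {i : Fin n} {P : Fin n → Data}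
    {j : Fin n} (hj : j ∉ block L n) :
    j ∈ corruptSet L sim i P ↔ sim = true ∧ (P j).tl.get i ≠ Data.nil := by
  cases sim <;> simp [corruptSet, corruptFlag, hj]

theorem corrupted_of_mem_finish {M : Code} {n : ℕ} {b : Bool} {I : Finset (Fin n)} {i : Fin n}
    {msgs P : Fin n → Data} {l : Data} {o : Outcome n}
    (ho : o ∈ (finish M b I i msgs P l).support) : o.corrupted = I := by
  rw [finish, PMF.mem_support_map_iff] at ho
  obtain ⟨_, _, rfl⟩ := ho
  rfl

theorem Pr_eq_zero {α : Type} (μ : PMF α) (E : Set α) (h : ∀ a ∈ μ.support, a ∉ E) :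
    Pr μ E = 0 :=
  (PMF.toOuterMeasure_apply_eq_zero_iff μ E).2 (Set.disjoint_left.2 h)

/-- The factors are the probabilities of guessing `i` and of isolating exactly `i`. The second is
guaranteed only for admissible corrupted sets, hence the assumption that the event forces
admissibility. -/
theorem ideal_le_execution (H : HybridModel) (π : Protocol) (L : ℕ) (b sim : Bool) (κ : ℕ)
    (i : Fin (H.parties κ)) (hib : i ∈ block L (H.parties κ)) (x : Fin (H.parties κ) → Bool)
    (B : ℝ) (q : ENNReal)
    (hq : ∀ I : Finset (Fin (H.parties κ)), (I.card : ℝ) ≤ B → i ∉ I →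
      1 ≤ q * H.isolated κ I {i})
    (E : Set (Outcome (H.parties κ))) (hE : ∀ o ∈ E, (o.corrupted.card : ℝ) ≤ B) :
    1 / (2 * H.parties κ : ENNReal) * (1 / q * Pr (ideal H π L b sim κ i x) E) ≤
      Pr ((execution H π (attack π.code H.relay L b sim) κ x).map Outcome.trim) E := by
  unfold ideal execution
  simp only [PMF_bind_eq, PMF.map_bind]
  rw [← mul_assoc]
  refine mul_Pr_bind_le _ _ _ _ _ _ fun crs _ => ?_
  rw [activate_eq, PMF.bind_map, mul_assoc]
  refine le_trans ?_ (val_attack_start π.code H.relay L b sim κ (H.parties κ) (π.rounds κ) crs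
    Data.nil i i.2 _ E)
  refine mul_le_mul_right ?_ _
  refine mul_Pr_bind_le _ _ _ _ _ _ fun P' _ => ?_
  simp only [Function.comp_def, Data.hd_cons, Data.tl_cons, Data.get_ofVec]
  change _ ≤ Pr ((H.isolated κ (corruptSet L sim i P')).bind _) E
  have hi : i ∉ corruptSet L sim i P' := by rw [mem_corruptSet_of_mem_block hib]; simp
  have hb : ∀ j ∈ block L (H.parties κ), j ≠ i → j ∈ corruptSet L sim i P' :=
    fun j hj h => (mem_corruptSet_of_mem_block hj).2 h
  -- If the simulation leads to too many corruptions, the event is impossible on the left.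
  by_cases hcard : ((corruptSet L sim i P').card : ℝ) ≤ B
  · refine le_trans ?_ (mul_Pr_le_Pr_bind _ _ _ {i})
    have h1 : 1 / q ≤ H.isolated κ (corruptSet L sim i P') {i} :=
      ENNReal.div_le_of_le_mul' (hq _ hcard hi)
    refine mul_le_mul' h1 (le_of_eq ?_)
    refine congrArg (fun μ => Pr μ E) (Eq.symm ?_)
    rw [← PMF.map_bind]
    refine (map_trim_aeRounds H π b sim hi hib hb (fun j => (P' j).tl.get i) (π.rounds κ)
      (Data.ofVec fun j : Fin (H.parties κ) => Data.cons (partyStart H π κ crs j) Data.nil)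
      { memory := fun j => partyStart H π κ crs j
        received := fun j => Data.ofBool (x j)
        adversary := _
        relay := relayStart H κ } rfl).trans ?_
    congr 1
    refine congrArg (fun f => liveRun _ _ _ _ f _ _) ?_
    funext j
    simp only [Data.get_ofVec, Data.hd_cons]
    exact ite_self _
  · rw [Pr_eq_zero, mul_zero]
    · exact zero_le
    · intro o ho hoE
      simp only [PMF.mem_support_bind_iff] at ho
      obtain ⟨_, _, _, _, ho⟩ := ho
      exact hcard (corrupted_of_mem_finish ho ▸ hE o hoE)

/-! ### Step counts of the programs -/

namespace Code

/-- Whether a program only reads variables and builds or destructs cells. -/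
def isExpr : Code → Bool
  | var _ => true
  | nil => true
  | cons a b => a.isExpr && b.isExpr
  | hd a => a.isExpr
  | tl a => a.isExpr
  | _ => false

/-- The number of steps of such a program. -/
def size : Code → ℕ
  | cons a b => a.size + b.size + 1
  | hd a => a.size + 1
  | tl a => a.size + 1
  | _ => 1

/-- The value of such a program. -/
def exprVal : Code → List Data → Data
  | var k, env => env.getD k Data.nil
  | cons a b, env => Data.cons (a.exprVal env) (b.exprVal env)
  | hd a, env => (a.exprVal env).hd
  | tl a, env => (a.exprVal env).tl
  | _, _ => Data.nil

end Code

namespace Triple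

theorem expr {e : Code} (he : e.isExpr = true) (env : List Data) :
    Triple e env e.size (· = e.exprVal env) := by
  induction e with
  | var k => exact var k env
  | nil => exact nil env
  | cons a b iha ihb =>
    simp only [Code.isExpr, Bool.and_eq_true] at he
    exact cons (iha he.1) (ihb he.2) fun x y hx hy => by rw [hx, hy]; rfl
  | hd a ih => exact hd (ih he) fun x hx => by rw [hx]; rfl
  | tl a ih => exact tl (ih he) fun x hx => by rw [hx]; rfl
  | _ => simp [Code.isExpr] at he

theorem call_expr {p e : Code} {env : List Data} {M : ℕ} {S : Data → Prop}
    (he : e.isExpr = true) (h : Triple p [e.exprVal env] M S) :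
    Triple (Code.call p e) env (e.size + M + 1) S :=
  call (expr he env) fun x hx => by rw [hx]; exact h

theorem of_mem_val {p : Code} {env : List Data} {N : ℕ} {Q : Data → Prop}
    (h : Triple p env N Q) {x : Data} (hx : x ∈ (p.val env).support) : Q x := by
  rw [Code.val, PMF.mem_support_map_iff] at hx
  obtain ⟨u, hu, rfl⟩ := hx
  exact (h u hu).1

end Triple

open Code

theorem triple_dropC (a b : Data) :
    Triple dropC [Data.cons a b] (3 * a.toList.length + 5)
      (· = Data.tl^[a.toList.length] b) := by
  refine Triple.of_pure (Q := fun _ => True) ?_ (val_dropC a b)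
  refine (Triple.fold a.toList.length 2 (fun _ _ => True)
    ((Triple.expr (e := hd (var 0)) rfl _).mono le_rfl fun x hx => by rw [hx]; rfl)
    (Triple.expr (e := tl (var 0)) rfl _) (fun _ _ => trivial)
    (fun t _ x acc _ => (Triple.expr (e := tl (var 1)) rfl _).mono le_rfl fun _ _ => trivial)
    fun _ _ => trivial).mono ?_ fun _ h => h
  simp only [size]
  omega

theorem triple_nthC (j : ℕ) (d : Data) :
    Triple nthC [Data.cons (Data.unary j) d] (3 * j + 6) (· = d.get j) := by
  refine Triple.of_pure (Q := fun _ => True) ?_ (val_nthC j d)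
  refine (Triple.hd (triple_dropC _ _) (S := fun _ => True) fun _ _ => trivial).mono ?_
    fun _ h => h
  simp

theorem triple_tlsC (e : Code) (he : e.isExpr = true) (L : ℕ) (env : List Data) :
    Triple (tlsC e L) env (e.size + L) (fun _ => True) := by
  induction L with
  | zero => exact (Triple.expr he env).mono le_rfl fun _ _ => trivial
  | succ L ih => exact Triple.tl ih fun _ _ => trivial

theorem triple_liveC (L j n : ℕ) :
    Triple (liveC L) [Data.cons (Data.unary j) (Data.unary n)] (j * (L + 2) + 5)
      (· = Data.unary (n - L * j)) := by
  refine Triple.of_pure (Q := fun _ => True) ?_ (val_liveC L j n)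
  refine (Triple.fold j (L + 1) (fun _ _ => True)
    ((Triple.expr (e := hd (var 0)) rfl _).mono le_rfl
      fun x hx => by rw [hx]; simp [exprVal])
    (Triple.expr (e := tl (var 0)) rfl _) (fun _ _ => trivial)
    (fun t _ x acc _ => (triple_tlsC (var 1) rfl L _).mono (by simp only [size]; omega)
      fun _ _ => trivial)
    fun _ _ => trivial).mono ?_ fun _ h => h
  simp only [size]
  ring_nf; omega

theorem triple_addC (a b : ℕ) :
    Triple addC [Data.cons (Data.unary a) (Data.unary b)] (4 * a + 5)
      (· = Data.unary (a + b)) := by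
  refine Triple.of_pure (Q := fun _ => True) ?_ (val_addC a b)
  refine (Triple.fold a 3 (fun _ _ => True)
    ((Triple.expr (e := hd (var 0)) rfl _).mono le_rfl
      fun x hx => by rw [hx]; simp [exprVal])
    (Triple.expr (e := tl (var 0)) rfl _) (fun _ _ => trivial)
    (fun t _ x acc _ => (Triple.expr (e := cons nil (var 1)) rfl _).mono le_rfl
      fun _ _ => trivial)
    fun _ _ => trivial).mono ?_ fun _ h => h
  simp only [size]
  omega

theorem triple_eqC (a b : ℕ) :
    Triple eqC [Data.cons (Data.unary a) (Data.unary b)] (3 * a + 3 * b + 30)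
      (· = if a = b then Data.nil else Data.cons Data.nil Data.nil) := by
  refine Triple.of_pure (Q := fun _ => True) ?_ (val_eqC a b)
  have h1 := triple_dropC (Data.unary a) (Data.unary b)
  have h2 := triple_dropC (Data.unary b) (Data.unary a)
  simp only [Data.toList_unary, List.length_replicate] at h1 h2
  refine (Triple.ifNil (M := 3 * b + 20) (Triple.call_expr rfl h1) (fun _ => ?_)
    (fun _ _ _ => ?_)).mono ?_ fun _ h => h
  · refine (Triple.ifNil (M := 3) (Triple.call_expr rfl h2) (fun _ => ?_)
      (fun _ _ _ => ?_)).mono ?_ fun _ h => h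
    · exact (Triple.nil _).mono (by omega) fun _ _ => trivial
    · exact (Triple.expr (e := cons nil nil) rfl _).mono (by simp [size]) fun _ _ => trivial
    · simp only [size]; omega
  · exact (Triple.expr (e := cons nil nil) rfl _).mono (by simp only [size]; omega)
      fun _ _ => trivial
  · simp only [size]; omega

/-- Pass `t` calls `p` on index `n - (t + 1)`, so the counter is the only invariant needed for the
cost. The entries are then controlled through the support of the already known value distribution.
-/
theorem triple_tabC {p : Code} {n : ℕ} {c : Data} {B : ℕ} {Q : ℕ → Data → Prop}
    (h : ∀ j < n, Triple p [Data.cons (Data.unary j) c] B (Q j)) :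
    Triple (tabC p) [Data.cons (Data.unary n) c] (n * (B + 15) + 8)
      (fun x => ∃ v : Fin n → Data, x = Data.ofVec v ∧ ∀ j : Fin n, Q j (v j)) := by
  have cost : Triple (tabC p) [Data.cons (Data.unary n) c] (n * (B + 15) + 8)
      (fun _ => True) := by
    refine (Triple.tl (S := fun _ => True) (Triple.fold n (B + 14)
      (fun t acc => acc.hd = Data.unary (n - t))
      ((Triple.expr (e := hd (var 0)) rfl _).mono le_rfl
        fun x hx => by rw [hx]; simp [exprVal])
      ((Triple.expr (e := cons (hd (var 0)) nil) rfl _))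
      (fun x hx => by rw [hx]; rfl)
      (fun t ht x acc hacc => ?_) (S := fun _ => True) fun _ _ => trivial)
      fun _ _ => trivial).mono ?_ fun _ h => h
    · have ha : acc.hd.tl = Data.unary (n - (t + 1)) := by
        rw [hacc, Data.tl_unary, Nat.sub_sub]
      refine (Triple.letIn (Triple.expr (e := tl (hd (var 1))) rfl _) (fun y hy => ?_)
        (M := B + 10)).mono ?_ fun _ h => h
      · have hy' : y = Data.unary (n - (t + 1)) := hy.trans ha
        have hp := h (n - (t + 1)) (by omega)
        rw [← hy'] at hp
        exact (Triple.cons (R := fun _ => True) (Triple.expr (e := var 0) rfl _)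
          (Triple.cons (R := fun _ => True) (Triple.call_expr rfl hp)
            ((Triple.expr (e := tl (var 2)) rfl _).mono le_rfl fun _ _ => trivial)
            fun _ _ _ _ => trivial)
          fun x _ hx _ => (hx : x = y).trans hy').mono (by simp only [size]; omega) fun _ h => h
      · simp only [size]; omega
    · simp only [size]; ring_nf; omega
  refine cost.of_val.mono le_rfl fun x hx => ?_
  rw [val_tabC, PMF.mem_support_map_iff] at hx
  obtain ⟨v, hv, rfl⟩ := hx
  exact ⟨v, rfl, fun j => (h j j.2).of_mem_val (mem_support_sampleAll _ v hv j)⟩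

/-- The guess need not be below `n`: the last doubling starts from some `k < n`. The `+ 1` covers `n
= 0`, where the initial range is `1`. -/
theorem triple_pickC (n : ℕ) :
    Triple pickC [Data.unary n] (n * (40 * n + 80) + 10)
      (fun x => ∃ u ≤ 2 * n + 1, x = Data.unary u) := by
  refine (Triple.tl (Q := fun x => ∃ k u, k ≤ 2 * n + 1 ∧ u ≤ k ∧
      x = Data.cons (Data.unary k) (Data.unary u)) (Triple.fold n (40 * n + 79)
    (fun _ x => ∃ k u, k ≤ 2 * n + 1 ∧ u ≤ k ∧ x = Data.cons (Data.unary k) (Data.unary u))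
    ((Triple.expr (e := var 0) rfl _).mono le_rfl
      fun x hx => by rw [hx]; simp [exprVal])
    (Triple.expr (e := cons (cons nil nil) nil) rfl _)
    (fun x hx => ⟨1, 0, by omega, by omega, hx⟩) ?_ fun _ h => h) ?_).mono ?_ fun _ h => h
  · rintro t ht x acc ⟨k, u, hk, hu, rfl⟩
    have h1 := triple_dropC (Data.unary k) (Data.unary n)
    simp only [Data.toList_unary, List.length_replicate, Data.tl_iterate_unary] at h1
    refine (Triple.ifNil (M := 30 * n + 60) (Triple.call_expr rfl h1) (fun _ => ?_)
      (fun x hx hne => ?_)).mono ?_ fun _ h => h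
    · exact (Triple.expr (e := var 1) rfl _).mono (by simp only [size]; omega)
        fun x hx => ⟨k, u, hk, hu, hx⟩
    · have hkn : k < n := by
        by_contra hkn
        apply hne
        rw [hx, Data.unary_eq_nil]
        omega
      refine (Triple.cons (Triple.call_expr rfl (triple_addC k k))
        (Triple.ifNil (M := 4 * n + 20) (S := fun x => ∃ u ≤ k + k, x = Data.unary u)
          (Triple.flip _) (fun _ => ?_) (fun _ _ _ => ?_))
        (fun x y hx hy => ?_)).mono ?_ fun _ h => h
      · exact (Triple.expr (e := tl (var 1)) rfl _).mono (by simp only [size]; omega)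
          fun x hx => ⟨u, by omega, hx⟩
      · exact (Triple.call_expr rfl (triple_addC k u)).mono (by simp only [size]; omega)
          fun x hx => ⟨k + u, by omega, hx⟩
      · obtain ⟨v, hv, rfl⟩ := hy
        exact ⟨k + k, v, by omega, hv, by rw [hx]⟩
      · simp only [size]; omega
    · simp only [size]; omega
  · rintro x ⟨k, u, hk, hu, rfl⟩
    exact ⟨u, by omega, rfl⟩
  · simp only [size]; ring_nf; omega

/-! ### Step counts of the simulation and of the adversary -/

section

open Code

theorem Triple.letIn_sub {a b : Code} {env : List Data} {N K : ℕ} {Q S : Data → Prop}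
    (ha : Triple a env N Q) (hK : N + 1 ≤ K)
    (hb : ∀ x, Q x → Triple b (x :: env) (K - N - 1) S) : Triple (Code.letIn a b) env K S :=
  (ha.letIn hb).mono (by omega) fun _ h => h

/-- A bound for the steps in one activation of all parties outside the block. -/
def stepCost (L n C : ℕ) : ℕ := n * (n * (L + 8) + C + 80) + 20

/-- A bound for the steps in extracting the messages. -/
def sentCost (n : ℕ) : ℕ := n * (3 * n + 22) + 8

/-- The machine `M` is assumed fast only for parties outside the block. Parties in the block are
never activated, so nothing is needed about their memories. -/
theorem triple_stepC {M : Code} {L n j C : ℕ} {results recv : Data} {Q : Data → Prop}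
    (h : n ≤ L * j → Triple M [(results.get j).hd, recv.get j] C Q) :
    Triple (stepC M L) [Data.cons (Data.unary j) (Data.cons (Data.unary n)
      (Data.cons results recv))] (j * (L + 8) + C + 60) (fun x => n ≤ L * j → Q x) := by
  refine (Triple.ifNil (M := 6 * j + C + 40) (Triple.call_expr rfl (triple_liveC L j n))
    (fun hx => ?_) (fun x hx hne => ?_)).mono ?_ fun _ h => h
  · have hj : n ≤ L * j := by
      have := hx.symm
      rw [Data.unary_eq_nil] at this
      omega
    refine (Triple.call_expr rfl (triple_nthC j recv)).letIn_sub
      (by simp only [size]; omega) fun r hr => ?_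
    refine (Triple.hd (S := (· = (results.get j).hd))
      (Triple.call_expr rfl (triple_nthC j results)) fun y hy => by rw [hy]).letIn_sub
      (by simp only [size]; omega) fun m hm => ?_
    subst hr hm
    exact ((h hj).machine _).mono (by simp only [size]; omega) fun _ h _ => h
  · refine (Triple.nil _).mono (by omega) fun y _ hj => absurd ?_ hne
    rw [hx, Data.unary_eq_nil]
    omega
  · simp only [size]; ring_nf; omega

theorem triple_stepAllC {M : Code} {L n C : ℕ} {results recv : Data} {Q : ℕ → Data → Prop}
    (h : ∀ j < n, n ≤ L * j → Triple M [(results.get j).hd, recv.get j] C (Q j)) :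
    Triple (stepAllC M L) [Data.cons (Data.unary n) (Data.cons results recv)] (stepCost L n C)
      (fun x => ∀ j < n, n ≤ L * j → Q j (x.get j)) := by
  refine (Triple.call_expr rfl (triple_tabC (p := stepC M L) (B := n * (L + 8) + C + 60)
    fun j hj => (triple_stepC (h j hj)).mono ?_ fun _ h => h)).mono ?_ ?_
  · gcongr
  · simp only [size, stepCost]; ring_nf; omega
  · rintro x ⟨v, rfl, hv⟩ j hj hlj
    have := hv ⟨j, hj⟩ hlj
    rwa [← Data.get_ofVec v] at this

theorem triple_sentC (n : ℕ) (results : Data) :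
    Triple sentC [Data.cons (Data.unary n) results] (sentCost n) (fun _ => True) := by
  refine (triple_tabC (p := tl nthC) (B := 3 * n + 7) (Q := fun _ _ => True) fun j hj =>
    (Triple.tl (S := fun _ => True) (triple_nthC j results) fun _ _ => trivial).mono (by omega)
      fun _ h => h).mono ?_ fun _ _ => trivial
  simp only [sentCost]; ring_nf; omega

/-- A bound for the steps in one round of a simulation. -/
def roundCost (L n C D : ℕ) : ℕ := stepCost L n C + sentCost n + D + 60

theorem triple_roundC {M rel : Code} {L n C D : ℕ} {acc : Data} {Q : ℕ → Data → Prop}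
    {Q' : Data → Prop}
    (h : ∀ j < n, n ≤ L * j → Triple M [(acc.hd.get j).hd, acc.tl.hd.get j] C (Q j))
    (h' : ∀ d, Triple rel [acc.tl.tl, d] D fun x => Q' x.hd) :
    Triple (roundC M rel L) [Data.cons (Data.unary n) acc] (roundCost L n C D)
      (fun x => (∀ j < n, n ≤ L * j → Q j (x.hd.get j)) ∧ Q' x.tl.tl) := by
  unfold roundCost
  refine (Triple.call_expr rfl (triple_stepAllC h)).letIn_sub
    (by simp only [size]; omega) fun P hP => ?_
  refine (Triple.call_expr rfl (triple_sentC n P)).letIn_sub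
    (by simp only [size]; omega) fun sent _ => ?_
  refine (Triple.expr (e := tl (tl (tl (var 2)))) rfl _).letIn_sub
    (by simp only [size]; omega) fun ρ' hρ => ?_
  have hρ' : ρ' = acc.tl.tl := hρ
  subst hρ'
  refine ((h' sent).machine _).letIn_sub (by simp only [size]; omega) fun v hv => ?_
  refine (Triple.expr (e := cons (var 3) (cons (tl (var 0)) (hd (var 0)))) rfl _).mono
    (by simp only [size]; omega) fun x hx => ?_
  rw [hx]
  exact ⟨hP, hv⟩

/-- A bound for the steps in a simulation. -/
def runCost (L n R C D : ℕ) : ℕ := R * (roundCost L n C D + 20) + stepCost L n C + 60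

/-- Every activation of `M`, started with memory `s₀`, among the first `T` ones takes at most `C`
steps. -/
def StepBound (M : Code) (s₀ : Data) (T C : ℕ) : Prop :=
  ∀ r < T, ∀ s, Reaches M s₀ r s → ∀ d, Triple M [s, d] C fun x => Reaches M s₀ (r + 1) x.hd

/-- Machines are polynomially bounded only on reachable memories, so the loop invariant records
reachability for the relay and for each simulated party. The activation after the `R` rounds
explains `R < T`. -/
theorem triple_runC {M rel : Code} {L n R T C D : ℕ} {start : ℕ → Data} {results recv ρ : Data}
    (hM : ∀ j < n, StepBound M (start j) T C) (hT : R < T) (hrel : StepBound rel ρ R D)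
    (hstart : ∀ j < n, (results.get j).hd = start j) :
    Triple (runC M rel L) [Data.cons (Data.unary n) (Data.cons (Data.unary R)
      (Data.cons results (Data.cons recv ρ)))] (runCost L n R C D) (fun _ => True) := by
  unfold runCost
  refine (Triple.fold R (roundCost L n C D + 10)
    (fun t x => (∀ j < n, n ≤ L * j → Reaches M (start j) t (x.hd.get j).hd) ∧
      Reaches rel ρ t x.tl.tl)
    ((Triple.expr (e := hd (tl (var 0))) rfl _).mono le_rfl
      fun x hx => by rw [hx]; simp [exprVal])
    (Triple.expr (e := tl (tl (var 0))) rfl _) (fun x hx => ?_) (fun t ht x acc hacc => ?_)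
    fun x hx => hx).letIn_sub (by simp only [size]; ring_nf; omega) fun x hx => ?_
  · rw [hx]
    refine ⟨fun j hj _ => ?_, Reaches.start⟩
    have h : Reaches M (start j) 0 (results.get j).hd := by
      rw [hstart j hj]; exact Reaches.start
    exact h
  · refine (Triple.call_expr rfl (triple_roundC (acc := acc)
      (Q := fun j x => Reaches M (start j) (t + 1) x.hd) (Q' := fun x => Reaches rel ρ (t + 1) x)
      (C := C) (D := D)
      (fun j hj hlj => hM j hj t (by omega) _ (hacc.1 j hj hlj) _)
      (fun d => hrel t ht _ hacc.2 d))).mono ?_ fun _ h => h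
    simp only [size]; omega
  · refine (Triple.call_expr rfl (triple_stepAllC (results := x.hd) (recv := x.tl.hd)
      (Q := fun _ _ => True) (C := C)
      fun j hj hlj => (hM j hj R hT _ (hx.1 j hj hlj) _).mono le_rfl fun _ _ => trivial)).mono
      ?_ fun _ _ => trivial
    simp only [size]; ring_nf; omega

/-- The start memory of party `j`. -/
def startMemory (κ n R : ℕ) (crs : Data) (j : ℕ) : Data :=
  Data.ofList [Data.unary κ, Data.unary n, Data.unary R, crs, Data.unary j]

theorem triple_startAllC (κ n R : ℕ) (crs : Data) :
    Triple startAllC [Data.ofList [Data.unary κ, Data.unary n, Data.unary R, crs]]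
      (n * 70 + 20) (· = Data.ofVec fun j : Fin n =>
        Data.cons (startMemory κ n R crs j) Data.nil) := by
  refine Triple.of_pure (Q := fun _ => True) ?_ (val_startAllC κ n R crs)
  refine (Triple.call_expr rfl (triple_tabC (p := startC) (B := 50) (Q := fun _ _ => True)
    fun j _ => (Triple.expr (e := startC) rfl _).mono ?_ fun _ _ => trivial)).mono ?_
      fun _ _ => trivial
  · simp [startC, size]
  · simp only [size]; omega

theorem triple_bitC (b : Bool) (env : List Data) : Triple (bitC b) env 3 (fun _ => True) := by
  cases b
  · exact (Triple.nil env).mono (by omega) fun _ _ => trivial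
  · exact (Triple.expr (e := cons nil nil) rfl env).mono le_rfl fun _ _ => trivial

theorem triple_initC (b : Bool) (κ n R : ℕ) (crs : Data) :
    Triple (initC b) [Data.ofList [Data.unary κ, Data.unary n, Data.unary R, crs]]
      (n * 100 + 100) (fun x => ∃ recv, x = Data.cons
        (Data.ofVec fun j : Fin n => Data.cons (startMemory κ n R crs j) Data.nil)
        (Data.cons recv (Data.ofList [Data.unary κ, Data.unary n]))) := by
  refine (Triple.cons (Triple.call_expr rfl (triple_startAllC κ n R crs))
    (Triple.cons (Triple.call_expr rfl
        (triple_tabC (B := 3) (Q := fun _ _ => True) (n := n) fun j _ => triple_bitC b _))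
      (Triple.expr (e := cons (hd (var 0)) (cons (hd (tl (var 0))) nil)) rfl _)
      (S := fun y => ∃ recv, y = Data.cons recv (Data.ofList [Data.unary κ, Data.unary n]))
      fun x y _ hy => ⟨x, by rw [hy]; rfl⟩)
    fun x y hx hy => ?_).mono ?_ fun _ h => h
  · obtain ⟨recv, rfl⟩ := hy
    exact ⟨recv, by rw [hx]⟩
  · simp only [size]; omega

theorem triple_messageC (i j : ℕ) (results : Data) :
    Triple messageC [Data.cons (Data.unary j) (Data.cons (Data.unary i) results)]
      (3 * i + 3 * j + 40) (fun _ => True) := by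
  refine (Triple.call (Triple.cons (Triple.expr (e := hd (tl (var 0))) rfl _)
    (Triple.tl (Triple.call_expr rfl (triple_nthC j results)) (S := fun _ => True)
      fun _ _ => trivial) (S := fun x => ∃ d, x = Data.cons (Data.unary i) d)
      fun x y hx _ => ⟨y, by rw [hx]; rfl⟩) (M := 3 * i + 6) ?_).mono ?_ fun _ h => h
  · rintro x ⟨d, rfl⟩
    exact (triple_nthC i d).mono le_rfl fun _ _ => trivial
  · simp only [size]; omega

theorem triple_corruptC (L : ℕ) (sim : Bool) (n i j : ℕ) (msgs : Data) :
    Triple (corruptC L sim) [Data.cons (Data.unary j) (Data.cons (Data.unary n)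
      (Data.cons (Data.unary i) msgs))] (j * (L + 10) + 3 * i + 100) (fun _ => True) := by
  refine (Triple.ifNil (M := 3 * i + 3 * j + 60) (Triple.call_expr rfl (triple_liveC L j n))
    (fun _ => ?_) (fun _ _ _ => ?_)).mono ?_ fun _ h => h
  · cases sim
    · exact (Triple.nil _).mono (by omega) fun _ _ => trivial
    · exact (Triple.call_expr rfl (triple_nthC j msgs)).mono (by simp only [size]; omega)
        fun _ _ => trivial
  · exact (Triple.call_expr rfl (triple_eqC j i)).mono (by simp only [size]; omega)
        fun _ _ => trivial
  · simp only [size]; ring_nf; omega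

theorem triple_rowC (b : Bool) (n i j : ℕ) (msgs results : Data) :
    Triple (rowC b) [Data.cons (Data.unary j) (Data.cons (Data.unary n) (Data.cons (Data.unary i)
      (Data.cons msgs results)))] (n * 17 + 6 * j + 3 * i + 150) (fun _ => True) := by
  refine (Triple.call_expr rfl (triple_nthC j msgs)).letIn_sub
    (by simp only [size]; omega) fun m _ => ?_
  refine (Triple.call_expr rfl (triple_messageC i j results)).letIn_sub
    (by simp only [size]; omega) fun m' _ => ?_
  refine (Triple.call (Triple.cons (N := 3) (M := 4) (R := fun _ => True)
    (Triple.expr (e := hd (tl (var 2))) rfl _) ?_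
    (S := fun x => ∃ d, x = Data.cons (Data.unary n) d) fun x y hx _ => ⟨y, by rw [hx]; rfl⟩)
    (M := n * 17 + 8) ?_).mono ?_ fun _ h => h
  · cases b
    all_goals
      refine (Triple.ifNil (M := 1) (Triple.expr rfl _) (fun _ => ?_) fun _ _ _ => ?_).mono
        (by simp only [size]; omega) fun _ h => h
      · exact (Triple.expr rfl _).mono le_rfl fun _ _ => trivial
      · exact (Triple.expr rfl _).mono le_rfl fun _ _ => trivial
  · rintro x ⟨d, rfl⟩
    exact (triple_tabC (B := 2) (Q := fun _ _ => True) fun j _ =>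
      (Triple.expr (e := tl (var 0)) rfl _).mono le_rfl fun _ _ => trivial).mono le_rfl
      fun _ _ => trivial
  · simp only [size]; omega

/-- A bound for the steps in the first activation of the adversary. -/
def corruptionCost (L n R C D : ℕ) : ℕ :=
  n * (40 * n + 80) + runCost L n R C D + n * (9 * n + 80) + n * (n * (L + 16) + 120) +
    n * 200 + 1000

theorem triple_corruptionC {M rel : Code} {L κ n R T C D : ℕ} {crs : Data} (b sim : Bool)
    (hM : ∀ j < n, StepBound M (startMemory κ n R crs j) T C) (hT : R < T)
    (hrel : StepBound rel (Data.ofList [Data.unary κ, Data.unary n]) R D) :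
    Triple (corruptionC M rel L b sim)
      [Data.ofList [Data.unary κ, Data.unary n, Data.unary R, crs]] (corruptionCost L n R C D)
      (fun x => ∃ i ≤ 2 * n + 1, ∃ msgs, x.hd = attackMemory n R i msgs
        (Data.ofVec fun j : Fin n => Data.cons (startMemory κ n R crs j) Data.nil)) := by
  unfold corruptionCost
  refine (Triple.call_expr rfl (triple_pickC n)).letIn_sub
    (by simp only [size]; omega) ?_
  rintro _ ⟨i, hi, rfl⟩
  have harg : Triple (cons (hd (tl (var 1))) (cons (hd (tl (tl (var 1))))
      (call (initC b) (var 1))))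
      [Data.unary i, Data.ofList [Data.unary κ, Data.unary n, Data.unary R, crs]]
      (n * 100 + 115) (fun x => ∃ recv, x = Data.cons (Data.unary n) (Data.cons (Data.unary R)
        (Data.cons (Data.ofVec fun j : Fin n => Data.cons (startMemory κ n R crs j) Data.nil)
          (Data.cons recv (Data.ofList [Data.unary κ, Data.unary n]))))) := by
    refine (Triple.cons (Triple.expr (e := hd (tl (var 1))) rfl _)
      (Triple.cons (Triple.expr (e := hd (tl (tl (var 1)))) rfl _)
        (Triple.call_expr (e := var 1) rfl (triple_initC b κ n R crs))
        (S := fun x => ∃ recv, x = Data.cons (Data.unary R) (Data.cons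
          (Data.ofVec fun j : Fin n => Data.cons (startMemory κ n R crs j) Data.nil)
          (Data.cons recv (Data.ofList [Data.unary κ, Data.unary n]))))
        fun x y hx hy => ?_) fun x y hx hy => ?_).mono (by simp only [size]; omega) fun _ h => h
    · obtain ⟨recv, rfl⟩ := hy
      exact ⟨recv, by rw [hx]; rfl⟩
    · obtain ⟨recv, rfl⟩ := hy
      exact ⟨recv, by rw [hx]; rfl⟩
  refine (harg.call (p := runC M rel L) (M := runCost L n R C D) (S := fun _ => True)
    ?_).letIn_sub (by simp only [size]; omega) fun P _ => ?_
  · rintro _ ⟨recv, rfl⟩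
    refine triple_runC hM hT hrel fun j hj => ?_
    have := Data.get_ofVec (fun j : Fin n => Data.cons (startMemory κ n R crs j) Data.nil) ⟨j, hj⟩
    simp only at this
    rw [this, Data.hd_cons]
  refine (Triple.call_expr rfl (triple_tabC (p := messageC) (B := 9 * n + 50)
    (Q := fun _ _ => True) fun j hj => (triple_messageC i j P).mono (by omega)
      fun _ h => h)).letIn_sub (by simp only [size]; ring_nf; omega) fun msgs _ => ?_
  refine (Triple.expr (e := cons (hd (tl (var 3))) (cons (var 2) (var 0))) rfl _).letIn_sub
    (by simp only [size]; ring_nf; omega) fun K hK => ?_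
  have hK' : K = Data.cons (Data.unary n) (Data.cons (Data.unary i) msgs) := hK
  subst hK'
  refine (Triple.cons (N := n * 70 + 100) (M := n * (n * (L + 16) + 120) + 100)
    (Q := fun x => x = attackMemory n R i msgs
        (Data.ofVec fun j : Fin n => Data.cons (startMemory κ n R crs j) Data.nil))
    (R := fun _ => True) ?_ ?_ ?_).mono (by simp only [size]; ring_nf; omega) fun _ h => h
  · refine (Triple.cons (Triple.cons (Triple.expr (e := hd (tl (tl (var 4)))) rfl _)
      (Triple.cons (Triple.expr (e := var 0) rfl _)
        (Triple.call_expr rfl (triple_startAllC κ n R crs))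
        (S := fun x => x = Data.cons (Data.cons (Data.unary n) (Data.cons (Data.unary i) msgs))
          (Data.ofVec fun j : Fin n => Data.cons (startMemory κ n R crs j) Data.nil))
        fun x y hx hy => by rw [hx, hy]; rfl)
      (S := fun x => x = Data.cons (Data.unary R)
        (Data.cons (Data.cons (Data.unary n) (Data.cons (Data.unary i) msgs))
          (Data.ofVec fun j : Fin n => Data.cons (startMemory κ n R crs j) Data.nil)))
      fun x y hx hy => by rw [hx, hy]; rfl) (Triple.nil _)
      fun x y hx hy => by rw [hx, hy]; rfl).mono (by simp only [size]; omega) fun _ h => h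
  · refine (Triple.call_expr rfl (triple_tabC (p := corruptC L sim)
      (B := n * (L + 16) + 105) (Q := fun _ _ => True) fun j hj =>
        (triple_corruptC L sim n i j msgs).mono ?_ fun _ h => h)).mono
        (by simp only [size]; ring_nf; omega) fun _ _ => trivial
    have : j * (L + 10) ≤ n * (L + 10) := Nat.mul_le_mul_right _ hj.le
    rw [show n * (L + 16) = n * (L + 10) + 6 * n by ring]
    omega
  · exact fun x y hx _ => ⟨i, hi, msgs, hx⟩

/-- A bound for the steps in a later activation of the adversary. -/
def actionCost (L n C : ℕ) : ℕ := stepCost L n C + n * (29 * n + 200) + 500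

theorem triple_roundActionC {M : Code} {L n r i C : ℕ} {msgs results recv : Data}
    {Q : ℕ → Data → Prop}
    (h : ∀ j < n, n ≤ L * j → Triple M [(results.get j).hd, recv.get j] C (Q j)) :
    Triple (roundActionC M L) [Data.cons (attackMemory n (r + 1) i msgs results) recv]
      (actionCost L n C)
      (fun x => ∃ P, x.hd = attackMemory n r i msgs P ∧
        ∀ j < n, n ≤ L * j → Q j (P.get j)) := by
  unfold actionCost
  refine (Triple.call_expr rfl (triple_stepAllC h)).letIn_sub
    (by simp only [size]; omega) fun P hP => ?_
  refine (Triple.cons (Triple.expr (e := cons (cons (tl (hd (hd (hd (var 1)))))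
      (cons (hd (tl (hd (hd (var 1))))) (var 0))) nil) rfl _)
    (Triple.call_expr rfl (triple_sentC n P)) fun x y hx _ =>
      ⟨P, by rw [hx]; rfl, hP⟩).mono ?_ fun _ h => h
  simp only [size, sentCost]; ring_nf; omega

theorem triple_lastActionC {M : Code} {L n i C : ℕ} (b : Bool) {msgs results recv : Data}
    (hi : i ≤ 2 * n + 1)
    (h : ∀ j < n, n ≤ L * j → Triple M [(results.get j).hd, recv.hd.get j] C fun _ => True) :
    Triple (lastActionC M L b) [Data.cons (attackMemory n 0 i msgs results) recv]
      (actionCost L n C) (fun _ => True) := by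
  unfold actionCost
  refine (Triple.call_expr rfl (triple_stepAllC (Q := fun _ _ => True) h)).letIn_sub
    (by simp only [size]; omega) fun P hP => ?_
  refine (Triple.cons (R := fun _ => True) (Triple.expr (e := nil) rfl _)
    (Triple.call_expr rfl (triple_tabC (p := rowC b) (B := 29 * n + 160)
      (Q := fun _ _ => True) fun j hj => (triple_rowC b n i j msgs P).mono (by omega)
        fun _ h => h)|>.mono le_rfl fun _ _ => trivial)
    fun _ _ _ _ => trivial).mono ?_ fun _ h => h
  simp only [size]; ring_nf; omega

/-- A bound for the steps in one activation of the adversary. -/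
def attackCost (L n R C D : ℕ) : ℕ := corruptionCost L n R C D + actionCost L n C + 40

/-- What is invariant about the memory of the adversary, after `r` activations. -/
def AttackInvariant (M : Code) (L κ n R : ℕ) (crs : Data) : ℕ → Data → Prop
  | 0, s => s = Data.ofList [Data.unary κ, Data.unary n, Data.unary R, crs]
  | t + 1, s => t ≤ R → ∃ i ≤ 2 * n + 1, ∃ msgs results,
      s = attackMemory n (R - t) i msgs results ∧
      ∀ j < n, n ≤ L * j → Reaches M (startMemory κ n R crs j) t (results.get j).hd

/-- Cost and invariant must be proved together: the running time of an activation is controlled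
because the stored memories of the parties are reachable, and the activation preserves this. -/
theorem triple_attack {M rel : Code} {L κ n R C D : ℕ} {crs : Data} (b sim : Bool)
    (hM : ∀ j < n, StepBound M (startMemory κ n R crs j) (R + 2) C)
    (hrel : StepBound rel (Data.ofList [Data.unary κ, Data.unary n]) R D)
    {r : ℕ} (hr : r < R + 2) {s : Data} (hs : AttackInvariant M L κ n R crs r s) (d : Data) :
    Triple (attack M rel L b sim) [s, d] (attackCost L n R C D)
      (fun x => AttackInvariant M L κ n R crs (r + 1) x.hd) := by
  unfold attackCost
  cases r with
  | zero =>
    have hs' : s = Data.ofList [Data.unary κ, Data.unary n, Data.unary R, crs] := hs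
    subst hs'
    refine (Triple.ifNil (M := corruptionCost L n R C D + actionCost L n C + 20)
      (Triple.expr (e := tl (var 0)) rfl _) (fun h => ?_) (fun _ _ _ => ?_)).mono
      (by simp only [size]; omega) fun _ h => h
    · cases h
    · refine (Triple.call_expr rfl (triple_corruptionC b sim hM (by omega) hrel)).mono
        (by simp only [size]; omega) ?_
      rintro x ⟨i, hi, msgs, hx⟩ -
      refine ⟨i, hi, msgs, _, hx, fun j hj _ => ?_⟩
      have := Data.get_ofVec (fun j : Fin n => Data.cons (startMemory κ n R crs j) Data.nil)
        ⟨j, hj⟩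
      simp only at this
      rw [this, Data.hd_cons]
      exact Reaches.start
  | succ t =>
    obtain ⟨i, hi, msgs, results, rfl, hres⟩ := hs (by omega)
    refine (Triple.ifNil (M := corruptionCost L n R C D + actionCost L n C + 20)
      (Triple.expr (e := tl (var 0)) rfl _) (fun _ => ?_) (fun x hx hne => ?_)).mono
      (by simp only [size]; omega) fun _ h => h
    · rcases Nat.lt_or_ge t R with htR | htR
      · obtain ⟨u, hu⟩ : ∃ u, R - t = u + 1 := ⟨R - t - 1, by omega⟩
        rw [hu]
        refine (Triple.ifNil (M := actionCost L n C + 10)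
          (Triple.expr (e := hd (hd (var 0))) rfl _) (fun h => ?_) (fun _ _ _ => ?_)).mono
          (by simp only [size]; omega) fun _ h => h
        · cases h
        · refine (Triple.call_expr rfl (triple_roundActionC (M := M) (L := L) (C := C)
            (msgs := msgs) (results := results) (recv := d)
            (Q := fun j x => Reaches M (startMemory κ n R crs j) (t + 1) x.hd)
            fun j hj hlj => hM j hj t (by omega) _ (hres j hj hlj) _)).mono
            (by simp only [size]; omega) ?_
          rintro x ⟨P, hx, hP⟩ -
          exact ⟨i, hi, msgs, P, by rw [hx]; congr 1; omega, hP⟩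
      · rw [show R - t = 0 by omega]
        refine (Triple.ifNil (M := actionCost L n C + 10)
          (Triple.expr (e := hd (hd (var 0))) rfl _) (fun _ => ?_) (fun x hx hne => ?_)).mono
          (by simp only [size]; omega) fun _ h => h
        · refine (Triple.call_expr rfl (triple_lastActionC (M := M) (L := L) (C := C) b
            (msgs := msgs) (results := results) (recv := d) hi
            fun j hj hlj => (hM j hj t (by omega) _ (hres j hj hlj) _).mono le_rfl
              fun _ _ => trivial)).mono (by simp only [size]; omega) ?_
          -- The memory is discarded in the point-to-point round; the invariant after that
          -- activation is vacuous.
          exact fun _ _ h => absurd h (by omega)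
        · exact absurd hx hne
    · exact absurd hx hne

theorem attackInvariant_of_reaches {M rel : Code} {L κ n R C D : ℕ} {crs : Data} {b sim : Bool}
    (hM : ∀ j < n, StepBound M (startMemory κ n R crs j) (R + 2) C)
    (hrel : StepBound rel (Data.ofList [Data.unary κ, Data.unary n]) R D)
    {r : ℕ} (hr : r < R + 2) {s : Data}
    (hs : Reaches (attack M rel L b sim)
      (Data.ofList [Data.unary κ, Data.unary n, Data.unary R, crs]) r s) :
    AttackInvariant M L κ n R crs r s := by
  induction hs with
  | start => rfl
  | step d u _ hu ih =>
    exact (triple_attack b sim hM hrel (by omega) (ih (by omega)) d u hu).1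

/-! ### Polynomial bounds -/

/-- Functions with a polynomial upper bound. -/
def PolyBounded (f : ℕ → ℕ) : Prop := ∃ p : Polynomial ℕ, ∀ κ, f κ ≤ p.eval κ

namespace PolyBounded

theorem const (c : ℕ) : PolyBounded fun _ => c := ⟨Polynomial.C c, by simp⟩

theorem add {f g : ℕ → ℕ} (hf : PolyBounded f) (hg : PolyBounded g) :
    PolyBounded fun κ => f κ + g κ := by
  obtain ⟨p, hp⟩ := hf
  obtain ⟨q, hq⟩ := hg
  exact ⟨p + q, fun κ => by rw [Polynomial.eval_add]; exact add_le_add (hp κ) (hq κ)⟩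

theorem mul {f g : ℕ → ℕ} (hf : PolyBounded f) (hg : PolyBounded g) :
    PolyBounded fun κ => f κ * g κ := by
  obtain ⟨p, hp⟩ := hf
  obtain ⟨q, hq⟩ := hg
  exact ⟨p * q, fun κ => by rw [Polynomial.eval_mul]; exact Nat.mul_le_mul (hp κ) (hq κ)⟩

end PolyBounded

theorem polyBounded_attackCost (L : ℕ) {n R C D : ℕ → ℕ} (hn : PolyBounded n)
    (hR : PolyBounded R) (hC : PolyBounded C) (hD : PolyBounded D) :
    PolyBounded fun κ => attackCost L (n κ) (R κ) (C κ) (D κ) := by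
  unfold attackCost corruptionCost actionCost runCost roundCost stepCost sentCost
  repeat' first
    | exact PolyBounded.const _ | exact hn | exact hR | exact hC | exact hD
    | apply PolyBounded.add | apply PolyBounded.mul

theorem StepBound.of_polyTime {M : Code} {s₀ : Data} {T C : ℕ}
    (h : ∀ r < T, ∀ s, Reaches M s₀ r s → ∀ d, ∀ u ∈ (M.run [s, d]).support, u.2 ≤ C) :
    StepBound M s₀ T C :=
  fun r hr s hs d u hu => ⟨hs.step d u hu, h r hr s hs d u hu⟩

/-- The adversary runs in probabilistic polynomial time. -/
theorem pptAdversary_attack {H : HybridModel} {π : Protocol}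
    (hparties : ∃ p : Polynomial ℕ, ∀ κ, H.parties κ ≤ p.eval κ)
    (hrounds : ∃ p : Polynomial ℕ, ∀ κ, π.rounds κ ≤ p.eval κ)
    (hrelay : RelayPPT H π) (hπ : π.PPT H) (L : ℕ) (b sim : Bool) :
    PPTAdversary H π (attack π.code H.relay L b sim) := by
  obtain ⟨pC, hC⟩ := hπ
  obtain ⟨pD, hD⟩ := hrelay
  obtain ⟨p, hp⟩ := polyBounded_attackCost L (n := H.parties) (R := π.rounds)
    (C := fun κ => pC.eval κ) (D := fun κ => pD.eval κ) hparties hrounds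
    ⟨pC, fun _ => le_rfl⟩ ⟨pD, fun _ => le_rfl⟩
  refine ⟨p, ?_⟩
  rintro κ _ ⟨crs, hcrs, rfl⟩ r hr s hs d u hu
  have hM : ∀ j < H.parties κ, StepBound π.code
      (startMemory κ (H.parties κ) (π.rounds κ) crs j) (π.rounds κ + 2) (pC.eval κ) :=
    fun j hj => StepBound.of_polyTime (hC κ _ ⟨crs, hcrs, j, hj, rfl⟩)
  have hrel : StepBound H.relay (Data.ofList [Data.unary κ, Data.unary (H.parties κ)])
      (π.rounds κ) (pD.eval κ) :=
    StepBound.of_polyTime (hD κ _ rfl)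
  exact (triple_attack b sim hM hrel hr (attackInvariant_of_reaches hM hrel hr hs) d u hu).2.trans
    (hp κ)

end

/-! ### Trimmed outcomes and double counting of messages -/

theorem Outcome.correct_trim {n : ℕ} (o : Outcome n) (x : Fin n → Bool) :
    o.trim.Correct x ↔ o.Correct x := by
  have h : ∀ i ∉ o.corrupted, o.trim.output i = o.output i := fun i hi => by simp [trim, hi]
  constructor
  · intro c
    refine ⟨fun i hi => ?_, fun i hi j hj => ?_, fun b hb i hi => ?_⟩
    · rw [← h i hi]; exact c.termination i hi
    · rw [← h i hi, ← h j hj]; exact c.agreement i hi j hj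
    · rw [← h i hi]; exact c.validity b hb i hi
  · intro c
    refine ⟨fun i hi => ?_, fun i hi j hj => ?_, fun b hb i hi => ?_⟩
    · rw [h i hi]; exact c.termination i hi
    · rw [h i hi, h j hj]; exact c.agreement i hi j hj
    · rw [h i hi]; exact c.validity b hb i hi

theorem Outcome.messagesSent_trim {n : ℕ} (o : Outcome n) {i : Fin n} (hi : i ∉ o.corrupted) :
    o.trim.messagesSent i = o.messagesSent i := by
  simp [messagesSent, trim, hi]

/-- The recipients, other than party `j`, of the messages in a result of party `j`. -/
def recipients {n : ℕ} (j : Fin n) (d : Data) : Finset (Fin n) :=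
  Finset.univ.filter fun k => k ≠ j ∧ d.tl.get k ≠ Data.nil

/-- The parties outside the block that send a message to party `i`. -/
def senders {n : ℕ} (L : ℕ) (i : Fin n) (P : Fin n → Data) : Finset (Fin n) :=
  Finset.univ.filter fun j => j ∉ block L n ∧ (P j).tl.get i ≠ Data.nil

theorem card_corruptSet_le {n L : ℕ} (sim : Bool) (i : Fin n) (P : Fin n → Data) :
    (corruptSet L sim i P).card ≤ (block L n).card + (senders L i P).card := by
  refine (Finset.card_le_card fun j hj => ?_).trans (Finset.card_union_le _ _)
  by_cases hb : j ∈ block L n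
  · exact Finset.mem_union_left _ hb
  · rw [mem_corruptSet_of_notMem_block hb] at hj
    exact Finset.mem_union_right _ (by simp [senders, hb, hj.2])

theorem corruptSet_false_subset {n L : ℕ} (i : Fin n) (P : Fin n → Data) :
    corruptSet L false i P ⊆ block L n := by
  intro j hj
  by_contra hb
  rw [mem_corruptSet_of_notMem_block hb] at hj
  simp at hj

/-- If all parties outside the block send few messages, then few parties in the block get many
messages. -/
theorem card_le_of_forall_recipients {n L m σ K : ℕ} (hK : n * m < (K + 1) * (σ + 1))
    {P : Fin n → Data} (hP : ∀ j ∉ block L n, (recipients j (P j)).card < m)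
    {t : Finset (Fin n)} (ht : t ⊆ block L n) (h : ∀ i ∈ t, σ < (senders L i P).card) :
    t.card ≤ K := by
  have h1 : t.card * (σ + 1) ≤ ∑ i ∈ t, (senders L i P).card := by
    rw [← smul_eq_mul]
    exact Finset.card_nsmul_le_sum _ _ _ fun i hi => h i hi
  have h2 : ∑ i ∈ t, (senders L i P).card ≤
      ∑ j ∈ (block L n)ᶜ, (recipients j (P j)).card := by
    simp only [Finset.card_eq_sum_ones, senders, recipients, Finset.sum_filter]
    rw [Finset.sum_comm]
    -- After exchanging the sums, parties of the block contribute nothing as senders. The recipients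
    -- counted lie in the block, so they differ from the senders outside it.
    rw [← Finset.sum_subset (Finset.subset_univ (block L n)ᶜ)]
    · refine Finset.sum_le_sum fun j hj => ?_
      rw [Finset.mem_compl] at hj
      refine (Finset.sum_le_sum fun i hi => ?_).trans
        (Finset.sum_le_sum_of_subset (Finset.subset_univ t))
      have : i ≠ j := fun e => hj (e ▸ ht hi)
      simp [this, hj]
    · intro j _ hj
      rw [Finset.mem_compl, not_not] at hj
      simp [hj]
  have h3 : ∑ j ∈ (block L n)ᶜ, (recipients j (P j)).card ≤ n * m := by
    refine (Finset.sum_le_card_nsmul _ _ m fun j hj => ?_).trans ?_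
    · exact (hP j (Finset.mem_compl.1 hj)).le
    · rw [smul_eq_mul]
      gcongr
      exact (Finset.card_le_univ _).trans_eq (Fintype.card_fin n)
  by_contra hlt
  have : (K + 1) * (σ + 1) ≤ t.card * (σ + 1) := Nat.mul_le_mul_right _ (by omega)
  omega

/-! ### The output of the isolated party -/

/-- The distribution of the output of the isolated party `i`, from its own result and the results
of the other parties in the executions with input `false` and `true`. -/
def isolatedOutput (M : Code) {n : ℕ} (i : Fin n) (P₀ P₁ : Fin n → Data) (l : Data) :
    PMF (Option Bool) :=
  (M.val [l.hd, Data.ofVec fun j : Fin n => if j = i then l.tl.get i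
    else precedence ((P₀ j).tl.get i) ((P₁ j).tl.get i)]).map fun d => d.tl.toBool?

theorem precedence_nil_right (m : Data) : precedence m Data.nil = m := by
  unfold precedence; split_ifs with h <;> simp [h]

theorem precedence_nil_left (m : Data) : precedence Data.nil m = m := by
  simp [precedence]

/-- A corrupted sender applies the precedence rule explicitly. An honest one outside the block has
an empty simulated message, so its own message is what the rule gives. The right-hand side does not
mention which run was simulated, which makes experiments (1) and (2) indistinguishable for `i`. -/
theorem finalOutput_isolated (M : Code) {n L : ℕ} {i : Fin n} (hi : i ∈ block L n) (b : Bool)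
    {P' P P₀ P₁ : Fin n → Data}
    (hb : ∀ j, precedence ((P₀ j).tl.get i) ((P₁ j).tl.get i) =
      combine b ((P' j).tl.get i) ((P j).tl.get i)) (l : Data) :
    finalOutput M b (corruptSet L true i P') i (fun j => (P' j).tl.get i) P l i =
      isolatedOutput M i P₀ P₁ l := by
  have hiI : i ∉ corruptSet L true i P' := by rw [mem_corruptSet_of_mem_block hi]; simp
  rw [finalOutput, if_neg hiI, isolatedOutput, allResults, if_pos rfl]
  have : delivered b (corruptSet L true i P') i (fun j => (P' j).tl.get i) P l i =
      Data.ofVec fun j : Fin n => if j = i then l.tl.get i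
        else precedence ((P₀ j).tl.get i) ((P₁ j).tl.get i) := by
    unfold delivered
    congr 1; funext j
    by_cases hj : j = i
    · subst hj; simp [hiI, allResults]
    · by_cases hjI : j ∈ corruptSet L true i P'
      · simp [hj, hjI, hb]
      · have hjb : j ∉ block L n := fun h => hjI ((mem_corruptSet_of_mem_block h).2 hj)
        rw [mem_corruptSet_of_notMem_block hjb] at hjI
        have hnil : (P' j).tl.get i = Data.nil := by simpa using hjI
        rw [if_neg, if_neg hj, hb, hnil, allResults, if_neg hj]
        · unfold combine
          split_ifs
          · rw [precedence_nil_right]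
          · rw [precedence_nil_left]
        · rw [mem_corruptSet_of_notMem_block hjb]; simpa using hjI
  rw [this]

/-- The output of a party depends on the isolated party only through its message. -/
theorem finalOutput_congr (M : Code) {n : ℕ} {i k : Fin n} (hk : k ≠ i) (b : Bool)
    (I : Finset (Fin n)) (msgs P : Fin n → Data) {l l' : Data}
    (h : l.tl.get k = l'.tl.get k) :
    finalOutput M b I i msgs P l k = finalOutput M b I i msgs P l' k := by
  unfold finalOutput delivered allResults
  simp only [hk, if_false]
  congr! 6
  funext j
  split_ifs <;> first | rfl | exact h

theorem Pr_finish_output (M : Code) {n : ℕ} (b : Bool) (I : Finset (Fin n)) (i : Fin n)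
    (msgs P : Fin n → Data) (l : Data) (k : Fin n) (E : Set (Option Bool)) :
    Pr (finish M b I i msgs P l) {o | o.output k ∈ E} = Pr (finalOutput M b I i msgs P l k) E := by
  rw [finish, Pr_map, ← sampleAll_eval (finalOutput M b I i msgs P l) k, Pr_map]
  rfl

theorem Pr_finish_le (M : Code) {n : ℕ} (b : Bool) (I : Finset (Fin n)) (i : Fin n)
    (msgs P : Fin n → Data) (l : Data) {E F : Set (Outcome n)}
    (h : ∀ o ∈ E, o.corrupted = I → o ∈ F) :
    Pr (finish M b I i msgs P l) E ≤ Pr (finish M b I i msgs P l) F := by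
  rw [finish, Pr_map, Pr_map]
  exact Pr_mono _ fun out hout => h _ hout rfl

/-- In any situation in which the attacks apply, one of them succeeds with noticeable
probability. -/
theorem one_le_failures (M : Code) {n L m : ℕ} {B : ℝ} {i : Fin n} (hi : i ∈ block L n)
    {P₀ P₁ : Fin n → Data} {l₀ l₁ : Data}
    (h₀ : ((corruptSet L true i P₀).card : ℝ) ≤ B) (h₁ : ((corruptSet L true i P₁).card : ℝ) ≤ B)
    (hl₀ : (recipients i l₀).card < m) (hl₁ : (recipients i l₁).card < m)
    (hn : (corruptSet L true i P₀).card + 2 * m + 1 ≤ n) :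
    1 ≤ Pr (finish M true (corruptSet L true i P₁) i (fun j => (P₁ j).tl.get i) P₀ l₀)
          {o | (o.corrupted.card : ℝ) ≤ B ∧ ¬ o.Correct fun _ => false} +
        Pr (finish M false (corruptSet L true i P₀) i (fun j => (P₀ j).tl.get i) P₁ l₀)
          {o | (o.corrupted.card : ℝ) ≤ B ∧ ¬ o.Correct fun j => decide (j ≠ i)} +
        Pr (finish M false (corruptSet L true i P₀) i (fun j => (P₀ j).tl.get i) P₁ l₁)
          {o | (o.corrupted.card : ℝ) ≤ B ∧ ¬ o.Correct fun _ => true} := by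
  have hiI : ∀ P : Fin n → Data, i ∉ corruptSet L true i P := fun P => by
    rw [mem_corruptSet_of_mem_block hi]; simp
  -- Too few parties are corrupted or addressed by `i` to cover everybody; `k` is honest and hears
  -- nothing from `i` with either input.
  obtain ⟨k, hk⟩ : ∃ k, k ∉ corruptSet L true i P₀ ∪
      (recipients i l₀ ∪ (recipients i l₁ ∪ {i})) := by
    by_contra! hall
    have h1 : n ≤ (corruptSet L true i P₀ ∪
        (recipients i l₀ ∪ (recipients i l₁ ∪ {i}))).card := by
      rw [Finset.eq_univ_iff_forall.2 hall, Finset.card_univ, Fintype.card_fin]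
    have h2 := Finset.card_union_le (corruptSet L true i P₀)
      (recipients i l₀ ∪ (recipients i l₁ ∪ {i}))
    have h3 := Finset.card_union_le (recipients i l₀) (recipients i l₁ ∪ {i})
    have h4 := Finset.card_union_le (recipients i l₁) {i}
    rw [Finset.card_singleton] at h4
    omega
  simp only [Finset.mem_union, Finset.mem_singleton, not_or] at hk
  obtain ⟨hkI, hk₀, hk₁, hki⟩ := hk
  have hm₀ : l₀.tl.get k = Data.nil := by simpa [recipients, hki] using hk₀
  have hm₁ : l₁.tl.get k = Data.nil := by simpa [recipients, hki] using hk₁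
  set μ := finish M false (corruptSet L true i P₀) i (fun j => (P₀ j).tl.get i) P₁ l₀ with hμ
  -- In the mixed experiment the outputs cannot at once be `false` for `i`, `true` for `k`, and
  -- equal.
  have cover : 1 ≤ Pr μ {o | o.output i ∈ {y : Option Bool | y ≠ some false}} +
      Pr μ {o | o.output i ≠ o.output k} +
      Pr μ {o | o.output k ∈ {y : Option Bool | y ≠ some true}} := by
    rw [← Pr_univ μ]
    refine le_trans (Pr_mono _ fun o _ => ?_) ((Pr_union_le _ _ _).trans
      (add_le_add_left (Pr_union_le _ _ _) _))
    simp only [Set.mem_union, Set.mem_ofPred_eq]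
    by_contra! h
    rw [h.1.1] at h
    simpa [h.2] using h.1.2
  refine cover.trans (add_le_add (add_le_add ?_ ?_) ?_)
  -- The output of `i` has the same law when the roles of simulated and actual run are exchanged;
  -- there validity for the input `false` applies.
  · rw [hμ, Pr_finish_output, finalOutput_isolated M hi false (P₀ := P₀) (P₁ := P₁)
      (fun j => rfl), ← finalOutput_isolated M hi true (P' := P₁) (fun j => rfl),
      ← Pr_finish_output]
    refine Pr_finish_le _ _ _ _ _ _ _ fun o ho hI => ⟨by rw [hI]; exact h₁, fun hc => ho ?_⟩
    exact hc.validity false (fun _ _ => rfl) i (hI ▸ hiI P₁)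
  · refine Pr_finish_le _ _ _ _ _ _ _ fun o ho hI => ⟨by rw [hI]; exact h₀, fun hc => ho ?_⟩
    exact hc.agreement i (hI ▸ hiI P₀) k (hI ▸ hkI)
  -- Party `k` gets no message from `i` in either case, so `l₀` may be replaced by `l₁`, and
  -- validity for the input `true` applies.
  · rw [hμ, Pr_finish_output, finalOutput_congr M hki _ _ _ _ (hm₀.trans hm₁.symm),
      ← Pr_finish_output]
    refine Pr_finish_le _ _ _ _ _ _ _ fun o ho hI => ⟨by rw [hI]; exact h₀, fun hc => ho ?_⟩
    exact hc.validity true (fun _ _ => rfl) k (hI ▸ hkI)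

/-! ### Joint distribution of the executions -/

/-- The results outside the block in an execution in which all inputs are `b`. -/
def blockRun (H : HybridModel) (π : Protocol) (L κ : ℕ) (crs : Data) (b : Bool) :
    PMF (Fin (H.parties κ) → Data) :=
  liveRun π.code H.relay L (π.rounds κ) (fun j : Fin (H.parties κ) => partyStart H π κ crs j)
    (fun _ => Data.ofBool b) (relayStart H κ)

/-- The result of the isolated party `i` with input `b`. -/
def isolatedRun (H : HybridModel) (π : Protocol) (κ : ℕ) (crs : Data) (i : Fin (H.parties κ))
    (b : Bool) : PMF Data :=
  loneRun π.code (π.rounds κ) (partyStart H π κ crs i) (Data.ofBool b)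

/-- Only the inputs of `i` and of the parties outside the block enter, so the mixed input vector
leads to the same run outside the block as the constant one. -/
theorem ideal_eq (H : HybridModel) (π : Protocol) (L : ℕ) (b sim : Bool) (κ : ℕ)
    {i : Fin (H.parties κ)} (hi : i ∈ block L (H.parties κ)) {x : Fin (H.parties κ) → Bool}
    {c : Bool} (hx : ∀ j ≠ i, x j = c) :
    ideal H π L b sim κ i x = (H.crs κ).bind fun crs =>
      (blockRun H π L κ crs b).bind fun P' => (blockRun H π L κ crs c).bind fun P =>
      (isolatedRun H π κ crs i (x i)).bind fun l =>
        finish π.code b (corruptSet L sim i P') i (fun j => (P' j).tl.get i) P l := by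
  unfold ideal blockRun isolatedRun
  congr 1; funext crs
  congr 1; funext P'
  congr 1
  refine liveRun_congr _ _ _ _ (fun _ _ => rfl) (fun j hj => ?_) _
  rw [hx j fun h => hj (h ▸ hi)]

/-- Independent executions with input `false` and with input `true`, with the same reference
string. -/
def jointRun (H : HybridModel) (π : Protocol) (L κ : ℕ) (i : Fin (H.parties κ)) :
    PMF (((Fin (H.parties κ) → Data) × (Fin (H.parties κ) → Data)) × (Data × Data)) :=
  (H.crs κ).bind fun crs => (blockRun H π L κ crs false).bind fun P₀ =>
    (blockRun H π L κ crs true).bind fun P₁ => (isolatedRun H π κ crs i false).bind fun l₀ =>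
      (isolatedRun H π κ crs i true).bind fun l₁ => PMF.pure ((P₀, P₁), (l₀, l₁))

theorem one_le_of_forall_notMem {α β : Type} (μ : PMF α) (bad : Set α) (F₁ F₂ F₃ : α → PMF β)
    (E₁ E₂ E₃ : Set β)
    (h : ∀ a ∉ bad, 1 ≤ Pr (F₁ a) E₁ + Pr (F₂ a) E₂ + Pr (F₃ a) E₃) :
    1 ≤ Pr μ bad + (Pr (μ.bind F₁) E₁ + Pr (μ.bind F₂) E₂ + Pr (μ.bind F₃) E₃) := by
  have hbad : Pr μ bad = ∑' a, μ a * (if a ∈ bad then 1 else 0) := by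
    rw [Pr, PMF.toOuterMeasure_apply]
    refine tsum_congr fun a => ?_
    by_cases ha : a ∈ bad <;> simp [ha]
  rw [hbad, Pr_bind, Pr_bind, Pr_bind, ← ENNReal.tsum_add, ← ENNReal.tsum_add,
    ← ENNReal.tsum_add, ← μ.tsum_coe]
  refine ENNReal.tsum_le_tsum fun a => ?_
  rw [← mul_add, ← mul_add, ← mul_add]
  conv_lhs => rw [← mul_one (μ a)]
  gcongr
  by_cases hb : a ∈ bad
  · simp [hb]
  · simpa [hb] using h a hb

theorem Pr_eq_one {α : Type} (μ : PMF α) (E : Set α) (h : ∀ a ∈ μ.support, a ∈ E) :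
    Pr μ E = 1 :=
  (PMF.toOuterMeasure_apply_eq_one_iff μ E).2 h

theorem Pr_pure_le {α β : Type} (a : α) (E : Set α) (μ : PMF β) (F : Set β)
    (h : a ∈ E → ∀ b ∈ μ.support, b ∈ F) : Pr (PMF.pure a) E ≤ Pr μ F := by
  rw [Pr_pure]
  split_ifs with ha
  · rw [Pr_eq_one μ F (h ha)]
  · exact zero_le

/-! ### Averaging over the block and the final contradiction -/

section Bounds

variable {H : HybridModel} {π : Protocol} {L κ m : ℕ} {B : ℝ} {i : Fin (H.parties κ)}

theorem mem_of_mem_finish (hB : ((block L (H.parties κ)).card : ℝ) ≤ B) {b : Bool}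
    {P P' : Fin (H.parties κ) → Data} {l : Data} {j : Fin (H.parties κ)}
    (hj : j ∉ corruptSet L false i P') (hm : m ≤ (recipients j (allResults i P l j)).card)
    (msgs : Fin (H.parties κ) → Data) (o : Outcome (H.parties κ))
    (ho : o ∈ (finish π.code b (corruptSet L false i P') i msgs P l).support) :
    o ∈ {o : Outcome (H.parties κ) |
      (o.corrupted.card : ℝ) ≤ B ∧ j ∉ o.corrupted ∧ m ≤ o.messagesSent j} := by
  rw [finish, PMF.mem_support_map_iff] at ho
  obtain ⟨out, _, rfl⟩ := ho
  refine ⟨le_trans ?_ hB, hj, hm.trans (le_of_eq ?_)⟩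
  · exact_mod_cast Finset.card_le_card (corruptSet_false_subset i P')
  · simp [recipients, Outcome.messagesSent, hj]

/-- With `sim = false` only the block without `i` is corrupted, so `j` is honest and its messages
count in the outcome. This transfers the assumed scarcity of messages to the runs used by the
attack. -/
theorem Pr_blockRun_le (hi : i ∈ block L (H.parties κ))
    (hB : ((block L (H.parties κ)).card : ℝ) ≤ B) (b : Bool) {j : Fin (H.parties κ)}
    (hj : j ∉ block L (H.parties κ)) :
    Pr ((H.crs κ).bind fun crs => blockRun H π L κ crs b) {P | m ≤ (recipients j (P j)).card} ≤
      Pr (ideal H π L false false κ i fun _ => b) {o | (o.corrupted.card : ℝ) ≤ B ∧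
        j ∉ o.corrupted ∧ m ≤ o.messagesSent j} := by
  have h : ((H.crs κ).bind fun crs => blockRun H π L κ crs b) = (H.crs κ).bind fun crs =>
      (blockRun H π L κ crs false).bind fun _ => (blockRun H π L κ crs b).bind fun P =>
        (isolatedRun H π κ crs i b).bind fun _ => PMF.pure P := by
    simp only [PMF.bind_const, PMF.bind_pure]
  rw [h, ideal_eq H π L false false κ hi (c := b) fun _ _ => rfl]
  refine Pr_bind_le_Pr_bind _ _ _ _ _ fun crs _ => ?_
  refine Pr_bind_le_Pr_bind _ _ _ _ _ fun P' _ => ?_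
  refine Pr_bind_le_Pr_bind _ _ _ _ _ fun P _ => ?_
  refine Pr_bind_le_Pr_bind _ _ _ _ _ fun l _ => ?_
  refine Pr_pure_le _ _ _ _ fun hP => mem_of_mem_finish hB
    (fun h => hj (corruptSet_false_subset i P' h)) ?_ _
  rw [allResults, if_neg fun e : j = i => hj (e ▸ hi)]
  exact hP

theorem Pr_isolatedRun_le (hi : i ∈ block L (H.parties κ))
    (hB : ((block L (H.parties κ)).card : ℝ) ≤ B) (b : Bool) :
    Pr ((H.crs κ).bind fun crs => isolatedRun H π κ crs i b) {l | m ≤ (recipients i l).card} ≤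
      Pr (ideal H π L false false κ i fun _ => b) {o | (o.corrupted.card : ℝ) ≤ B ∧
        i ∉ o.corrupted ∧ m ≤ o.messagesSent i} := by
  have h : ((H.crs κ).bind fun crs => isolatedRun H π κ crs i b) = (H.crs κ).bind fun crs =>
      (blockRun H π L κ crs false).bind fun _ => (blockRun H π L κ crs b).bind fun _ =>
        (isolatedRun H π κ crs i b).bind fun l => PMF.pure l := by
    simp only [PMF.bind_const, PMF.bind_pure]
  rw [h, ideal_eq H π L false false κ hi (c := b) fun _ _ => rfl]
  refine Pr_bind_le_Pr_bind _ _ _ _ _ fun crs _ => ?_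
  refine Pr_bind_le_Pr_bind _ _ _ _ _ fun P' _ => ?_
  refine Pr_bind_le_Pr_bind _ _ _ _ _ fun P _ => ?_
  refine Pr_bind_le_Pr_bind _ _ _ _ _ fun l _ => ?_
  refine Pr_pure_le _ _ _ _ fun hl => mem_of_mem_finish hB
    (by rw [mem_corruptSet_of_mem_block hi]; simp) ?_ _
  rw [allResults, if_pos rfl]
  exact hl

/-- Some party in the block is likely to get few messages, with both inputs. -/
theorem exists_few_senders {σ K : ℕ} {ζ : ENNReal} (hpos : 0 < (block L (H.parties κ)).card)
    (hK : H.parties κ * m < (K + 1) * (σ + 1)) (hK' : 8 * K ≤ (block L (H.parties κ)).card)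
    (hζ : H.parties κ * ζ ≤ 1 / 24)
    (h : ∀ b, ∀ j ∉ block L (H.parties κ), Pr ((H.crs κ).bind fun crs => blockRun H π L κ crs b)
      {P | m ≤ (recipients j (P j)).card} ≤ ζ) :
    ∃ i ∈ block L (H.parties κ),
      Pr ((H.crs κ).bind fun crs => blockRun H π L κ crs false) {P | σ < (senders L i P).card} +
      Pr ((H.crs κ).bind fun crs => blockRun H π L κ crs true) {P | σ < (senders L i P).card} ≤
        1 / 3 := by
  have hbad : ∀ b, Pr ((H.crs κ).bind fun crs => blockRun H π L κ crs b)
      {P | ∃ j, P ∈ {P : Fin (H.parties κ) → Data |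
        j ∉ block L (H.parties κ) ∧ m ≤ (recipients j (P j)).card}} ≤ 1 / 24 := by
    intro b
    refine (Pr_exists_le _ _).trans (le_trans ?_ hζ)
    refine (Finset.sum_le_card_nsmul _ _ ζ fun j _ => ?_).trans_eq (by simp)
    by_cases hj : j ∈ block L (H.parties κ)
    · rw [Pr_eq_zero _ _ fun P _ hP => hP.1 hj]
      exact zero_le
    · exact (Pr_mono _ fun P hP => hP.2).trans (h b j hj)
  have hKs : (K : ENNReal) ≤ (block L (H.parties κ)).card * (1 / 8) := by
    rw [mul_one_div, ENNReal.le_div_iff_mul_le (by simp) (by simp)]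
    exact_mod_cast (by omega : K * 8 ≤ (block L (H.parties κ)).card)
  -- At most `K`, an eighth of the block, have many senders unless some party sends too much, which
  -- has probability at most `1 / 24`; and `1 / 8 + 1 / 24 = 1 / 6`.
  have hsum : ∀ b, ∑ i ∈ block L (H.parties κ),
      Pr ((H.crs κ).bind fun crs => blockRun H π L κ crs b) {P | σ < (senders L i P).card} ≤
        (block L (H.parties κ)).card * (1 / 6) := by
    intro b
    refine (Pr_sum_count_le _ _ _ {P | ∃ j, P ∈ {P : Fin (H.parties κ) → Data |
        j ∉ block L (H.parties κ) ∧ m ≤ (recipients j (P j)).card}} K ?_).trans ?_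
    · intro P hP t ht hti
      refine card_le_of_forall_recipients hK (fun j hj => ?_) ht hti
      by_contra hlt
      exact hP ⟨j, hj, not_lt.1 hlt⟩
    · refine (add_le_add hKs (mul_le_mul_right (hbad b) _)).trans_eq ?_
      rw [← mul_add]
      congr 1
      rw [← ENNReal.toReal_eq_toReal_iff' (by finiteness) (by finiteness),
        ENNReal.toReal_add (by finiteness) (by finiteness)]
      norm_num
  -- The minimum is at most the average, which is at most `1 / 6` for each of the two inputs. One
  -- `i` thus serves both runs.
  obtain ⟨i, hi, hmin⟩ := Finset.exists_min_image (block L (H.parties κ)) (fun i =>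
    Pr ((H.crs κ).bind fun crs => blockRun H π L κ crs false) {P | σ < (senders L i P).card} +
      Pr ((H.crs κ).bind fun crs => blockRun H π L κ crs true) {P | σ < (senders L i P).card})
    (Finset.card_pos.1 hpos)
  refine ⟨i, hi, ?_⟩
  have hle := Finset.card_nsmul_le_sum _ _ _ hmin
  rw [Finset.sum_add_distrib, nsmul_eq_mul] at hle
  replace hle := hle.trans (add_le_add (hsum false) (hsum true))
  rw [← mul_add, mul_comm, mul_comm _ (1 / 6 + 1 / 6 : ENNReal),
    ENNReal.mul_le_mul_iff_left (by exact_mod_cast hpos.ne') (by finiteness)] at hle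
  refine hle.trans_eq ?_
  rw [← ENNReal.toReal_eq_toReal_iff' (by finiteness) (by finiteness),
    ENNReal.toReal_add (by finiteness) (by finiteness)]
  norm_num

/-- Small probabilities `ζ` that a party sends at least `m` messages and that the protocol fails
contradict each other. -/
theorem false_of_bounds {σ K : ℕ} {ζ : ENNReal} (hpos : 0 < (block L (H.parties κ)).card)
    (hcard : ((block L (H.parties κ)).card + σ : ℝ) ≤ B)
    (hn : (block L (H.parties κ)).card + σ + 2 * m + 1 ≤ H.parties κ)
    (hK : H.parties κ * m < (K + 1) * (σ + 1)) (hK' : 8 * K ≤ (block L (H.parties κ)).card)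
    (hζ : H.parties κ * ζ ≤ 1 / 24)
    (hsent : ∀ b, ∀ i ∈ block L (H.parties κ), ∀ j, Pr (ideal H π L false false κ i fun _ => b)
      {o | (o.corrupted.card : ℝ) ≤ B ∧ j ∉ o.corrupted ∧ m ≤ o.messagesSent j} ≤ ζ)
    (hattack : ∀ b, ∀ i ∈ block L (H.parties κ), ∀ x, Pr (ideal H π L b true κ i x)
      {o | (o.corrupted.card : ℝ) ≤ B ∧ ¬ o.Correct x} ≤ ζ) : False := by
  have hB : ((block L (H.parties κ)).card : ℝ) ≤ B := le_trans (by simp) hcard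
  obtain ⟨i₀, hi₀⟩ := Finset.card_pos.1 hpos
  obtain ⟨i, hi, hfew⟩ := exists_few_senders hpos hK hK' hζ fun b j hj =>
    (Pr_blockRun_le hi₀ hB b hj).trans (hsent b i₀ hi₀ j)
  have hζ' : ζ ≤ 1 / 24 := by
    refine le_trans ?_ hζ
    conv_lhs => rw [← one_mul ζ]
    gcongr
    exact_mod_cast (by omega : 1 ≤ H.parties κ)
  have hl : ∀ b, Pr ((H.crs κ).bind fun crs => isolatedRun H π κ crs i b)
      {l | m ≤ (recipients i l).card} ≤ 1 / 24 := fun b =>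
    (Pr_isolatedRun_le hi hB b).trans ((hsent b i hi i).trans hζ')
  have hJP₀ : (jointRun H π L κ i).map (fun τ => τ.1.1) =
      (H.crs κ).bind fun crs => blockRun H π L κ crs false := by
    simp only [jointRun, PMF.map_bind, PMF.pure_map, PMF.bind_const, PMF.bind_pure]
  have hJP₁ : (jointRun H π L κ i).map (fun τ => τ.1.2) =
      (H.crs κ).bind fun crs => blockRun H π L κ crs true := by
    simp only [jointRun, PMF.map_bind, PMF.pure_map, PMF.bind_const, PMF.bind_pure]
  have hJl₀ : (jointRun H π L κ i).map (fun τ => τ.2.1) =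
      (H.crs κ).bind fun crs => isolatedRun H π κ crs i false := by
    simp only [jointRun, PMF.map_bind, PMF.pure_map, PMF.bind_const, PMF.bind_pure]
  have hJl₁ : (jointRun H π L κ i).map (fun τ => τ.2.2) =
      (H.crs κ).bind fun crs => isolatedRun H π κ crs i true := by
    simp only [jointRun, PMF.map_bind, PMF.pure_map, PMF.bind_const, PMF.bind_pure]
  -- Each experiment is a marginal of the joint run. Only the reference string is shared, so here
  -- the two runs can be drawn in the opposite order.
  have hF₁ : ((jointRun H π L κ i).bind fun τ => finish π.code true (corruptSet L true i τ.1.2) i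
      (fun j => (τ.1.2 j).tl.get i) τ.1.1 τ.2.1) =
      ideal H π L true true κ i fun _ => false := by
    rw [ideal_eq H π L true true κ hi (c := false) fun _ _ => rfl]
    simp only [jointRun, PMF.bind_bind, PMF.pure_bind, PMF.bind_const]
    congr 1; funext crs
    rw [PMF.bind_comm]
  have hF₂ : ((jointRun H π L κ i).bind fun τ => finish π.code false (corruptSet L true i τ.1.1) i
      (fun j => (τ.1.1 j).tl.get i) τ.1.2 τ.2.1) =
      ideal H π L false true κ i fun j => decide (j ≠ i) := by
    rw [ideal_eq H π L false true κ hi (c := true) fun j hj => by simp [hj]]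
    simp only [jointRun, PMF.bind_bind, PMF.pure_bind, PMF.bind_const, ne_eq, not_true,
      decide_false]
  have hF₃ : ((jointRun H π L κ i).bind fun τ => finish π.code false (corruptSet L true i τ.1.1) i
      (fun j => (τ.1.1 j).tl.get i) τ.1.2 τ.2.2) =
      ideal H π L false true κ i fun _ => true := by
    rw [ideal_eq H π L false true κ hi (c := true) fun _ _ => rfl]
    simp only [jointRun, PMF.bind_bind, PMF.pure_bind, PMF.bind_const]
  have main := one_le_of_forall_notMem (jointRun H π L κ i)
    (((fun τ => τ.1.1) ⁻¹' {P | σ < (senders L i P).card} ∪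
      (fun τ => τ.1.2) ⁻¹' {P | σ < (senders L i P).card}) ∪
      ((fun τ => τ.2.1) ⁻¹' {l | m ≤ (recipients i l).card} ∪
      (fun τ => τ.2.2) ⁻¹' {l | m ≤ (recipients i l).card}))
    (fun τ => finish π.code true (corruptSet L true i τ.1.2) i (fun j => (τ.1.2 j).tl.get i)
      τ.1.1 τ.2.1)
    (fun τ => finish π.code false (corruptSet L true i τ.1.1) i (fun j => (τ.1.1 j).tl.get i)
      τ.1.2 τ.2.1)
    (fun τ => finish π.code false (corruptSet L true i τ.1.1) i (fun j => (τ.1.1 j).tl.get i)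
      τ.1.2 τ.2.2)
    {o | (o.corrupted.card : ℝ) ≤ B ∧ ¬ o.Correct fun _ => false}
    {o | (o.corrupted.card : ℝ) ≤ B ∧ ¬ o.Correct fun j => decide (j ≠ i)}
    {o | (o.corrupted.card : ℝ) ≤ B ∧ ¬ o.Correct fun _ => true}
    (fun τ hτ => by
      simp only [Set.mem_union, Set.mem_preimage, Set.mem_ofPred_eq, not_or, not_lt, not_le] at hτ
      have h₀ := card_corruptSet_le (L := L) true i τ.1.1
      have h₁ := card_corruptSet_le (L := L) true i τ.1.2
      refine one_le_failures π.code (B := B) hi (le_trans ?_ hcard) (le_trans ?_ hcard)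
        hτ.2.1 hτ.2.2 (by omega)
      · exact_mod_cast h₀.trans (by omega)
      · exact_mod_cast h₁.trans (by omega))
  rw [hF₁, hF₂, hF₃] at main
  have hbad := (Pr_union_le (jointRun H π L κ i)
    ((fun τ => τ.1.1) ⁻¹' {P | σ < (senders L i P).card} ∪
      (fun τ => τ.1.2) ⁻¹' {P | σ < (senders L i P).card})
    ((fun τ => τ.2.1) ⁻¹' {l | m ≤ (recipients i l).card} ∪
      (fun τ => τ.2.2) ⁻¹' {l | m ≤ (recipients i l).card})).trans
    (add_le_add (Pr_union_le _ _ _) (Pr_union_le _ _ _))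
  rw [← Pr_map, ← Pr_map, ← Pr_map, ← Pr_map, hJP₀, hJP₁, hJl₀, hJl₁] at hbad
  have htotal := main.trans (add_le_add (hbad.trans (add_le_add hfew (add_le_add (hl _) (hl _))))
    (add_le_add (add_le_add ((hattack _ i hi _).trans hζ') ((hattack _ i hi _).trans hζ'))
      ((hattack _ i hi _).trans hζ')))
  -- The total is `1 / 3` for many senders to `i`, `2 / 24` for many messages from `i` and `3 / 24`
  -- for failures of the protocol, that is `13 / 24 < 1`.
  rw [← ENNReal.toReal_le_toReal (by finiteness) (by finiteness)] at htotal
  repeat rw [ENNReal.toReal_add (by finiteness) (by finiteness)] at htotal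
  norm_num at htotal

end Bounds

/-! ### Choice of the parameters -/

theorem card_block_bounds {L : ℕ} (hL : 0 < L) (n : ℕ) :
    n ≤ L * (block L n).card ∧ L * (block L n).card < n + L := by
  obtain ⟨t, h₁, h₂⟩ : ∃ t, n ≤ L * t ∧ L * t < n + L := by
    refine ⟨(n + L - 1) / L, ?_, ?_⟩
    · have h := Nat.div_add_mod (n + L - 1) L
      have h' := Nat.mod_lt (n + L - 1) hL
      omega
    · have h := Nat.div_add_mod (n + L - 1) L
      omega
  have htn : t ≤ n := by
    by_contra! h
    have := Nat.mul_le_mul_left L h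
    rw [Nat.mul_succ] at this
    nlinarith
  have hblock : block L n = Finset.univ.filter fun j : Fin n => (j : ℕ) < t := by
    ext j
    simp only [mem_block, Finset.mem_filter, Finset.mem_univ, true_and]
    refine ⟨fun hj => lt_of_mul_lt_mul_left (hj.trans_le h₁) (Nat.zero_le L), fun hj => ?_⟩
    have := Nat.mul_le_mul_left L (Nat.succ_le_of_lt hj)
    rw [Nat.mul_succ] at this
    omega
  rw [hblock, Fin.card_filter_val_lt, min_eq_right htn]
  exact ⟨h₁, h₂⟩

/-- The number of messages in the lower bound, for `n` parties. -/
def messageBound (β : ℝ) (L n : ℕ) : ℕ := ⌈β * n / (64 * L)⌉₊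

theorem messageBound_isTheta {β : ℝ} (hβ : 0 < β) {L : ℕ} (hL : 0 < L) :
    (fun n : ℕ => (messageBound β L n : ℝ)) =Θ[atTop] fun n : ℕ => (n : ℝ) := by
  have hL' : (0 : ℝ) < L := by exact_mod_cast hL
  constructor
  · refine IsBigO.of_bound (β / (64 * L) + 1) ?_
    filter_upwards [eventually_ge_atTop 1] with n hn
    have hn' : (1 : ℝ) ≤ n := by exact_mod_cast hn
    rw [Real.norm_of_nonneg (Nat.cast_nonneg _), Real.norm_of_nonneg (Nat.cast_nonneg _)]
    have := Nat.ceil_lt_add_one (a := β * n / (64 * L)) (by positivity)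
    calc (messageBound β L n : ℝ) ≤ β * n / (64 * L) + 1 := this.le
      _ ≤ β * n / (64 * L) + n := by gcongr
      _ = (β / (64 * L) + 1) * n := by ring
  · refine IsBigO.of_bound (64 * L / β) (Eventually.of_forall fun n => ?_)
    rw [Real.norm_of_nonneg (Nat.cast_nonneg _), Real.norm_of_nonneg (Nat.cast_nonneg _)]
    calc (n : ℝ) = 64 * L / β * (β * n / (64 * L)) := by field_simp
      _ ≤ _ := by gcongr; exact Nat.le_ceil _

/-- The block and the threshold `⌊β * n / 4⌋₊` for senders each take about a quarter of the
corruption budget. The constant `64` in `messageBound` leaves an eighth of the block as the allowed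
exceptions. -/
theorem parameters_admissible {β : ℝ} (hβ₀ : 0 < β) (hβ₁ : β < 1) {L n : ℕ} (hL : 4 / β ≤ L)
    (hn : 64 * L ≤ β * n) :
    0 < (block L n).card ∧
    ((block L n).card + ⌊β * n / 4⌋₊ : ℝ) ≤ β * n ∧
    (block L n).card + ⌊β * n / 4⌋₊ + 2 * messageBound β L n + 1 ≤ n ∧
    n * messageBound β L n < ((block L n).card / 8 + 1) * (⌊β * n / 4⌋₊ + 1) := by
  have hL4 : (4 : ℝ) ≤ L := by
    refine le_trans ?_ hL
    rw [le_div_iff₀ hβ₀]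
    linarith
  have hL0 : 0 < L := by
    have : (0 : ℝ) < L := by linarith
    exact_mod_cast this
  rw [div_le_iff₀ hβ₀] at hL
  obtain ⟨h₁, h₂⟩ := card_block_bounds hL0 n
  set s := (block L n).card
  have h₁' : (n : ℝ) ≤ L * s := by exact_mod_cast h₁
  have h₂' : (L : ℝ) * s < n + L := by exact_mod_cast h₂
  have hn0 : (0 : ℝ) < n := by
    by_contra! h
    nlinarith
  have hs : (s : ℝ) ≤ β * n / 4 + 1 := by
    have : (L : ℝ) * s ≤ L * (β * n / 4 + 1) := by nlinarith
    exact le_of_mul_le_mul_left this (by linarith)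
  have hσ : (⌊β * n / 4⌋₊ : ℝ) ≤ β * n / 4 := Nat.floor_le (by positivity)
  have hσ' : β * n / 4 < ⌊β * n / 4⌋₊ + 1 := Nat.lt_floor_add_one _
  have hx : β * n / (64 * L) ≤ β * n / 256 := by
    gcongr
    linarith
  have hm : (messageBound β L n : ℝ) < β * n / (64 * L) + 1 :=
    Nat.ceil_lt_add_one (by positivity)
  have hβn : β * n ≤ n := by nlinarith
  have hs8 : (s : ℝ) / 8 < (s / 8 : ℕ) + 1 := by
    rw [div_lt_iff₀ (by norm_num)]
    exact_mod_cast (by omega : s < (s / 8 + 1) * 8)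
  refine ⟨?_, by linarith, ?_, ?_⟩
  · by_contra! h
    have h0 : s = 0 := by omega
    rw [h0] at h₁'
    simp only [Nat.cast_zero, mul_zero] at h₁'
    linarith
  · rw [← Nat.cast_le (α := ℝ)]
    push_cast
    linarith
  · rw [← Nat.cast_lt (α := ℝ)]
    push_cast
    have hL0' : (0 : ℝ) < L := by linarith
    -- Rounding up at most doubles the bound, because `β * n / (64 * L) ≥ 1`; the block has at least
    -- `n / L` members.
    calc (n : ℝ) * messageBound β L n
        ≤ n * (β * n / (64 * L) + β * n / (64 * L)) := by
          gcongr
          refine hm.le.trans ?_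
          gcongr
          rwa [le_div_iff₀ (by positivity), one_mul]
      _ = n / L / 8 * (β * n / 4) := by ring
      _ ≤ s / 8 * (β * n / 4) := by
          gcongr
          rwa [div_le_iff₀ hL0', mul_comm]
      _ < _ := by gcongr

/-! ### Polynomial bounds and negligible probabilities -/

theorem exists_eval_le_pow (p : Polynomial ℕ) : ∃ k : ℕ, ∀ᶠ κ : ℕ in atTop, p.eval κ ≤ κ ^ k := by
  induction p using Polynomial.induction_on' with
  | add p q hp hq =>
    obtain ⟨k, hk⟩ := hp
    obtain ⟨l, hl⟩ := hq
    refine ⟨max k l + 1, ?_⟩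
    filter_upwards [hk, hl, eventually_ge_atTop 2] with κ h₁ h₂ h₃
    rw [Polynomial.eval_add]
    calc p.eval κ + q.eval κ ≤ κ ^ max k l + κ ^ max k l :=
          add_le_add (h₁.trans (Nat.pow_le_pow_right (by omega) (le_max_left _ _)))
            (h₂.trans (Nat.pow_le_pow_right (by omega) (le_max_right _ _)))
      _ = κ ^ max k l * 2 := by ring
      _ ≤ κ ^ max k l * κ := by gcongr
      _ = _ := (pow_succ _ _).symm
  | monomial d a =>
    refine ⟨d + 1, ?_⟩
    filter_upwards [eventually_ge_atTop a] with κ h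
    rw [Polynomial.eval_monomial, pow_succ, mul_comm]
    gcongr

/-- Resilience concerns one sequence of inputs at a time. Applying it to the worst inputs for each
`κ` gives a bound uniform in `x`. -/
theorem IsResilientBA.eventually_le {H : HybridModel} {π : Protocol} {β : ℝ}
    (h : IsResilientBA H π β) {A : Code} (hA : PPTAdversary H π A) (k : ℕ) :
    ∀ᶠ κ : ℕ in atTop, ∀ x, (Pr (execution H π A κ x)
      {o | (o.corrupted.card : ℝ) ≤ β * H.parties κ ∧ ¬ o.Correct x}).toReal ≤
        1 / (κ : ℝ) ^ k := by
  choose x hx using fun κ => Finite.exists_max fun x : Fin (H.parties κ) → Bool =>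
    (Pr (execution H π A κ x)
      {o | (o.corrupted.card : ℝ) ≤ β * H.parties κ ∧ ¬ o.Correct x}).toReal
  filter_upwards [(h A hA x k).eventually (gt_mem_nhds zero_lt_one), eventually_gt_atTop 0]
    with κ hκ hpos y
  refine (hx κ y).trans ?_
  have hpow : (0 : ℝ) < (κ : ℝ) ^ k := by positivity
  rw [le_div_iff₀ hpow, mul_comm]
  exact hκ.le

/-! ### Transfer from the ideal experiment -/

/-- Here `48 * n ^ 2 * q` is the loss `2 * n * q` of guess and isolation times the target `24 * n`,
which permits a union bound over all parties. -/
theorem Pr_ideal_le {H : HybridModel} {π : Protocol} {L : ℕ} {b sim : Bool} {κ : ℕ}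
    {i : Fin (H.parties κ)} (hi : i ∈ block L (H.parties κ)) {x : Fin (H.parties κ) → Bool}
    {B : ℝ} {q : ℕ} (hq₀ : 0 < q)
    (hq : ∀ I : Finset (Fin (H.parties κ)), (I.card : ℝ) ≤ B → i ∉ I →
      1 ≤ (q : ENNReal) * H.isolated κ I {i})
    {E : Set (Outcome (H.parties κ))} (hE : ∀ o ∈ E, (o.corrupted.card : ℝ) ≤ B)
    (h : (Pr (execution H π (attack π.code H.relay L b sim) κ x) (Outcome.trim ⁻¹' E)).toReal ≤
      1 / (48 * H.parties κ ^ 2 * q : ℕ)) :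
    Pr (ideal H π L b sim κ i x) E ≤ 1 / (24 * H.parties κ : ℕ) := by
  have hn : 0 < H.parties κ := i.pos
  have key := ideal_le_execution H π L b sim κ i hi x B q hq E hE
  rw [Pr_map] at key
  have hnR : (0 : ℝ) < H.parties κ := by exact_mod_cast hn
  have hqR : (0 : ℝ) < q := by exact_mod_cast hq₀
  replace key := (ENNReal.toReal_mono (Pr_ne_top _ _) key).trans h
  rw [ENNReal.toReal_mul, ENNReal.toReal_mul, ENNReal.toReal_div, ENNReal.toReal_div,
    ENNReal.toReal_mul] at key
  push_cast at key
  simp only [ENNReal.toReal_one, ENNReal.toReal_natCast, ENNReal.toReal_ofNat] at key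
  rw [← ENNReal.toReal_le_toReal (Pr_ne_top _ _) (ENNReal.div_ne_top ENNReal.one_ne_top
    (by exact_mod_cast (by omega : 24 * H.parties κ ≠ 0))), ENNReal.toReal_div,
    ENNReal.toReal_one, ENNReal.toReal_natCast]
  push_cast
  set y := (Pr (ideal H π L b sim κ i x) E).toReal
  calc y = (2 * H.parties κ * q) * (1 / (2 * H.parties κ) * (1 / q * y)) := by field_simp
    _ ≤ (2 * H.parties κ * q) * (1 / (48 * H.parties κ ^ 2 * q)) := by gcongr
    _ = _ := by field_simp; norm_num

end BALowerBound

end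

theorem theorem4p5 (H : HybridModel) (π : Protocol) (β : ℝ) (hβ₀ : 0 < β) (hβ₁ : β < 1)
    (hparties : Tendsto H.parties atTop atTop)
    (hpartiesPoly : ∃ p : Polynomial ℕ, ∀ κ, H.parties κ ≤ p.eval κ)
    (hisolated : H.IsolatesSingleParties β)
    (hrelay : RelayPPT H π)
    (hroundsPoly : ∃ p : Polynomial ℕ, ∀ κ, π.rounds κ ≤ p.eval κ)
    (hπ : π.PPT H)
    (hBA : IsResilientBA H π β) :
    ∃ m : ℕ → ℕ,
      (fun κ => (m κ : ℝ)) =Θ[atTop] (fun κ => (H.parties κ : ℝ)) ∧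
      ∃ A : Code, PPTAdversary H π A ∧ ∃ k : ℕ, ∀ᶠ κ : ℕ in atTop,
        ∃ (x : Fin (H.parties κ) → Bool) (i : Fin (H.parties κ)),
          1 / (κ : ℝ) ^ k ≤
            ((execution H π A κ x).toOuterMeasure
              {o | (o.corrupted.card : ℝ) ≤ β * H.parties κ ∧ i ∉ o.corrupted ∧
                m κ ≤ o.messagesSent i}).toReal := by
  have hPPT := pptAdversary_attack hpartiesPoly hroundsPoly hrelay hπ
  obtain ⟨p, hp⟩ := hpartiesPoly
  obtain ⟨q, hq⟩ := hisolated
  obtain ⟨k, hk⟩ := exists_eval_le_pow (48 * p ^ 2 * q)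
  set L := ⌈4 / β⌉₊ with hLdef
  have hL : 4 / β ≤ L := Nat.le_ceil _
  have hL0 : 0 < L := Nat.ceil_pos.2 (by positivity)
  refine ⟨fun κ => messageBound β L (H.parties κ),
    ⟨(messageBound_isTheta hβ₀ hL0).1.comp_tendsto hparties,
      (messageBound_isTheta hβ₀ hL0).2.comp_tendsto hparties⟩,
    attack π.code H.relay L false false, hPPT L false false, k, ?_⟩
  have hlarge : ∀ᶠ κ in atTop, 64 * L ≤ β * H.parties κ :=
    ((tendsto_natCast_atTop_atTop.comp hparties).const_mul_atTop hβ₀).eventually_ge_atTop _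
  filter_upwards [hq, hk, hlarge, hBA.eventually_le (hPPT L false true) k,
    hBA.eventually_le (hPPT L true true) k, eventually_gt_atTop 0] with κ hqκ hkκ hn h₀ h₁ hκ
  by_contra! hcon
  obtain ⟨hpos, hcard, hmany, hprod⟩ := parameters_admissible hβ₀ hβ₁ hL hn
  obtain ⟨i₀, hi₀⟩ := Finset.card_pos.1 hpos
  have hn₀ : 0 < H.parties κ := i₀.pos
  -- An isolation probability bounded below by `1 / q` forces `q > 0`; the empty corrupted set
  -- witnesses it.
  have hq₀ : 0 < q.eval κ := by
    rw [Nat.pos_iff_ne_zero]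
    intro h
    simpa [h] using hqκ ∅ (by simp; positivity) i₀ (Finset.notMem_empty _)
  have hδ : 1 / (κ : ℝ) ^ k ≤ 1 / (48 * H.parties κ ^ 2 * q.eval κ : ℕ) := by
    have hpos' : 0 < 48 * H.parties κ ^ 2 * q.eval κ := by positivity
    gcongr
    have : 48 * H.parties κ ^ 2 * q.eval κ ≤ κ ^ k := by
      refine le_trans ?_ hkκ
      simp only [Polynomial.eval_mul, Polynomial.eval_pow, Polynomial.eval_ofNat]
      gcongr
      exact hp κ
    exact_mod_cast this
  refine false_of_bounds (H := H) (π := π) (ζ := 1 / (24 * H.parties κ : ℕ)) hpos hcard hmany hprod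
    (Nat.mul_div_le _ _) ?_ (fun b i hi j => ?_) fun b i hi x => ?_
  · rw [mul_one_div]
    refine ENNReal.div_le_of_le_mul ?_
    rw [Nat.cast_mul, ← mul_assoc, Nat.cast_ofNat, one_div,
      ENNReal.inv_mul_cancel (by norm_num) (by finiteness), one_mul]
  -- The negated conclusion bounds the probability of many messages for all inputs and parties, in
  -- particular for constant inputs.
  · refine Pr_ideal_le hi hq₀ (fun I hI => hqκ I hI i) (fun o ho => ho.1) (le_trans ?_
      ((hcon (fun _ => b) j).le.trans hδ))
    refine ENNReal.toReal_mono (Pr_ne_top _ _)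
      (Pr_mono _ fun o ho => ⟨ho.1, ho.2.1, ?_⟩)
    exact (o.messagesSent_trim ho.2.1) ▸ ho.2.2
  · refine Pr_ideal_le hi hq₀ (fun I hI => hqκ I hI i) (fun o ho => ho.1) (le_trans ?_ hδ)
    have hset : Outcome.trim ⁻¹' {o : Outcome (H.parties κ) |
        (o.corrupted.card : ℝ) ≤ β * H.parties κ ∧ ¬ o.Correct x} =
        {o | (o.corrupted.card : ℝ) ≤ β * H.parties κ ∧ ¬ o.Correct x} := by
      ext o
      exact and_congr_right fun _ => not_congr (o.correct_trim x)
    rw [hset]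
    cases b
    · exact h₀ x
    · exact h₁ x
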